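/- **Theorem 2.** Let $d\ge 1$, let $m_{\mathrm B}\in\mathbb R^d$, let $\Sigma_{\mathrm B}\in\mathbb R^{d\times d}$ be symmetric positive definite, and let $\mu_{\mathrm B}=\mathcal N(m_{\mathrm B},\Sigma_{\mathrm B})$, with density $\rho_{\mathrm B}=\frac{\mathrm d\mu_{\mathrm B}}{\mathrm dx}$. Let $\rho_*$ be a probability density on $\mathbb R^d$ with $\rho_*\log\rho_*\in L^1(\mathbb R^d)$, such that $\rho_*>0$ almost everywhere and $\log\rho_*\in L^1_{\mathrm{loc}}(\mathbb R^d)$ (for example, $\rho_*$ is bounded below by a positive constant on every ball), and such that for some $M>0$ and $\sigma_\bullet>0$ $$\rho_*(x)\ \ge\ \frac{1}{(2\pi\sigma_\bullet^2)^{d/2}}\,e^{-\|x\|^2/(2\sigma_\bullet^2)}\qquad\text{for all }\|x\|\ge M .$$ Put $\mu_*=\rho_*\,\mathrm dx$. Then for every $T>0$ and every $\varepsilon>0$ there is a control $\theta=(w,a,b):[0,T]\to\mathbb R^d\times\mathbb R^d\times\mathbb R$, piecewise constant with finitely many switches, such that the following holds. Let $v(x,\theta)=w\,(a^\top x+b)_+$,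 where $(s)_+=\max\{s,0\}$, let $\Phi_\theta^T:\mathbb R^d\to\mathbb R^d$ be the time-$T$ flow map of $\dot x(t)=v(x(t),\theta(t))$, and let $\rho\in C^0([0,T];L^1(\mathbb R^d))\cap L^\infty([0,T]\times\mathbb R^d)$ be the weak solution of $$\partial_t\rho(t,x)+\operatorname{div}\big(v(x,\theta(t))\,\rho(t,x)\big)=0\ \text{ in }[0,T]\times\mathbb R^d,\qquad \rho(0,\cdot)=\rho_{\mathrm B}.$$ Then $\rho(T,\cdot)$ is the density of $\Phi^T_{\theta\#}\mu_{\mathrm B}$, and $$\int_{\mathbb R^d}\rho(T,x)\log\frac{\rho(T,x)}{\rho_*(x)}\,\mathrm dx\le\varepsilon ,\qquad\text{equivalently}\qquad \mathsf{KL}\big(\Phi^T_{\theta\#}\mu_{\mathrm B}\,\big\|\,\mu_*\big)\le\varepsilon .$$ -/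

import Mathlib

open MeasureTheory Filter Topology
open scoped ContDiff

namespace NeuralTransport

/-- Parameters `(w, a, b)` of one neuron: `θ.1 = w`, `θ.2.1 = a`, `θ.2.2 = b`. -/
abbrev Param (d : ℕ) : Type :=
  EuclideanSpace ℝ (Fin d) × EuclideanSpace ℝ (Fin d) × ℝ

/-- The perceptron velocity field `v(x, (w, a, b)) = (a · x + b)₊ w`. -/
noncomputable def velocity {d : ℕ} (x : EuclideanSpace ℝ (Fin d)) (θ : Param d) :
    EuclideanSpace ℝ (Fin d) :=
  max (inner ℝ θ.2.1 x + θ.2.2) 0 • θ.1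

/-- `θ` is piecewise constant on `[0, T]` with finitely many switches: there are
`0 = t₀ < t₁ < ⋯ < t_K = T` such that `θ` is constant on each `[t_{k-1}, t_k)`. -/
def IsPiecewiseConstant {d : ℕ} (T : ℝ) (θ : ℝ → Param d) : Prop :=
  ∃ (K : ℕ) (t : Fin (K + 1) → ℝ) (c : Fin K → Param d),
    StrictMono t ∧ t 0 = 0 ∧ t (Fin.last K) = T ∧
      ∀ k : Fin K, ∀ s ∈ Set.Ico (t k.castSucc) (t k.succ), θ s = c k

/-- `Φ` is the flow on `[0, T]` of `x'(t) = v(x(t), θ(t))`, `x(0) = x`, the equation being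
understood in integrated form since `θ` is allowed to jump. -/
def IsFlow {d : ℕ} (T : ℝ) (θ : ℝ → Param d)
    (Φ : ℝ → EuclideanSpace ℝ (Fin d) → EuclideanSpace ℝ (Fin d)) : Prop :=
  ∀ x, ContinuousOn (fun t => Φ t x) (Set.Icc 0 T) ∧
    ∀ t ∈ Set.Icc 0 T, Φ t x = x + ∫ s in (0 : ℝ)..t, velocity (Φ s x) (θ s)

/-- `ρ` is a weak solution on `[0, T]` of `∂ₜρ + div(v(x, θ(t)) ρ) = 0`, `ρ(0) = ρ₀`, which is
continuous in time with values in `L¹` and bounded in `L^∞`. -/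
structure IsContinuitySolution {d : ℕ} (T : ℝ) (θ : ℝ → Param d)
    (ρ₀ : EuclideanSpace ℝ (Fin d) → ℝ) (ρ : ℝ → EuclideanSpace ℝ (Fin d) → ℝ) : Prop where
  integrable : ∀ t ∈ Set.Icc 0 T, Integrable (ρ t)
  bounded : ∃ C : ℝ, ∀ t ∈ Set.Icc 0 T, ∀ᵐ x, |ρ t x| ≤ C
  continuous : ∀ t ∈ Set.Icc 0 T,
    Tendsto (fun s => ∫ x, |ρ s x - ρ t x|) (𝓝[Set.Icc 0 T] t) (𝓝 0)
  initial : ρ 0 =ᵐ[volume] ρ₀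
  weak : ∀ φ : EuclideanSpace ℝ (Fin d) → ℝ, ContDiff ℝ ∞ φ → HasCompactSupport φ →
    ∀ t ∈ Set.Icc 0 T,
      ∫ x, φ x * ρ t x = (∫ x, φ x * ρ₀ x) +
        ∫ s in (0 : ℝ)..t, ∫ x, fderiv ℝ φ x (velocity x (θ s)) * ρ s x

/-- Probability densities with respect to Lebesgue measure. -/
structure IsProbDensity {d : ℕ} (ρ : EuclideanSpace ℝ (Fin d) → ℝ) : Prop where
  nonneg : ∀ x, 0 ≤ ρ x
  integrable : Integrable ρ
  integral_eq_one : ∫ x, ρ x = 1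

/-- The measure `ρ dx`. -/
noncomputable def densityMeasure {d : ℕ} (ρ : EuclideanSpace ℝ (Fin d) → ℝ) :
    Measure (EuclideanSpace ℝ (Fin d)) :=
  volume.withDensity fun x => ENNReal.ofReal (ρ x)

/-- The density of the centered Gaussian with covariance `σ² I`. -/
noncomputable def isoGaussianDensity {d : ℕ} (σ : ℝ) (x : EuclideanSpace ℝ (Fin d)) : ℝ :=
  1 / (2 * Real.pi * σ ^ 2) ^ ((d : ℝ) / 2) * Real.exp (-‖x‖ ^ 2 / (2 * σ ^ 2))

end NeuralTransport

open NeuralTransport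

namespace NeuralTransport

variable {d : ℕ}

/-! Let `r` be an everywhere positive version of the target density, and let `klInf r p` be the
infimum of KL(F_# p ‖ r) over the group generated by the flows of single neurons. Every element of
this group is reached by a piecewise constant control in any prescribed time (`steerable_of_mem`),
because rescaling `w` rescales time and controls can be concatenated. So the theorem reduces to
`klInf r g = 0` for the Gaussian density `g`.

The infimum is easier to handle than an explicit control because it tolerates limits. For fixed F,
the map p ↦ KL(F_# p ‖ r) is continuous under a.e. convergence dominated by a Gaussian: the tail
bound and the local integrability of log ρ_* make log r integrable against every Gaussian. An
infimum of continuous functionals is upper semicontinuous (`le_klInf_of_tendsto`), so limits of flow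
maps may be used even when they are discontinuous.

The basic limit is a stretching along e_j of the column above a box, everything else staying fixed.
It arises by conjugating a one-coordinate stretching with shears along e_j whose size vanishes over
the cell and diverges off it. The inverse is of the same kind, so `klInf` is exactly invariant
(`klInf_stretch`). Three stretchings, based at the bottom, middle and top of a box where the density
is constant, move mass between the two halves and restore everything above (`stretch_split`).
Iterating over bisections turns the constant into any positive step function on dyadic sub-boxes
with the same mean (`klInf_stepTree`).

Two positive continuous densities with equal mass in a box are there, up to a factor e^η, step
functions reached from one and the same constant, and relative entropy is stable under such factors
(`klInf_le_of_ratio`). Letting η tend to 0, the box grow and the competitor lose its continuity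
gives `klInf r g ≤ klInf r q` for every `q` with Gaussian decay and the mass of `g`
(`klInf_le_of_isDom`). Finally take q = min(r, (n+1) e^{-|x|²}) / Z_n: since q/r ≤ 1/Z_n, its
relative entropy is at most -log Z_n, which tends to 0 (`klInf_eq_zero`). -/

/-! ### Explicit flow of a single neuron -/

/-- `∫₀ᵗ e^{l s} ds`. -/
noncomputable def expInt (l t : ℝ) : ℝ := ∫ s in (0 : ℝ)..t, Real.exp (l * s)

lemma hasDerivAt_expInt (l t : ℝ) : HasDerivAt (expInt l) (Real.exp (l * t)) t := by
  have hc : Continuous fun s : ℝ => Real.exp (l * s) := by fun_prop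
  exact intervalIntegral.integral_hasDerivAt_right (hc.intervalIntegrable _ _)
    hc.stronglyMeasurable.stronglyMeasurableAtFilter hc.continuousAt

@[simp] lemma expInt_zero (l : ℝ) : expInt l 0 = 0 := by simp [expInt]

@[simp] lemma expInt_zero_left (t : ℝ) : expInt 0 t = t := by simp [expInt]

lemma continuous_expInt (l : ℝ) : Continuous (expInt l) :=
  continuous_iff_continuousAt.2 fun t => (hasDerivAt_expInt l t).continuousAt

/-- Avoiding division by `l` treats the shears, where the rate vanishes, together with the
stretchings. -/
lemma mul_expInt (l t : ℝ) : l * expInt l t = Real.exp (l * t) - 1 := by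
  simp [expInt]

lemma expInt_add (l s t : ℝ) : expInt l (s + t) = expInt l s + Real.exp (l * s) * expInt l t := by
  have hc : Continuous fun s : ℝ => Real.exp (l * s) := by fun_prop
  unfold expInt
  rw [← intervalIntegral.integral_add_adjacent_intervals (b := s) (hc.intervalIntegrable _ _)
    (hc.intervalIntegrable _ _), ← intervalIntegral.integral_const_mul]
  congr 1
  have := intervalIntegral.integral_comp_add_left (a := 0) (b := t)
    (fun u => Real.exp (l * u)) s
  rw [add_zero] at this
  rw [← this]
  congr 1
  ext u
  rw [← Real.exp_add]
  ring_nf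

/-- The growth rate `a · w` of the pre-activation under the flow. -/
noncomputable def rate (θ : Param d) : ℝ := inner ℝ θ.2.1 θ.1

/-- The pre-activation `a · x + b`. -/
noncomputable def preact (θ : Param d) (x : EuclideanSpace ℝ (Fin d)) : ℝ :=
  inner ℝ θ.2.1 x + θ.2.2

/-- The flow of the vector field `velocity · θ`. -/
noncomputable def flowMap (θ : Param d) (t : ℝ) (x : EuclideanSpace ℝ (Fin d)) :
    EuclideanSpace ℝ (Fin d) :=
  x + (expInt (rate θ) t * max (preact θ x) 0) • θ.1

lemma velocity_eq (θ : Param d) (x : EuclideanSpace ℝ (Fin d)) :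
    velocity x θ = max (preact θ x) 0 • θ.1 := rfl

@[fun_prop] lemma continuous_preact (θ : Param d) : Continuous (preact θ) := by
  unfold preact; fun_prop

lemma continuous_velocity (θ : Param d) : Continuous fun x => velocity x θ := by
  simp only [velocity_eq]; fun_prop

lemma continuous_flowMap_uncurry (θ : Param d) :
    Continuous fun z : ℝ × EuclideanSpace ℝ (Fin d) => flowMap θ z.1 z.2 := by
  have := continuous_expInt (rate θ)
  unfold flowMap; fun_prop

/-- Along a trajectory the pre-activation solves the scalar equation y' = (a·w) y₊: it grows
exponentially when positive and is frozen otherwise. Hence its sign never changes, which makes the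
flow explicit. -/
lemma preact_flowMap (θ : Param d) (t : ℝ) (x : EuclideanSpace ℝ (Fin d)) :
    preact θ (flowMap θ t x) =
      preact θ x + (Real.exp (rate θ * t) - 1) * max (preact θ x) 0 := by
  rw [← mul_expInt]
  simp only [preact, flowMap, inner_add_right, real_inner_smul_right, rate]
  ring

lemma preact_flowMap_of_nonneg (θ : Param d) (t : ℝ) {x : EuclideanSpace ℝ (Fin d)}
    (h : 0 ≤ preact θ x) : preact θ (flowMap θ t x) = Real.exp (rate θ * t) * preact θ x := by
  rw [preact_flowMap, max_eq_left h]; ring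

lemma flowMap_of_nonpos (θ : Param d) (t : ℝ) {x : EuclideanSpace ℝ (Fin d)}
    (h : preact θ x ≤ 0) : flowMap θ t x = x := by
  simp [flowMap, max_eq_right h]

lemma max_preact_flowMap (θ : Param d) (t : ℝ) (x : EuclideanSpace ℝ (Fin d)) :
    max (preact θ (flowMap θ t x)) 0 = Real.exp (rate θ * t) * max (preact θ x) 0 := by
  rcases le_total 0 (preact θ x) with h | h
  · rw [preact_flowMap_of_nonneg θ t h, max_eq_left h, max_eq_left (by positivity)]
  · rw [flowMap_of_nonpos θ t h, max_eq_right h, mul_zero]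

lemma preact_flowMap_nonneg_iff (θ : Param d) (t : ℝ) (x : EuclideanSpace ℝ (Fin d)) :
    0 ≤ preact θ (flowMap θ t x) ↔ 0 ≤ preact θ x := by
  rcases le_total 0 (preact θ x) with h | h
  · rw [preact_flowMap_of_nonneg θ t h]
    exact ⟨fun _ => h, fun _ => by positivity⟩
  · rw [flowMap_of_nonpos θ t h]

lemma flowMap_flowMap (θ : Param d) (s t : ℝ) (x : EuclideanSpace ℝ (Fin d)) :
    flowMap θ s (flowMap θ t x) = flowMap θ (t + s) x := by
  conv_lhs => rw [flowMap, max_preact_flowMap, flowMap]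
  rw [flowMap, expInt_add, add_assoc, ← add_smul]
  congr 2; ring

@[simp] lemma flowMap_zero (θ : Param d) (x : EuclideanSpace ℝ (Fin d)) : flowMap θ 0 x = x := by
  simp [flowMap]

/-- The time-`t` flow map as a homeomorphism. -/
noncomputable def flowHomeo (θ : Param d) (t : ℝ) :
    EuclideanSpace ℝ (Fin d) ≃ₜ EuclideanSpace ℝ (Fin d) where
  toFun := flowMap θ t
  invFun := flowMap θ (-t)
  left_inv x := by simp [flowMap_flowMap]
  right_inv x := by simp [flowMap_flowMap]
  continuous_toFun := (continuous_flowMap_uncurry θ).comp (by fun_prop : Continuous fun x => (t, x))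
  continuous_invFun :=
    (continuous_flowMap_uncurry θ).comp (by fun_prop : Continuous fun x => (-t, x))

@[simp] lemma flowHomeo_apply (θ : Param d) (t : ℝ) (x : EuclideanSpace ℝ (Fin d)) :
    flowHomeo θ t x = flowMap θ t x := rfl

@[simp] lemma flowHomeo_symm_apply (θ : Param d) (t : ℝ) (x : EuclideanSpace ℝ (Fin d)) :
    (flowHomeo θ t).symm x = flowMap θ (-t) x := rfl

lemma hasDerivAt_flowMap (θ : Param d) (t : ℝ) (x : EuclideanSpace ℝ (Fin d)) :
    HasDerivAt (fun s => flowMap θ s x) (velocity (flowMap θ t x) θ) t := by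
  rw [velocity_eq, max_preact_flowMap]
  exact (((hasDerivAt_expInt (rate θ) t).mul_const _).smul_const θ.1).const_add x

/-! ### Jacobians -/

/-- `J` is the density of the image of Lebesgue measure under `F`. -/
structure HasJac (F : EuclideanSpace ℝ (Fin d) ≃ₜ EuclideanSpace ℝ (Fin d))
    (J : EuclideanSpace ℝ (Fin d) → ℝ) : Prop where
  measurable : Measurable J
  nonneg : ∀ y, 0 ≤ J y
  bounded : ∃ C, ∀ y, J y ≤ C
  map_volume : volume.map F = densityMeasure J

lemma densityMeasure_apply (p : EuclideanSpace ℝ (Fin d) → ℝ) {s : Set (EuclideanSpace ℝ (Fin d))}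
    (hs : MeasurableSet s) : densityMeasure p s = ∫⁻ x in s, ENNReal.ofReal (p x) :=
  withDensity_apply _ hs

lemma HasJac.map_densityMeasure {F : EuclideanSpace ℝ (Fin d) ≃ₜ EuclideanSpace ℝ (Fin d)}
    {J : EuclideanSpace ℝ (Fin d) → ℝ} (hF : HasJac F J) {p : EuclideanSpace ℝ (Fin d) → ℝ}
    (hp : Measurable p) :
    (densityMeasure p).map F = densityMeasure fun y => p (F.symm y) * J y := by
  have hFm : Measurable F := F.continuous.measurable
  have hFs : Measurable F.symm := F.symm.continuous.measurable
  ext s hs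
  rw [Measure.map_apply hFm hs, densityMeasure_apply _ (hFm hs), densityMeasure_apply _ hs]
  have h1 : ∫⁻ x in F ⁻¹' s, ENNReal.ofReal (p x) =
      ∫⁻ y in s, ENNReal.ofReal (p (F.symm y)) ∂(volume.map F) := by
    rw [setLIntegral_map hs (by fun_prop) hFm]
    simp
  rw [h1, hF.map_volume, densityMeasure, setLIntegral_withDensity_eq_setLIntegral_mul _
    hF.measurable.ennreal_ofReal (by fun_prop) hs]
  refine lintegral_congr fun y => ?_
  rw [Pi.mul_apply, mul_comm (p _), ENNReal.ofReal_mul (hF.nonneg y)]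

lemma HasJac.trans {F F' : EuclideanSpace ℝ (Fin d) ≃ₜ EuclideanSpace ℝ (Fin d)}
    {J J' : EuclideanSpace ℝ (Fin d) → ℝ} (hF : HasJac F J) (hF' : HasJac F' J') :
    HasJac (F.trans F') fun y => J (F'.symm y) * J' y where
  measurable := (hF.measurable.comp F'.symm.continuous.measurable).mul hF'.measurable
  nonneg y := mul_nonneg (hF.nonneg _) (hF'.nonneg _)
  bounded := by
    obtain ⟨C, hC⟩ := hF.bounded
    obtain ⟨C', hC'⟩ := hF'.bounded
    exact ⟨C * C', fun y => mul_le_mul (hC _) (hC' _) (hF'.nonneg _)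
      ((hF.nonneg y).trans (hC y))⟩
  map_volume := by
    rw [← hF'.map_densityMeasure hF.measurable, ← hF.map_volume,
      Measure.map_map F'.continuous.measurable F.continuous.measurable]
    rfl

/-- The density of the image of Lebesgue measure under the flow map. -/
noncomputable def flowJac (θ : Param d) (t : ℝ) (y : EuclideanSpace ℝ (Fin d)) : ℝ :=
  if 0 ≤ preact θ y then Real.exp (-(rate θ * t)) else 1

lemma measurableSet_preact (θ : Param d) : MeasurableSet {y | 0 ≤ preact θ y} :=
  measurableSet_le measurable_const (continuous_preact θ).measurable

lemma measurable_flowJac (θ : Param d) (t : ℝ) : Measurable (flowJac θ t) :=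
  Measurable.ite (measurableSet_preact θ) measurable_const measurable_const

lemma flowJac_pos (θ : Param d) (t : ℝ) (y : EuclideanSpace ℝ (Fin d)) : 0 < flowJac θ t y := by
  unfold flowJac; split_ifs <;> positivity

lemma flowJac_le (θ : Param d) (t : ℝ) (y : EuclideanSpace ℝ (Fin d)) :
    flowJac θ t y ≤ Real.exp (|rate θ| * |t|) := by
  unfold flowJac
  split_ifs
  · rw [← abs_mul]
    exact Real.exp_le_exp.2 (neg_le_abs _)
  · exact Real.one_le_exp (by positivity)

/-- On the invariant half-space of nonnegative pre-activation the flow is a transvection followed by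
a translation, with determinant 1 + (a·w) ∫₀ᵗ e^{(a·w)s} ds = e^{(a·w)t}. -/
lemma volume_preimage_flowMap_pos (θ : Param d) (t : ℝ) {s : Set (EuclideanSpace ℝ (Fin d))}
    (hs : s ⊆ {y | 0 ≤ preact θ y}) :
    volume (flowMap θ t ⁻¹' s) = ENNReal.ofReal (Real.exp (-(rate θ * t))) * volume s := by
  set f : Module.Dual ℝ (EuclideanSpace ℝ (Fin d)) := (innerSL ℝ θ.2.1).toLinearMap with hf
  set L := LinearMap.transvection f (expInt (rate θ) t • θ.1) with hL
  have hdet : LinearMap.det L = Real.exp (rate θ * t) := by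
    rw [hL, LinearMap.transvection.det, hf]
    have := mul_expInt (rate θ) t
    have h2 : (innerSL ℝ θ.2.1).toLinearMap (expInt (rate θ) t • θ.1)
        = expInt (rate θ) t * rate θ := by
      simp [rate]
    rw [h2]; linarith
  have hset : flowMap θ t ⁻¹' s =
      L ⁻¹' ((fun y => y + (expInt (rate θ) t * θ.2.2) • θ.1) ⁻¹' s) := by
    have haff : ∀ x, 0 ≤ preact θ x →
        flowMap θ t x = L x + (expInt (rate θ) t * θ.2.2) • θ.1 := by
      intro x hx
      rw [flowMap, max_eq_left hx, hL, LinearMap.transvection.apply, hf, preact]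
      simp only [ContinuousLinearMap.coe_coe, innerSL_apply_apply]
      module
    ext x
    simp only [Set.mem_preimage]
    constructor
    · intro hx
      rwa [← haff x ((preact_flowMap_nonneg_iff θ t x).1 (hs hx))]
    · intro hx
      have h0 : 0 ≤ preact θ x := by
        have h1 := hs hx
        have h2 : preact θ (L x + (expInt (rate θ) t * θ.2.2) • θ.1) =
            Real.exp (rate θ * t) * preact θ x := by
          have := mul_expInt (rate θ) t
          rw [hL, LinearMap.transvection.apply, hf, preact, preact]
          simp only [ContinuousLinearMap.coe_coe, innerSL_apply_apply, inner_add_right,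
            real_inner_smul_right]
          change _ + _ * (_ * rate θ) + _ * rate θ + _ = _
          linear_combination (inner ℝ θ.2.1 x + θ.2.2) * this
        simp only [Set.mem_ofPred_eq] at h1
        rw [h2] at h1
        exact nonneg_of_mul_nonneg_right h1 (Real.exp_pos _)
      rwa [haff x h0]
  rw [hset, Measure.addHaar_preimage_linearMap _ (by rw [hdet]; positivity), hdet,
    measure_preimage_add_right, abs_of_pos (by positivity), Real.exp_neg]

lemma hasJac_flowHomeo (θ : Param d) (t : ℝ) : HasJac (flowHomeo θ t) (flowJac θ t) where
  measurable := measurable_flowJac θ t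
  nonneg y := (flowJac_pos θ t y).le
  bounded := ⟨_, flowJac_le θ t⟩
  map_volume := by
    have hFm : Measurable (flowHomeo θ t) := (flowHomeo θ t).continuous.measurable
    have hP := measurableSet_preact θ
    ext s hs
    rw [Measure.map_apply hFm hs, densityMeasure_apply _ hs,
      ← measure_inter_add_sdiff _ (hFm hP), ← lintegral_inter_add_sdiff _ s hP]
    congr 1
    · rw [← Set.preimage_inter]
      refine (volume_preimage_flowMap_pos θ t Set.inter_subset_right).trans ?_
      rw [setLIntegral_congr_fun (hs.inter hP)
        (g := fun _ => ENNReal.ofReal (Real.exp (-(rate θ * t)))), setLIntegral_const]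
      intro y hy
      have : 0 ≤ preact θ y := hy.2
      simp [flowJac, this]
    · rw [← Set.preimage_sdiff, setLIntegral_congr_fun (hs.diff hP) (g := fun _ => 1),
        setLIntegral_const, one_mul]
      · congr 1
        ext x
        simp only [Set.mem_preimage, flowHomeo_apply]
        by_cases hx : preact θ x ≤ 0
        · rw [flowMap_of_nonpos θ t hx]
        · have h1 := (preact_flowMap_nonneg_iff θ t x).2 (not_le.1 hx).le
          have h2 := (not_le.1 hx).le
          simp [h1, h2]
      · intro y hy
        have : ¬ 0 ≤ preact θ y := hy.2
        simp [flowJac, this]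

/-! ### Solutions of the continuity equation driven by a control -/

/-- Bounded nonnegative integrable initial data. -/
structure IsNice (p : EuclideanSpace ℝ (Fin d) → ℝ) : Prop where
  measurable : Measurable p
  nonneg : ∀ x, 0 ≤ p x
  integrable : Integrable p
  bounded : ∃ C, ∀ x, p x ≤ C

lemma HasJac.lintegral_push {F : EuclideanSpace ℝ (Fin d) ≃ₜ EuclideanSpace ℝ (Fin d)}
    {J : EuclideanSpace ℝ (Fin d) → ℝ} (hF : HasJac F J)
    {f : EuclideanSpace ℝ (Fin d) → ENNReal} (hf : Measurable f) :
    ∫⁻ y, f (F.symm y) * ENNReal.ofReal (J y) = ∫⁻ x, f x := by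
  have hFm : Measurable F := F.continuous.measurable
  have hFs : Measurable F.symm := F.symm.continuous.measurable
  have h := lintegral_map (μ := volume) (f := fun y => f (F.symm y)) (by fun_prop) hFm
  simp only [Homeomorph.symm_apply_apply] at h
  rw [← h, hF.map_volume, densityMeasure, lintegral_withDensity_eq_lintegral_mul _
    hF.measurable.ennreal_ofReal (by fun_prop)]
  refine lintegral_congr fun y => ?_
  rw [Pi.mul_apply, mul_comm]

lemma HasJac.integral_push {F : EuclideanSpace ℝ (Fin d) ≃ₜ EuclideanSpace ℝ (Fin d)}
    {J : EuclideanSpace ℝ (Fin d) → ℝ} (hF : HasJac F J) (f : EuclideanSpace ℝ (Fin d) → ℝ) :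
    ∫ y, f (F.symm y) * J y = ∫ x, f x := by
  have h := (F.measurableEmbedding).integral_map (μ := volume) (fun y => f (F.symm y))
  simp only [Homeomorph.symm_apply_apply] at h
  rw [← h, hF.map_volume, densityMeasure, integral_withDensity_eq_integral_toReal_smul
    hF.measurable.ennreal_ofReal (ae_of_all _ fun _ => ENNReal.ofReal_lt_top)]
  refine integral_congr_ae (ae_of_all _ fun y => ?_)
  simp [ENNReal.toReal_ofReal (hF.nonneg y), mul_comm]

lemma HasJac.integrable_push {F : EuclideanSpace ℝ (Fin d) ≃ₜ EuclideanSpace ℝ (Fin d)}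
    {J : EuclideanSpace ℝ (Fin d) → ℝ} (hF : HasJac F J) {f : EuclideanSpace ℝ (Fin d) → ℝ}
    (hf : Integrable f) : Integrable fun y => f (F.symm y) * J y := by
  have h := (F.measurableEmbedding).integrable_map_iff (μ := volume) (g := fun y => f (F.symm y))
  have h2 : (fun y => f (F.symm y)) ∘ F = f := by ext; simp
  rw [h2] at h
  have h3 := h.2 hf
  rw [hF.map_volume, densityMeasure, integrable_withDensity_iff_integrable_smul'
    hF.measurable.ennreal_ofReal (ae_of_all _ fun _ => ENNReal.ofReal_lt_top)] at h3
  refine h3.congr (ae_of_all _ fun y => ?_)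
  simp [ENNReal.toReal_ofReal (hF.nonneg y), mul_comm]

lemma IsNice.push {F : EuclideanSpace ℝ (Fin d) ≃ₜ EuclideanSpace ℝ (Fin d)}
    {J p : EuclideanSpace ℝ (Fin d) → ℝ} (hF : HasJac F J) (hp : IsNice p) :
    IsNice fun y => p (F.symm y) * J y where
  measurable := (hp.measurable.comp F.symm.continuous.measurable).mul hF.measurable
  nonneg y := mul_nonneg (hp.nonneg _) (hF.nonneg _)
  integrable := hF.integrable_push hp.integrable
  bounded := by
    obtain ⟨C, hC⟩ := hp.bounded
    obtain ⟨C', hC'⟩ := hF.bounded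
    exact ⟨C * C', fun y => mul_le_mul (hC _) (hC' _) (hF.nonneg _)
      ((hp.nonneg y).trans (hC y))⟩

/-- The density at time `t` of the image of `p` under the flow of a single neuron. -/
noncomputable def flowDensity (θ : Param d) (p : EuclideanSpace ℝ (Fin d) → ℝ) (t : ℝ)
    (y : EuclideanSpace ℝ (Fin d)) : ℝ :=
  p (flowMap θ (-t) y) * flowJac θ t y

lemma flowDensity_zero (θ : Param d) (p : EuclideanSpace ℝ (Fin d) → ℝ) :
    flowDensity θ p 0 = p := by
  ext y; simp [flowDensity, flowJac]

lemma flowDensity_add (θ : Param d) (p : EuclideanSpace ℝ (Fin d) → ℝ) (s t : ℝ) :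
    flowDensity θ p (s + t) = flowDensity θ (flowDensity θ p s) t := by
  ext y
  simp only [flowDensity, flowMap_flowMap]
  have : flowJac θ (s + t) y = flowJac θ s (flowMap θ (-t) y) * flowJac θ t y := by
    simp only [flowJac, preact_flowMap_nonneg_iff]
    split_ifs
    · rw [← Real.exp_add]; ring_nf
    · simp
  rw [this, mul_assoc]
  ring_nf

lemma integrable_flowDensity (θ : Param d) {p : EuclideanSpace ℝ (Fin d) → ℝ}
    (hp : Integrable p) (t : ℝ) : Integrable (flowDensity θ p t) :=
  (hasJac_flowHomeo θ t).integrable_push hp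

lemma integral_abs_flowDensity (θ : Param d) (p : EuclideanSpace ℝ (Fin d) → ℝ) (t : ℝ) :
    ∫ y, |flowDensity θ p t y| = ∫ x, |p x| := by
  rw [← (hasJac_flowHomeo θ t).integral_push fun x => |p x|]
  congr 1; ext y
  rw [flowDensity, abs_mul, abs_of_pos (flowJac_pos θ t y)]; rfl

lemma flowDensity_sub (θ : Param d) (p q : EuclideanSpace ℝ (Fin d) → ℝ) (t : ℝ)
    (y : EuclideanSpace ℝ (Fin d)) : flowDensity θ (fun x => p x - q x) t y =
      flowDensity θ p t y - flowDensity θ q t y := by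
  simp only [flowDensity]; ring

lemma continuous_flowDensity_time (θ : Param d) {g : EuclideanSpace ℝ (Fin d) → ℝ}
    (hg : Continuous g) (y : EuclideanSpace ℝ (Fin d)) :
    Continuous fun t => flowDensity θ g t y := by
  have h1 : Continuous fun t : ℝ => flowMap θ (-t) y :=
    (continuous_flowMap_uncurry θ).comp (by fun_prop : Continuous fun t : ℝ => (-t, y))
  have h2 : Continuous fun t => flowJac θ t y := by
    unfold flowJac; split_ifs <;> fun_prop
  exact (hg.comp h1).mul h2

/-- Although the Jacobian jumps across a hyperplane, at each fixed point the density is continuous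
in time. For |t| ≤ 1 the supports stay in one compact set, so dominated convergence applies. -/
lemma tendsto_flowDensity_zero_of_compact (θ : Param d) {g : EuclideanSpace ℝ (Fin d) → ℝ}
    (hg : Continuous g) (hc : HasCompactSupport g) :
    Tendsto (fun t => ∫ x, |flowDensity θ g t x - g x|) (𝓝 0) (𝓝 0) := by
  obtain ⟨C, hC⟩ := hc.exists_bound_of_continuous hg
  set S := (fun z : ℝ × EuclideanSpace ℝ (Fin d) => flowMap θ z.1 z.2) ''
    (Set.Icc (-1) 1 ×ˢ tsupport g) with hS
  have hSc : IsCompact S := (isCompact_Icc.prod hc).image (continuous_flowMap_uncurry θ)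
  have hzero : ∀ t ∈ Set.Icc (-1 : ℝ) 1, ∀ x ∉ S, g (flowMap θ (-t) x) = 0 := by
    intro t ht x hx
    by_contra h
    refine hx ⟨(t, flowMap θ (-t) x), ⟨ht, subset_tsupport _ h⟩, ?_⟩
    simp [flowMap_flowMap]
  have hC0 : 0 ≤ C := (norm_nonneg _).trans (hC 0)
  have key : Tendsto (fun t => ∫ x, |flowDensity θ g t x - g x|) (𝓝 0)
      (𝓝 (∫ x, |flowDensity θ g 0 x - g x|)) := by
    refine tendsto_integral_filter_of_dominated_convergence
      (S.indicator fun _ => C * Real.exp |rate θ| + C) ?_ ?_ ?_ ?_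
    · refine Eventually.of_forall fun t => ?_
      have h1 : Measurable (flowDensity θ g t) :=
        (hg.measurable.comp (flowHomeo θ t).symm.continuous.measurable).mul (measurable_flowJac θ t)
      exact ((h1.sub hg.measurable).abs).aestronglyMeasurable
    · filter_upwards [Icc_mem_nhds (show (-1 : ℝ) < 0 by norm_num) one_pos] with t ht
      refine ae_of_all _ fun x => ?_
      by_cases hx : x ∈ S
      · rw [Set.indicator_of_mem hx, norm_abs_eq_norm]
        refine (norm_sub_le _ _).trans (add_le_add ?_ (hC x))
        rw [flowDensity, norm_mul]
        refine mul_le_mul (hC _) ?_ (norm_nonneg _) hC0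
        rw [Real.norm_of_nonneg (flowJac_pos θ t x).le]
        refine (flowJac_le θ t x).trans (Real.exp_le_exp.2 ?_)
        exact mul_le_of_le_one_right (abs_nonneg _) (abs_le.2 ht)
      · rw [Set.indicator_of_notMem hx, flowDensity, hzero t ht x hx]
        have := hzero 0 (by simp) x hx
        simp only [neg_zero, flowMap_zero] at this
        simp [this]
    · exact (integrable_indicator_iff hSc.measurableSet).2
        (integrableOn_const hSc.measure_lt_top.ne)
    · refine ae_of_all _ fun x => ?_
      have := continuous_flowDensity_time θ hg x
      exact ((this.sub continuous_const).abs).tendsto 0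
  simpa [flowDensity_zero] using key

/-- The push-forward is an isometry of L¹, so the error of a compactly supported continuous
approximation does not grow under the flow. -/
lemma tendsto_flowDensity_zero (θ : Param d) {p : EuclideanSpace ℝ (Fin d) → ℝ}
    (hp : Integrable p) :
    Tendsto (fun t => ∫ x, |flowDensity θ p t x - p x|) (𝓝 0) (𝓝 0) := by
  rw [Metric.tendsto_nhds]
  intro ε hε
  obtain ⟨g, hgc, hgp, hg, hgi⟩ := hp.exists_hasCompactSupport_integral_sub_le
    (show 0 < ε / 3 by positivity)
  have h3 := (Metric.tendsto_nhds.1 (tendsto_flowDensity_zero_of_compact θ hg hgc)) (ε / 3)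
    (by positivity)
  filter_upwards [h3] with t ht
  have hpos : 0 ≤ ∫ x, |flowDensity θ p t x - p x| := integral_nonneg fun _ => abs_nonneg _
  rw [Real.dist_0_eq_abs, abs_of_nonneg (integral_nonneg fun _ => abs_nonneg _)] at ht ⊢
  have i1 : Integrable fun x => |flowDensity θ (fun x => p x - g x) t x| :=
    (integrable_flowDensity θ (hp.sub hgi) t).abs
  have i2 : Integrable fun x => |flowDensity θ g t x - g x| :=
    ((integrable_flowDensity θ hgi t).sub hgi).abs
  have i3 : Integrable fun x => |p x - g x| := (hp.sub hgi).abs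
  have hle : ∫ x, |flowDensity θ p t x - p x| ≤
      ∫ x, (|flowDensity θ (fun x => p x - g x) t x| + |flowDensity θ g t x - g x| + |p x - g x|) := by
    refine integral_mono (((integrable_flowDensity θ hp t).sub hp).abs) ((i1.add i2).add i3)
      fun x => ?_
    simp only [flowDensity_sub]
    have h1 := abs_add_le (flowDensity θ p t x - flowDensity θ g t x + (flowDensity θ g t x - g x))
      (g x - p x)
    have h2 := abs_add_le (flowDensity θ p t x - flowDensity θ g t x) (flowDensity θ g t x - g x)
    rw [abs_sub_comm (g x)] at h1
    calc |flowDensity θ p t x - p x| = |flowDensity θ p t x - flowDensity θ g t x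
          + (flowDensity θ g t x - g x) + (g x - p x)| := by ring_nf
      _ ≤ _ := by linarith
  have hadd := integral_add (i1.add i2) i3
  simp only [Pi.add_apply] at hadd
  rw [hadd, integral_add i1 i2, integral_abs_flowDensity] at hle
  simp only [Real.norm_eq_abs] at hgp
  linarith

lemma tendsto_flowDensity (θ : Param d) {p : EuclideanSpace ℝ (Fin d) → ℝ}
    (hp : Integrable p) (t : ℝ) :
    Tendsto (fun s => ∫ x, |flowDensity θ p s x - flowDensity θ p t x|) (𝓝 t) (𝓝 0) := by
  have h := tendsto_flowDensity_zero θ (integrable_flowDensity θ hp t)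
  have h2 : Tendsto (fun s : ℝ => s - t) (𝓝 t) (𝓝 0) := by
    have : Continuous fun s : ℝ => s - t := by fun_prop
    simpa using this.tendsto t
  have h3 := h.comp h2
  refine h3.congr fun s => ?_
  simp only [Function.comp, ← flowDensity_add, add_sub_cancel]

/-- The data of a control on `[0, T]` whose flow ends at the map `F`, with the associated flow and
solution of the continuity equation. -/
structure Steers (T : ℝ) (F : EuclideanSpace ℝ (Fin d) → EuclideanSpace ℝ (Fin d))
    (ρ₀ : EuclideanSpace ℝ (Fin d) → ℝ) (θ : ℝ → Param d)
    (Φ : ℝ → EuclideanSpace ℝ (Fin d) → EuclideanSpace ℝ (Fin d))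
    (ρ : ℝ → EuclideanSpace ℝ (Fin d) → ℝ) : Prop where
  isPiecewiseConstant : IsPiecewiseConstant T θ
  isFlow : IsFlow T θ Φ
  velocity_integrable : ∀ x, IntervalIntegrable (fun s => velocity (Φ s x) (θ s)) volume 0 T
  isSolution : IsContinuitySolution T θ ρ₀ ρ
  flux_integrable : ∀ φ : EuclideanSpace ℝ (Fin d) → ℝ, ContDiff ℝ ∞ φ → HasCompactSupport φ →
    IntervalIntegrable (fun s => ∫ x, fderiv ℝ φ x (velocity x (θ s)) * ρ s x) volume 0 T
  flow_end : Φ T = F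
  nice_end : IsNice (ρ T)
  map_eq : (densityMeasure ρ₀).map F = densityMeasure (ρ T)

/-- `F` is the end point of a piecewise constant control in any prescribed time. -/
def Steerable (F : EuclideanSpace ℝ (Fin d) → EuclideanSpace ℝ (Fin d)) : Prop :=
  ∀ T : ℝ, 0 < T → ∀ ρ₀ : EuclideanSpace ℝ (Fin d) → ℝ, IsNice ρ₀ → ∃ θ Φ ρ, Steers T F ρ₀ θ Φ ρ

lemma continuous_flux (θ : Param d) {φ : EuclideanSpace ℝ (Fin d) → ℝ} (hφ : ContDiff ℝ ∞ φ) :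
    Continuous fun x => fderiv ℝ φ x (velocity x θ) :=
  (hφ.continuous_fderiv (by simp)).clm_apply (continuous_velocity θ)

lemma exists_flux_bound (θ : Param d) {φ : EuclideanSpace ℝ (Fin d) → ℝ} (hφ : ContDiff ℝ ∞ φ)
    (hc : HasCompactSupport φ) : ∃ C, ∀ x, ‖fderiv ℝ φ x (velocity x θ)‖ ≤ C := by
  refine HasCompactSupport.exists_bound_of_continuous ?_ (continuous_flux θ hφ)
  refine (hc.fderiv (𝕜 := ℝ)).mono fun x hx => ?_
  contrapose! hx
  simp only [Function.mem_support, not_not] at hx ⊢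
  simp [hx]

lemma integral_mul_flowDensity (θ : Param d) (p ψ : EuclideanSpace ℝ (Fin d) → ℝ) (t : ℝ) :
    ∫ x, ψ x * flowDensity θ p t x = ∫ x, ψ (flowMap θ t x) * p x := by
  rw [← (hasJac_flowHomeo θ t).integral_push fun x => ψ (flowMap θ t x) * p x]
  congr 1; ext y
  simp [flowMap_flowMap, flowDensity, mul_assoc]

lemma integrable_flux_uncurry (θ : Param d) {φ : EuclideanSpace ℝ (Fin d) → ℝ}
    (hφ : ContDiff ℝ ∞ φ) (hc : HasCompactSupport φ) {p : EuclideanSpace ℝ (Fin d) → ℝ}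
    (hp : IsNice p) (t : ℝ) :
    Integrable (Function.uncurry fun s x =>
      fderiv ℝ φ (flowMap θ s x) (velocity (flowMap θ s x) θ) * p x)
      ((volume.restrict (Set.uIoc 0 t)).prod volume) := by
  obtain ⟨C, hC⟩ := exists_flux_bound θ hφ hc
  have h1 : Integrable (fun z : ℝ × EuclideanSpace ℝ (Fin d) => p z.2)
      ((volume.restrict (Set.uIoc 0 t)).prod volume) := by
    have : IsFiniteMeasure (volume.restrict (Set.uIoc 0 t)) :=
      ⟨by simp [Set.uIoc]⟩
    exact hp.integrable.comp_snd _
  refine h1.bdd_mul (c := C) ?_ (ae_of_all _ fun z => hC _)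
  exact ((continuous_flux θ hφ).comp (continuous_flowMap_uncurry θ)).aestronglyMeasurable

lemma steers_const (θ : Param d) {T : ℝ} (hT : 0 < T) {ρ₀ : EuclideanSpace ℝ (Fin d) → ℝ}
    (h₀ : IsNice ρ₀) :
    Steers T (flowMap θ T) ρ₀ (fun _ => θ) (flowMap θ) (flowDensity θ ρ₀) where
  isPiecewiseConstant := by
    refine ⟨1, ![0, T], fun _ => θ, ?_, rfl, rfl, fun _ _ _ => rfl⟩
    intro i j hij
    fin_cases i <;> fin_cases j <;> simp_all
  isFlow x := by
    have hc : Continuous fun t => flowMap θ t x :=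
      (continuous_flowMap_uncurry θ).comp (by fun_prop : Continuous fun t : ℝ => (t, x))
    refine ⟨hc.continuousOn, fun t _ => ?_⟩
    have h := intervalIntegral.integral_eq_sub_of_hasDerivAt (a := 0) (b := t)
      (fun s _ => hasDerivAt_flowMap θ s x)
      (((continuous_velocity θ).comp hc).intervalIntegrable _ _)
    rw [h, flowMap_zero]; abel
  velocity_integrable x := by
    have hc : Continuous fun t => flowMap θ t x :=
      (continuous_flowMap_uncurry θ).comp (by fun_prop : Continuous fun t : ℝ => (t, x))
    exact ((continuous_velocity θ).comp hc).intervalIntegrable _ _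
  isSolution := by
    refine ⟨fun t _ => integrable_flowDensity θ h₀.integrable t, ?_, fun t _ =>
      (tendsto_flowDensity θ h₀.integrable t).mono_left nhdsWithin_le_nhds, ?_, ?_⟩
    · obtain ⟨C, hC⟩ := h₀.bounded
      have hC0 : 0 ≤ C := (h₀.nonneg 0).trans (hC 0)
      refine ⟨C * Real.exp (|rate θ| * T), fun t ht => ae_of_all _ fun x => ?_⟩
      rw [flowDensity, abs_mul, abs_of_nonneg (h₀.nonneg _), abs_of_pos (flowJac_pos θ t x)]
      refine mul_le_mul (hC _) ((flowJac_le θ t x).trans ?_) (flowJac_pos θ t x).le hC0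
      gcongr
      rw [abs_of_nonneg ht.1]; exact ht.2
    · rw [flowDensity_zero]
    · intro φ hφ hc t _
      -- Changing variables moves the flow onto the test function. The weak form is then the
      -- fundamental theorem of calculus along each trajectory, integrated against `ρ₀` with Fubini.
      simp_rw [integral_mul_flowDensity]
      rw [intervalIntegral_integral_swap (integrable_flux_uncurry θ hφ hc h₀ t)]
      obtain ⟨C, hC⟩ := hc.exists_bound_of_continuous hφ.continuous
      have hi : ∀ s, Integrable fun x => φ (flowMap θ s x) * ρ₀ x := fun s =>
        h₀.integrable.bdd_mul (c := C) ((hφ.continuous.comp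
          (flowHomeo θ s).continuous).aestronglyMeasurable) (ae_of_all _ fun z => hC _)
      have hi0 := hi 0
      simp only [flowMap_zero] at hi0
      rw [← sub_eq_iff_eq_add', ← integral_sub (hi t) hi0]
      congr 1; ext x
      have hcx : Continuous fun t => flowMap θ t x :=
        (continuous_flowMap_uncurry θ).comp (by fun_prop : Continuous fun t : ℝ => (t, x))
      have h := intervalIntegral.integral_eq_sub_of_hasDerivAt (a := 0) (b := t)
        (f := fun s => φ (flowMap θ s x))
        (f' := fun s => fderiv ℝ φ (flowMap θ s x) (velocity (flowMap θ s x) θ))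
        (fun s _ => ((hφ.differentiable (by simp) _).hasFDerivAt.comp_hasDerivAt s
          (hasDerivAt_flowMap θ s x)))
        (((continuous_flux θ hφ).comp hcx).intervalIntegrable _ _)
      rw [intervalIntegral.integral_mul_const, h, flowMap_zero]
      ring
  flux_integrable φ hφ hc := by
    simp_rw [integral_mul_flowDensity]
    exact intervalIntegrable_iff.2 (integrable_flux_uncurry θ hφ hc h₀ T).integral_prod_left
  flow_end := rfl
  nice_end := IsNice.push (hasJac_flowHomeo θ T) h₀
  map_eq := (hasJac_flowHomeo θ T).map_densityMeasure h₀.measurable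

/-! ### Concatenation of controls -/

/-- Follow `f` until time `T`, then `g`. -/
noncomputable def concat {α : Type*} (T : ℝ) (f g : ℝ → α) (s : ℝ) : α :=
  if s < T then f s else g (s - T)

lemma concat_of_lt {α : Type*} {T s : ℝ} (f g : ℝ → α) (h : s < T) : concat T f g s = f s :=
  if_pos h

lemma concat_of_ge {α : Type*} {T s : ℝ} (f g : ℝ → α) (h : T ≤ s) :
    concat T f g s = g (s - T) := if_neg h.not_gt

lemma concat_of_le {α : Type*} {T s : ℝ} {f g : ℝ → α} (hfg : g 0 = f T) (h : s ≤ T) :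
    concat T f g s = f s := by
  rcases h.lt_or_eq with h | rfl
  · exact concat_of_lt f g h
  · rw [concat_of_ge f g le_rfl, sub_self, hfg]

lemma integral_concat_left {V : Type*} [NormedAddCommGroup V] [NormedSpace ℝ V] {T t : ℝ}
    (u v : ℝ → V) (ht0 : 0 ≤ t) (ht : t ≤ T) :
    ∫ s in (0 : ℝ)..t, concat T u v s = ∫ s in (0 : ℝ)..t, u s :=
  intervalIntegral.integral_congr_Ioo_of_le ht0 fun _ hs => concat_of_lt u v (hs.2.trans_le ht)

lemma intervalIntegrable_concat_left {V : Type*} [NormedAddCommGroup V] {T : ℝ} (hT : 0 ≤ T)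
    {u : ℝ → V} (v : ℝ → V) (hu : IntervalIntegrable u volume 0 T) :
    IntervalIntegrable (concat T u v) volume 0 T := by
  rw [intervalIntegrable_iff_integrableOn_Ioo_of_le hT] at hu ⊢
  exact hu.congr_fun (fun s hs => (concat_of_lt u v hs.2).symm) measurableSet_Ioo

lemma intervalIntegrable_concat_right {V : Type*} [NormedAddCommGroup V] {T t : ℝ} (ht : T ≤ t)
    (u : ℝ → V) {v : ℝ → V} (hv : IntervalIntegrable v volume 0 (t - T)) :
    IntervalIntegrable (concat T u v) volume T t := by
  have h := hv.comp_sub_right T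
  simp only [zero_add, sub_add_cancel] at h
  rw [intervalIntegrable_iff_integrableOn_Ioo_of_le ht] at h ⊢
  exact h.congr_fun (fun s hs => (concat_of_ge u v hs.1.le).symm) measurableSet_Ioo

lemma integral_concat_right {V : Type*} [NormedAddCommGroup V] [NormedSpace ℝ V] {T t : ℝ}
    (hT : 0 ≤ T) (ht : T ≤ t) {u v : ℝ → V} (hu : IntervalIntegrable u volume 0 T)
    (hv : IntervalIntegrable v volume 0 (t - T)) :
    ∫ s in (0 : ℝ)..t, concat T u v s =
      (∫ s in (0 : ℝ)..T, u s) + ∫ s in (0 : ℝ)..(t - T), v s := by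
  rw [← intervalIntegral.integral_add_adjacent_intervals
    (intervalIntegrable_concat_left hT v hu) (intervalIntegrable_concat_right ht u hv),
    integral_concat_left u v hT le_rfl]
  congr 1
  have h := intervalIntegral.integral_comp_sub_right (a := T) (b := t) v T
  rw [sub_self] at h
  rw [← h]
  exact intervalIntegral.integral_congr_Ioo_of_le ht fun s hs => concat_of_ge u v hs.1.le

lemma IsPiecewiseConstant.concat_const {T T' : ℝ} (hT' : 0 < T') {θ : ℝ → Param d}
    (h : IsPiecewiseConstant T θ) (θ' : Param d) :
    IsPiecewiseConstant (T + T') (concat T θ fun _ => θ') := by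
  obtain ⟨K, t, c, hmono, h0, hlast, hc⟩ := h
  refine ⟨K + 1, Fin.snoc (α := fun _ => ℝ) t (T + T'), Fin.snoc (α := fun _ => Param d) c θ',
    ?_, ?_, by simp, ?_⟩
  · rw [Fin.strictMono_iff_lt_succ]
    intro i
    induction i using Fin.lastCases with
    | last => simp [hlast, hT']
    | cast i =>
      rw [Fin.succ_castSucc, Fin.snoc_castSucc, Fin.snoc_castSucc]
      exact hmono i.castSucc_lt_succ
  · rw [← Fin.castSucc_zero, Fin.snoc_castSucc, h0]
  · intro k
    induction k using Fin.lastCases with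
    | last =>
      intro s hs
      simp only [Fin.snoc_castSucc, hlast] at hs
      rw [concat_of_ge _ _ hs.1, Fin.snoc_last]
    | cast k =>
      intro s hs
      rw [Fin.succ_castSucc, Fin.snoc_castSucc, Fin.snoc_castSucc] at hs
      have : s < T := hs.2.trans_le (hlast ▸ hmono.monotone (Fin.le_last _))
      rw [concat_of_lt _ _ this, Fin.snoc_castSucc, hc k s hs]

lemma nhdsWithin_Icc_le_sup {a b c t : ℝ} :
    𝓝[Set.Icc a c] t ≤ 𝓝[Set.Icc a b] t ⊔ 𝓝[Set.Icc b c] t := by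
  rw [← nhdsWithin_union]
  refine nhdsWithin_mono t fun s hs => ?_
  rcases le_total s b with h | h
  · exact Or.inl ⟨hs.1, h⟩
  · exact Or.inr ⟨h, hs.2⟩

lemma tendsto_nhdsWithin_Icc_of_notMem {β : Type*} {a b t : ℝ} (h : t ∉ Set.Icc a b) (f : ℝ → β)
    (l : Filter β) : Tendsto f (𝓝[Set.Icc a b] t) l := by
  have : 𝓝[Set.Icc a b] t = ⊥ := by
    by_contra hne
    have hm : t ∈ closure (Set.Icc a b) := mem_closure_iff_nhdsWithin_neBot.2 ⟨hne⟩
    rw [isClosed_Icc.closure_eq] at hm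
    exact h hm
  rw [this]; exact tendsto_bot

/-- Appending one constant piece is enough, since group elements are built by composing with one
neuron flow at a time. -/
lemma Steers.concat_const {T T' : ℝ} (hT : 0 < T) (hT' : 0 < T')
    {F : EuclideanSpace ℝ (Fin d) → EuclideanSpace ℝ (Fin d)} (hF : Measurable F)
    {ρ₀ : EuclideanSpace ℝ (Fin d) → ℝ} {θ : ℝ → Param d}
    {Φ : ℝ → EuclideanSpace ℝ (Fin d) → EuclideanSpace ℝ (Fin d)}
    {ρ : ℝ → EuclideanSpace ℝ (Fin d) → ℝ} (h : Steers T F ρ₀ θ Φ ρ) (θ' : Param d) :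
    Steers (T + T') (flowMap θ' T' ∘ F) ρ₀ (concat T θ fun _ => θ')
      (concat T Φ fun s x => flowMap θ' s (F x)) (concat T ρ (flowDensity θ' (ρ T))) := by
  have h2 := steers_const θ' hT' h.nice_end
  have hle : T ≤ T + T' := by linarith
  have hsub : T + T' - T = T' := by ring
  have hvel : ∀ x, (fun s => velocity ((concat T Φ fun s x => flowMap θ' s (F x)) s x)
      (concat T θ (fun _ => θ') s)) = concat T (fun s => velocity (Φ s x) (θ s))
        (fun s => velocity (flowMap θ' s (F x)) θ') := by
    intro x; ext1 s; unfold concat; split_ifs <;> rfl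
  have hflux : ∀ φ : EuclideanSpace ℝ (Fin d) → ℝ,
      (fun s => ∫ x, fderiv ℝ φ x (velocity x (concat T θ (fun _ => θ') s)) *
        concat T ρ (flowDensity θ' (ρ T)) s x) =
      concat T (fun s => ∫ x, fderiv ℝ φ x (velocity x (θ s)) * ρ s x)
        (fun s => ∫ x, fderiv ℝ φ x (velocity x θ') * flowDensity θ' (ρ T) s x) := by
    intro φ; ext1 s; unfold concat; split_ifs <;> rfl
  have hvi : ∀ x, IntervalIntegrable (fun s => velocity ((concat T Φ fun s x =>
      flowMap θ' s (F x)) s x) (concat T θ (fun _ => θ') s)) volume 0 (T + T') := by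
    intro x
    rw [hvel x]
    exact (intervalIntegrable_concat_left hT.le _ (h.velocity_integrable x)).trans
      (intervalIntegrable_concat_right hle _ (hsub.symm ▸ h2.velocity_integrable (F x)))
  have hρT : flowDensity θ' (ρ T) 0 = ρ T := flowDensity_zero _ _
  have hflow : ∀ x, ∀ t ∈ Set.Icc 0 (T + T'), concat T Φ (fun s x => flowMap θ' s (F x)) t x =
      x + ∫ s in (0 : ℝ)..t, velocity ((concat T Φ fun s x => flowMap θ' s (F x)) s x)
        (concat T θ (fun _ => θ') s) := by
    intro x t ht
    rw [hvel x]
    rcases lt_or_ge t T with htT | htT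
    · rw [concat_of_lt _ _ htT, integral_concat_left _ _ ht.1 htT.le]
      exact (h.isFlow x).2 t ⟨ht.1, htT.le⟩
    · have htm : t - T ∈ Set.Icc 0 T' := ⟨by linarith, by linarith [ht.2]⟩
      have hvs : IntervalIntegrable (fun s => velocity (flowMap θ' s (F x)) θ') volume 0 (t - T) :=
        (h2.velocity_integrable (F x)).mono_set (by
          rw [Set.uIcc_of_le htm.1, Set.uIcc_of_le hT'.le]
          exact Set.Icc_subset_Icc_right htm.2)
      rw [concat_of_ge _ _ htT, integral_concat_right hT.le htT (h.velocity_integrable x) hvs,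
        ← add_assoc, ← (h.isFlow x).2 T ⟨hT.le, le_rfl⟩, h.flow_end]
      exact (h2.isFlow (F x)).2 _ htm
  refine ⟨h.isPiecewiseConstant.concat_const hT' θ', fun x => ⟨?_, hflow x⟩, hvi, ?_, ?_, ?_, ?_, ?_⟩
  · have hc := intervalIntegral.continuousOn_primitive_interval' (hvi x) Set.left_mem_uIcc
    rw [Set.uIcc_of_le (by linarith : (0 : ℝ) ≤ T + T')] at hc
    exact (continuousOn_const.add hc).congr fun t ht => hflow x t ht
  · refine ⟨?_, ?_, ?_, ?_, ?_⟩
    · intro t ht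
      rcases lt_or_ge t T with htT | htT
      · rw [concat_of_lt _ _ htT]
        exact h.isSolution.integrable t ⟨ht.1, htT.le⟩
      · rw [concat_of_ge _ _ htT]
        exact integrable_flowDensity θ' h.nice_end.integrable _
    · obtain ⟨C₁, hC₁⟩ := h.isSolution.bounded
      obtain ⟨C₂, hC₂⟩ := h2.isSolution.bounded
      refine ⟨max C₁ C₂, fun t ht => ?_⟩
      rcases lt_or_ge t T with htT | htT
      · rw [concat_of_lt _ _ htT]
        filter_upwards [hC₁ t ⟨ht.1, htT.le⟩] with x hx using hx.trans (le_max_left _ _)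
      · rw [concat_of_ge _ _ htT]
        filter_upwards [hC₂ (t - T) ⟨by linarith, by linarith [ht.2]⟩] with x hx
          using hx.trans (le_max_right _ _)
    · intro t ht
      -- Continuity is checked on the two closed pieces separately. At the switching time both
      -- pieces contribute, and they agree there by `hρT`.
      refine Tendsto.mono_left ?_ (nhdsWithin_Icc_le_sup (b := T))
      refine tendsto_sup.2 ⟨?_, ?_⟩
      · by_cases htm : t ∈ Set.Icc 0 T
        · refine (h.isSolution.continuous t htm).congr' ?_
          filter_upwards [self_mem_nhdsWithin] with s hs
          rw [concat_of_le hρT hs.2, concat_of_le hρT htm.2]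
        · exact tendsto_nhdsWithin_Icc_of_notMem htm _ _
      · by_cases htm : t ∈ Set.Icc T (T + T')
        · have hs : Tendsto (fun s => s - T) (𝓝[Set.Icc T (T + T')] t) (𝓝 (t - T)) :=
            ((continuous_id.sub continuous_const).tendsto t).mono_left nhdsWithin_le_nhds
          refine ((tendsto_flowDensity θ' h.nice_end.integrable (t - T)).comp hs).congr' ?_
          filter_upwards [self_mem_nhdsWithin] with s hs
          rw [concat_of_ge _ _ hs.1, concat_of_ge _ _ htm.1]
          rfl
        · exact tendsto_nhdsWithin_Icc_of_notMem htm _ _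
    · rw [concat_of_lt _ _ hT]
      exact h.isSolution.initial
    · intro φ hφ hc t ht
      rw [hflux φ]
      rcases lt_or_ge t T with htT | htT
      · rw [concat_of_lt _ _ htT, integral_concat_left _ _ ht.1 htT.le]
        exact h.isSolution.weak φ hφ hc t ⟨ht.1, htT.le⟩
      · have htm : t - T ∈ Set.Icc 0 T' := ⟨by linarith, by linarith [ht.2]⟩
        have hvs : IntervalIntegrable (fun s => ∫ x, fderiv ℝ φ x (velocity x θ') *
            flowDensity θ' (ρ T) s x) volume 0 (t - T) :=
          (h2.flux_integrable φ hφ hc).mono_set (by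
            rw [Set.uIcc_of_le htm.1, Set.uIcc_of_le hT'.le]
            exact Set.Icc_subset_Icc_right htm.2)
        rw [concat_of_ge _ _ htT, integral_concat_right hT.le htT (h.flux_integrable φ hφ hc) hvs,
          ← add_assoc, ← h.isSolution.weak φ hφ hc T ⟨hT.le, le_rfl⟩]
        exact h2.isSolution.weak φ hφ hc _ htm
  · intro φ hφ hc
    rw [hflux φ]
    exact (intervalIntegrable_concat_left hT.le _ (h.flux_integrable φ hφ hc)).trans
      (intervalIntegrable_concat_right hle _ (hsub.symm ▸ h2.flux_integrable φ hφ hc))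
  · rw [concat_of_ge _ _ hle, hsub]; rfl
  · rw [concat_of_ge _ _ hle, hsub]
    exact h2.nice_end
  · have hm : Measurable (flowMap θ' T') := (flowHomeo θ' T').continuous.measurable
    rw [concat_of_ge _ _ hle, hsub, ← Measure.map_map hm hF, h.map_eq]
    exact h2.map_eq

/-! ### Time rescaling and the group generated by single-neuron flows -/

lemma expInt_mul_left (c l t : ℝ) : c * expInt (c * l) t = expInt l (c * t) := by
  have h := intervalIntegral.mul_integral_comp_mul_left (a := 0) (b := t)
    (f := fun s => Real.exp (l * s)) c
  simp only [mul_zero] at h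
  rw [expInt, expInt, ← h]
  congr 2
  ext s; ring_nf

lemma flowMap_smul (θ : Param d) (c t : ℝ) :
    flowMap (c • θ.1, θ.2.1, θ.2.2) t = flowMap θ (c * t) := by
  ext1 x
  have h1 : rate ((c • θ.1, θ.2.1, θ.2.2) : Param d) = c * rate θ := by
    simp [rate, real_inner_smul_right]
  rw [flowMap, flowMap, h1, ← expInt_mul_left, smul_smul]
  congr 2
  simp only [preact]; ring

/-- Scaling `w` by t/T lets the map reached at time t be reached at time T. Negative t is allowed,
so inverses of flow maps are attained in positive time as well. -/
lemma flowMap_smul_div (θ : Param d) (t : ℝ) {T : ℝ} (hT : T ≠ 0) :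
    flowMap ((t / T) • θ.1, θ.2.1, θ.2.2) T = flowMap θ t := by
  rw [flowMap_smul, div_mul_cancel₀ t hT]

lemma steerable_flowMap (θ : Param d) (t : ℝ) : Steerable (flowMap θ t) := by
  intro T hT ρ₀ h₀
  rw [← flowMap_smul_div θ t hT.ne']
  exact ⟨_, _, _, steers_const _ hT h₀⟩

lemma Steerable.flowMap_comp {F : EuclideanSpace ℝ (Fin d) → EuclideanSpace ℝ (Fin d)}
    (hF : Steerable F) (hm : Measurable F) (θ : Param d) (t : ℝ) :
    Steerable (flowMap θ t ∘ F) := by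
  intro T hT ρ₀ h₀
  obtain ⟨θ₁, Φ, ρ, h⟩ := hF (T / 2) (by positivity) ρ₀ h₀
  have hT2 : 0 < T / 2 := by positivity
  rw [← flowMap_smul_div θ t hT2.ne']
  have := h.concat_const hT2 hT2 hm ((t / (T / 2)) • θ.1, θ.2.1, θ.2.2)
  rw [add_halves] at this
  exact ⟨_, _, _, this⟩

/-- The group generated by the flow maps of single neurons. -/
def flowGroup (d : ℕ) : Subgroup (EuclideanSpace ℝ (Fin d) ≃ₜ EuclideanSpace ℝ (Fin d)) :=
  Subgroup.closure (Set.range fun z : Param d × ℝ => flowHomeo z.1 z.2)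

lemma flowHomeo_mem (θ : Param d) (t : ℝ) : flowHomeo θ t ∈ flowGroup d :=
  Subgroup.subset_closure ⟨(θ, t), rfl⟩

lemma flowHomeo_inv (θ : Param d) (t : ℝ) : (flowHomeo θ t)⁻¹ = flowHomeo θ (-t) := by
  ext1 x; rfl

/-- The inverse of a generator is the flow at time -t, again a generator; this is why no separate
case for inverses is needed. -/
lemma flowGroup_induction {P : (EuclideanSpace ℝ (Fin d) ≃ₜ EuclideanSpace ℝ (Fin d)) → Prop}
    (one : P 1) (mul : ∀ (θ : Param d) (t : ℝ) F, P F → P (flowHomeo θ t * F))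
    {F : EuclideanSpace ℝ (Fin d) ≃ₜ EuclideanSpace ℝ (Fin d)} (hF : F ∈ flowGroup d) : P F := by
  refine Subgroup.closure_induction_left (p := fun F _ => P F) one ?_ ?_ hF
  · rintro _ ⟨⟨θ, t⟩, rfl⟩ F _ h
    exact mul θ t F h
  · rintro _ ⟨⟨θ, t⟩, rfl⟩ F _ h
    rw [flowHomeo_inv]
    exact mul θ (-t) F h

lemma steerable_of_mem {F : EuclideanSpace ℝ (Fin d) ≃ₜ EuclideanSpace ℝ (Fin d)}
    (hF : F ∈ flowGroup d) : Steerable F := by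
  refine flowGroup_induction (P := fun F => Steerable F) ?_ (fun θ t F h =>
    h.flowMap_comp F.continuous.measurable θ t) hF
  have := steerable_flowMap (0 : Param d) 0
  convert this using 1
  ext1 x; simp

/-! ### Densities with Gaussian decay -/

lemma integrable_exp_neg_mul_norm_sq {c : ℝ} (hc : 0 < c) :
    Integrable fun x : EuclideanSpace ℝ (Fin d) => Real.exp (-(c * ‖x‖ ^ 2)) := by
  have h := (GaussianFourier.integrable_cexp_neg_mul_sq_norm_add
    (V := EuclideanSpace ℝ (Fin d)) (b := (c : ℂ)) (by simpa using hc) 0 0).norm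
  refine h.congr (ae_of_all _ fun x => ?_)
  simp only [zero_mul, add_zero, Complex.norm_exp]
  congr 1
  rw [← Complex.ofReal_pow, neg_mul, ← Complex.ofReal_mul, ← Complex.ofReal_neg, Complex.ofReal_re]

/-- Nonnegative measurable functions bounded by `C e^{-c |x|²}`. -/
structure IsDom (C c : ℝ) (p : EuclideanSpace ℝ (Fin d) → ℝ) : Prop where
  measurable : Measurable p
  nonneg : ∀ x, 0 ≤ p x
  le : ∀ x, p x ≤ C * Real.exp (-(c * ‖x‖ ^ 2))

lemma IsDom.const_nonneg {C c : ℝ} {p : EuclideanSpace ℝ (Fin d) → ℝ} (hp : IsDom C c p) :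
    0 ≤ C := by
  simpa using (hp.nonneg 0).trans (hp.le 0)

lemma IsDom.integrable {C c : ℝ} (hc : 0 < c) {p : EuclideanSpace ℝ (Fin d) → ℝ}
    (hp : IsDom C c p) : Integrable p := by
  refine ((integrable_exp_neg_mul_norm_sq hc).const_mul C).mono'
    hp.measurable.aestronglyMeasurable (ae_of_all _ fun x => ?_)
  rw [Real.norm_of_nonneg (hp.nonneg x)]
  exact hp.le x

lemma IsDom.isNice {C c : ℝ} (hc : 0 < c) {p : EuclideanSpace ℝ (Fin d) → ℝ}
    (hp : IsDom C c p) : IsNice p where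
  measurable := hp.measurable
  nonneg := hp.nonneg
  integrable := hp.integrable hc
  bounded := ⟨C, fun x => (hp.le x).trans (mul_le_of_le_one_right hp.const_nonneg
    (Real.exp_le_one_iff.2 (by simp; positivity)))⟩

lemma IsDom.mono {C C' c c' : ℝ} {p : EuclideanSpace ℝ (Fin d) → ℝ} (hp : IsDom C c p)
    (hC : C ≤ C') (hc : c' ≤ c) : IsDom C' c' p where
  measurable := hp.measurable
  nonneg := hp.nonneg
  le x := (hp.le x).trans (by
    have := hp.const_nonneg
    have := this.trans hC
    gcongr)

/-- Linear growth gives |y|² ≤ 2(L²|F⁻¹y|² + D²), hence the loss of 2L² in the exponent. The new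
constants depend on `F` only through `B`, `L`, `D`, so sequences of maps with common bounds keep a
common Gaussian majorant. -/
lemma IsDom.push {F : EuclideanSpace ℝ (Fin d) ≃ₜ EuclideanSpace ℝ (Fin d)}
    {J p : EuclideanSpace ℝ (Fin d) → ℝ} {C c B L D : ℝ} (hp : IsDom C c p) (hc : 0 ≤ c)
    (hF : HasJac F J) (hB : ∀ y, J y ≤ B) (hL : 0 < L) (hgrow : ∀ x, ‖F x‖ ≤ L * ‖x‖ + D) :
    IsDom (C * Real.exp (c * D ^ 2 / L ^ 2) * B) (c / (2 * L ^ 2)) fun y => p (F.symm y) * J y where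
  measurable := (hp.measurable.comp F.symm.continuous.measurable).mul hF.measurable
  nonneg y := mul_nonneg (hp.nonneg _) (hF.nonneg _)
  le y := by
    have hC := hp.const_nonneg
    have h1 : ‖y‖ ^ 2 ≤ 2 * (L ^ 2 * ‖F.symm y‖ ^ 2 + D ^ 2) := by
      have h := hgrow (F.symm y)
      rw [F.apply_symm_apply] at h
      nlinarith [sq_nonneg (L * ‖F.symm y‖ - D), norm_nonneg y]
    have h2 : -(c * ‖F.symm y‖ ^ 2) ≤ c * D ^ 2 / L ^ 2 + -(c / (2 * L ^ 2) * ‖y‖ ^ 2) := by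
      have : c / (2 * L ^ 2) * ‖y‖ ^ 2 ≤ c / (2 * L ^ 2) * (2 * (L ^ 2 * ‖F.symm y‖ ^ 2 + D ^ 2)) := by
        gcongr
      have h3 : c / (2 * L ^ 2) * (2 * (L ^ 2 * ‖F.symm y‖ ^ 2 + D ^ 2)) =
          c * ‖F.symm y‖ ^ 2 + c * D ^ 2 / L ^ 2 := by
        field_simp
      linarith
    calc p (F.symm y) * J y
        ≤ (C * (Real.exp (c * D ^ 2 / L ^ 2) * Real.exp (-(c / (2 * L ^ 2) * ‖y‖ ^ 2)))) * B := by
          refine mul_le_mul ((hp.le _).trans ?_) (hB y) (hF.nonneg y) (by positivity)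
          rw [← Real.exp_add]
          gcongr
      _ = _ := by ring

lemma norm_flowMap_le (θ : Param d) (t : ℝ) (x : EuclideanSpace ℝ (Fin d)) :
    ‖flowMap θ t x‖ ≤ (1 + |expInt (rate θ) t| * ‖θ.2.1‖ * ‖θ.1‖) * ‖x‖ +
      |expInt (rate θ) t| * |θ.2.2| * ‖θ.1‖ := by
  have h1 : |max (preact θ x) 0| ≤ ‖θ.2.1‖ * ‖x‖ + |θ.2.2| := by
    rw [abs_of_nonneg (le_max_right _ _)]
    refine max_le ?_ (by positivity)
    exact add_le_add (real_inner_le_norm _ _) (le_abs_self _)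
  calc ‖flowMap θ t x‖ ≤ ‖x‖ + |expInt (rate θ) t| * |max (preact θ x) 0| * ‖θ.1‖ := by
        refine (norm_add_le _ _).trans ?_
        rw [norm_smul, Real.norm_eq_abs, abs_mul]
    _ ≤ ‖x‖ + |expInt (rate θ) t| * (‖θ.2.1‖ * ‖x‖ + |θ.2.2|) * ‖θ.1‖ := by gcongr
    _ = _ := by ring

lemma exists_jac_growth {F : EuclideanSpace ℝ (Fin d) ≃ₜ EuclideanSpace ℝ (Fin d)}
    (hF : F ∈ flowGroup d) : ∃ J, HasJac F J ∧ ∃ L D : ℝ, 0 < L ∧ ∀ x, ‖F x‖ ≤ L * ‖x‖ + D := by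
  refine flowGroup_induction (P := fun F => ∃ J, HasJac F J ∧
    ∃ L D : ℝ, 0 < L ∧ ∀ x, ‖F x‖ ≤ L * ‖x‖ + D) ?_ ?_ hF
  · refine ⟨fun _ => 1, ⟨measurable_const, fun _ => zero_le_one, ⟨1, fun _ => le_rfl⟩, ?_⟩, 1, 0,
      one_pos, fun x => by simp⟩
    have : (⇑(1 : EuclideanSpace ℝ (Fin d) ≃ₜ EuclideanSpace ℝ (Fin d))) = id := rfl
    rw [this, Measure.map_id, densityMeasure]
    simp
  · rintro θ t F ⟨J, hJ, L, D, hL, hg⟩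
    refine ⟨_, hJ.trans (hasJac_flowHomeo θ t), ?_⟩
    set A := 1 + |expInt (rate θ) t| * ‖θ.2.1‖ * ‖θ.1‖ with hA
    have hA0 : 0 < A := by positivity
    refine ⟨A * L, A * D + |expInt (rate θ) t| * |θ.2.2| * ‖θ.1‖, by positivity, fun x => ?_⟩
    refine (norm_flowMap_le θ t (F x)).trans ?_
    rw [← hA]
    have := mul_le_mul_of_nonneg_left (hg x) hA0.le
    linarith

/-- Needed to compose an almost everywhere limit with `F.symm`. -/
lemma quasiMeasurePreserving_symm {F : EuclideanSpace ℝ (Fin d) ≃ₜ EuclideanSpace ℝ (Fin d)}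
    (hF : F ∈ flowGroup d) : Measure.QuasiMeasurePreserving F.symm volume volume := by
  obtain ⟨J, hJ, -⟩ := exists_jac_growth (inv_mem hF)
  refine ⟨F.symm.continuous.measurable, ?_⟩
  have h : volume.map F.symm = densityMeasure J := hJ.map_volume
  rw [h]
  exact withDensity_absolutelyContinuous _ _

/-! ### Relative entropy in terms of densities -/

/-- Everywhere positive target densities whose logarithm is integrable against Gaussians. -/
structure IsTarget (r : EuclideanSpace ℝ (Fin d) → ℝ) : Prop where
  measurable : Measurable r
  pos : ∀ x, 0 < r x
  integrable : Integrable r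
  integrable_log : ∀ c : ℝ, 0 < c → Integrable fun x => Real.exp (-(c * ‖x‖ ^ 2)) * |Real.log (r x)|

lemma isFiniteMeasure_densityMeasure {p : EuclideanSpace ℝ (Fin d) → ℝ} (hp : Integrable p) :
    IsFiniteMeasure (densityMeasure p) :=
  isFiniteMeasure_withDensity_ofReal hp.2

lemma densityMeasure_eq_withDensity {p r : EuclideanSpace ℝ (Fin d) → ℝ} (hp : Measurable p)
    (hr : Measurable r) (hr0 : ∀ x, 0 < r x) :
    densityMeasure p = (densityMeasure r).withDensity fun x => ENNReal.ofReal (p x / r x) := by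
  have hm : Measurable fun x => ENNReal.ofReal (p x / r x) := by fun_prop
  rw [densityMeasure, densityMeasure, ← withDensity_mul _ hr.ennreal_ofReal hm]
  congr 1; ext1 x
  rw [Pi.mul_apply, ← ENNReal.ofReal_mul (hr0 x).le, mul_div_cancel₀ _ (hr0 x).ne']

/-- The integrand r · klFun(p/r) is nonnegative, so the divergence becomes a lower integral with
respect to Lebesgue measure, without any integrability condition on the logarithm. -/
lemma klDiv_densityMeasure {p r : EuclideanSpace ℝ (Fin d) → ℝ} (hp : Measurable p)
    (hp0 : ∀ x, 0 ≤ p x) (hpi : Integrable p) (hr : IsTarget r) :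
    InformationTheory.klDiv (densityMeasure p) (densityMeasure r) =
      ∫⁻ x, ENNReal.ofReal (r x * InformationTheory.klFun (p x / r x)) := by
  have := isFiniteMeasure_densityMeasure hpi
  have := isFiniteMeasure_densityMeasure hr.integrable
  have heq := densityMeasure_eq_withDensity hp hr.measurable hr.pos
  have hac : densityMeasure p ≪ densityMeasure r := by
    rw [heq]; exact withDensity_absolutelyContinuous _ _
  rw [InformationTheory.klDiv_eq_lintegral_klFun_of_ac hac]
  have hrn : (densityMeasure p).rnDeriv (densityMeasure r) =ᵐ[densityMeasure r]
      fun x => ENNReal.ofReal (p x / r x) := by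
    conv_lhs => rw [heq]
    exact Measure.rnDeriv_withDensity _ (hp.div hr.measurable).ennreal_ofReal
  have h1 : ∫⁻ x, ENNReal.ofReal (InformationTheory.klFun
        ((densityMeasure p).rnDeriv (densityMeasure r) x).toReal) ∂(densityMeasure r) =
      ∫⁻ x, ENNReal.ofReal (InformationTheory.klFun (p x / r x)) ∂(densityMeasure r) := by
    refine lintegral_congr_ae ?_
    filter_upwards [hrn] with x hx
    rw [hx, ENNReal.toReal_ofReal (div_nonneg (hp0 x) (hr.pos x).le)]
  have hm : Measurable fun x => ENNReal.ofReal (InformationTheory.klFun (p x / r x)) :=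
    (InformationTheory.measurable_klFun.comp (hp.div hr.measurable)).ennreal_ofReal
  rw [h1, densityMeasure, lintegral_withDensity_eq_lintegral_mul _ hr.measurable.ennreal_ofReal hm]
  refine lintegral_congr fun x => ?_
  rw [Pi.mul_apply, ENNReal.ofReal_mul (hr.pos x).le]

/-- The majorant comes from r · klFun(q/r) = q log q - q log r + r - q with q log q ≤ q². With `H` a
Gaussian, each of its terms is integrable for a target density. -/
lemma mul_klFun_div_le {q r H : ℝ} (hq : 0 ≤ q) (hqH : q ≤ H) (hr : 0 < r) :
    r * InformationTheory.klFun (q / r) ≤ H ^ 2 + H * |Real.log r| + r := by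
  rcases hq.eq_or_lt with rfl | hq0
  · simp only [zero_div, InformationTheory.klFun_zero, mul_one]
    have := mul_nonneg hqH (abs_nonneg (Real.log r))
    nlinarith [sq_nonneg H]
  · rw [InformationTheory.klFun_apply, Real.log_div hq0.ne' hr.ne']
    have h1 : r * (q / r * (Real.log q - Real.log r) + 1 - q / r) =
        q * Real.log q - q * Real.log r + r - q := by field_simp
    rw [h1]
    have h2 : q * Real.log q ≤ q * q :=
      mul_le_mul_of_nonneg_left ((Real.log_le_sub_one_of_pos hq0).trans (by linarith)) hq
    have h3 : -(q * Real.log r) ≤ H * |Real.log r| := by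
      calc -(q * Real.log r) = q * (-Real.log r) := by ring
        _ ≤ q * |Real.log r| := mul_le_mul_of_nonneg_left (neg_le_abs _) hq
        _ ≤ H * |Real.log r| := mul_le_mul_of_nonneg_right hqH (abs_nonneg _)
    nlinarith

lemma tendsto_klDiv_of_isDom {r : EuclideanSpace ℝ (Fin d) → ℝ} (hr : IsTarget r) {C c : ℝ}
    (hc : 0 < c) {p : ℕ → EuclideanSpace ℝ (Fin d) → ℝ} {q : EuclideanSpace ℝ (Fin d) → ℝ}
    (hp : ∀ n, IsDom C c (p n)) (hq : IsDom C c q)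
    (hlim : ∀ᵐ x, Tendsto (fun n => p n x) atTop (𝓝 (q x))) :
    Tendsto (fun n => InformationTheory.klDiv (densityMeasure (p n)) (densityMeasure r)) atTop
      (𝓝 (InformationTheory.klDiv (densityMeasure q) (densityMeasure r))) := by
  rw [klDiv_densityMeasure hq.measurable hq.nonneg (hq.integrable hc) hr]
  simp_rw [fun n => klDiv_densityMeasure (hp n).measurable (hp n).nonneg ((hp n).integrable hc) hr]
  set H : EuclideanSpace ℝ (Fin d) → ℝ := fun x => C * Real.exp (-(c * ‖x‖ ^ 2)) with hH
  have hbi : Integrable fun x => H x ^ 2 + H x * |Real.log (r x)| + r x := by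
    refine (Integrable.add ?_ ?_).add hr.integrable
    · have h2 : (fun x => H x ^ 2) = fun x : EuclideanSpace ℝ (Fin d) =>
          C ^ 2 * Real.exp (-((2 * c) * ‖x‖ ^ 2)) := by
        ext x
        simp only [hH, mul_pow, ← Real.exp_nat_mul]
        congr 2; push_cast; ring
      rw [h2]
      exact (integrable_exp_neg_mul_norm_sq (by positivity)).const_mul _
    · simp only [hH, mul_assoc]
      exact (hr.integrable_log c hc).const_mul C
  refine tendsto_lintegral_of_dominated_convergence
    (fun x => ENNReal.ofReal (H x ^ 2 + H x * |Real.log (r x)| + r x)) ?_ ?_ ?_ ?_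
  · intro n
    exact (hr.measurable.mul (InformationTheory.measurable_klFun.comp
      ((hp n).measurable.div hr.measurable))).ennreal_ofReal
  · intro n
    exact ae_of_all _ fun x => ENNReal.ofReal_le_ofReal
      (mul_klFun_div_le ((hp n).nonneg x) ((hp n).le x) (hr.pos x))
  · exact hbi.lintegral_lt_top.ne
  · filter_upwards [hlim] with x hx
    exact ENNReal.tendsto_ofReal (((InformationTheory.continuous_klFun.tendsto _).comp
      (hx.div_const _)).const_mul _)

/-- From the identity klFun(ut) = u klFun(t) + (u log u) t + (1 - u), bounding each coefficient
separately. -/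
lemma klFun_mul_le {η t u : ℝ} (ht : 0 ≤ t) (hu : Real.exp (-η) ≤ u) (hu' : u ≤ Real.exp η) :
    InformationTheory.klFun (u * t) ≤ Real.exp η * InformationTheory.klFun t +
      Real.exp η * η * t + (1 - Real.exp (-η)) := by
  have hu0 : 0 < u := (Real.exp_pos _).trans_le hu
  have hη : Real.log u ≤ η := (Real.log_le_iff_le_exp hu0).2 hu'
  have hη0 : 0 ≤ η := by
    have := Real.exp_le_exp.1 (hu.trans hu'); linarith
  have h1 : InformationTheory.klFun (u * t) =
      u * InformationTheory.klFun t + u * Real.log u * t + (1 - u) := by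
    rcases ht.eq_or_lt with rfl | ht
    · simp [InformationTheory.klFun_zero]
    · rw [InformationTheory.klFun_apply, InformationTheory.klFun_apply,
        Real.log_mul hu0.ne' ht.ne']; ring
  have h2 := mul_le_mul_of_nonneg_right hu' (InformationTheory.klFun_nonneg ht)
  have h3 : u * Real.log u ≤ Real.exp η * η :=
    (mul_le_mul_of_nonneg_left hη hu0.le).trans (mul_le_mul_of_nonneg_right hu' hη0)
  have h4 := mul_le_mul_of_nonneg_right h3 ht
  rw [h1]; linarith

lemma klDiv_le_of_ratio {r p q : EuclideanSpace ℝ (Fin d) → ℝ} (hr : IsTarget r) {η : ℝ}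
    (hη : 0 ≤ η) (hp : IsNice p) (hq : IsNice q) (h1 : ∀ x, Real.exp (-η) * q x ≤ p x)
    (h2 : ∀ x, p x ≤ Real.exp η * q x) :
    InformationTheory.klDiv (densityMeasure p) (densityMeasure r) ≤
      ENNReal.ofReal (Real.exp η) *
        InformationTheory.klDiv (densityMeasure q) (densityMeasure r) +
      (ENNReal.ofReal (Real.exp η * η) * ∫⁻ x, ENNReal.ofReal (q x)) +
      (ENNReal.ofReal (1 - Real.exp (-η)) * ∫⁻ x, ENNReal.ofReal (r x)) := by
  rw [klDiv_densityMeasure hp.measurable hp.nonneg hp.integrable hr,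
    klDiv_densityMeasure hq.measurable hq.nonneg hq.integrable hr]
  have hm : Measurable fun x => ENNReal.ofReal (r x * InformationTheory.klFun (q x / r x)) :=
    (hr.measurable.mul (InformationTheory.measurable_klFun.comp
      (hq.measurable.div hr.measurable))).ennreal_ofReal
  have hq' := hq.measurable
  have hr' := hr.measurable
  rw [← lintegral_const_mul _ hm, ← lintegral_const_mul _ (by fun_prop),
    ← lintegral_const_mul _ (by fun_prop), ← lintegral_add_left (by fun_prop),
    ← lintegral_add_left (by fun_prop)]
  refine lintegral_mono fun x => ?_
  have hrx := hr.pos x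
  obtain ⟨u, hu1, hu2, hu⟩ : ∃ u, Real.exp (-η) ≤ u ∧ u ≤ Real.exp η ∧ p x = u * q x := by
    rcases (hq.nonneg x).eq_or_lt with h0 | h0
    · refine ⟨1, by simpa using hη, by simpa using hη, ?_⟩
      have := h2 x
      rw [← h0] at this ⊢
      exact le_antisymm (by linarith) (by simpa using hp.nonneg x)
    · exact ⟨p x / q x, (le_div_iff₀ h0).2 (h1 x), (div_le_iff₀ h0).2 (h2 x),
        (div_mul_cancel₀ _ h0.ne').symm⟩
  have hkl := klFun_mul_le (div_nonneg (hq.nonneg x) hrx.le) hu1 hu2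
  have hη1 : 0 ≤ 1 - Real.exp (-η) := by simpa using hη
  have hk0 := InformationTheory.klFun_nonneg (div_nonneg (hq.nonneg x) hrx.le)
  have hle : r x * InformationTheory.klFun (p x / r x) ≤
      Real.exp η * (r x * InformationTheory.klFun (q x / r x)) + Real.exp η * η * q x +
        (1 - Real.exp (-η)) * r x := by
    rw [hu, mul_div_assoc]
    refine (mul_le_mul_of_nonneg_left hkl hrx.le).trans_eq ?_
    field_simp
  refine (ENNReal.ofReal_le_ofReal hle).trans_eq ?_
  have hqx := hq.nonneg x
  rw [ENNReal.ofReal_add (by positivity) (by positivity),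
    ENNReal.ofReal_add (by positivity) (by positivity), ENNReal.ofReal_mul (by positivity),
    ENNReal.ofReal_mul (by positivity : 0 ≤ Real.exp η * η), ENNReal.ofReal_mul hη1]

/-! ### The infimal relative entropy along the group of flow maps -/

/-- The infimum of the relative entropies `KL(F_# (p dx) ‖ r dx)` over the flow maps `F`. -/
noncomputable def klInf (r p : EuclideanSpace ℝ (Fin d) → ℝ) : ENNReal :=
  ⨅ F ∈ flowGroup d, InformationTheory.klDiv ((densityMeasure p).map F) (densityMeasure r)

lemma klInf_le_klDiv (r p : EuclideanSpace ℝ (Fin d) → ℝ) :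
    klInf r p ≤ InformationTheory.klDiv (densityMeasure p) (densityMeasure r) := by
  refine (iInf₂_le 1 (one_mem _)).trans_eq ?_
  congr 1
  exact Measure.map_id

lemma klInf_le_klInf_push {r p J : EuclideanSpace ℝ (Fin d) → ℝ} (hp : Measurable p)
    {F : EuclideanSpace ℝ (Fin d) ≃ₜ EuclideanSpace ℝ (Fin d)} (hF : F ∈ flowGroup d)
    (hJ : HasJac F J) : klInf r p ≤ klInf r fun y => p (F.symm y) * J y := by
  refine le_iInf₂ fun Ψ hΨ => ?_
  rw [← hJ.map_densityMeasure hp, Measure.map_map Ψ.continuous.measurable F.continuous.measurable]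
  exact iInf₂_le (Ψ * F) (mul_mem hΨ hF)

/-- Upper semicontinuity of an infimum of continuous functionals. For each fixed `Ψ` the pushed
densities still share a Gaussian majorant and converge almost everywhere, so their divergences
converge. -/
lemma le_klInf_of_tendsto {r : EuclideanSpace ℝ (Fin d) → ℝ} (hr : IsTarget r) {C c : ℝ}
    (hc : 0 < c) {p : ℕ → EuclideanSpace ℝ (Fin d) → ℝ} {q : EuclideanSpace ℝ (Fin d) → ℝ}
    (hp : ∀ n, IsDom C c (p n)) (hq : IsDom C c q)
    (hlim : ∀ᵐ x, Tendsto (fun n => p n x) atTop (𝓝 (q x))) {k : ENNReal}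
    (hk : ∀ n, k ≤ klInf r (p n)) : k ≤ klInf r q := by
  refine le_iInf₂ fun Ψ hΨ => ?_
  obtain ⟨J, hJ, L, D, hL, hg⟩ := exists_jac_growth hΨ
  obtain ⟨B, hB⟩ := hJ.bounded
  have hlim' := (quasiMeasurePreserving_symm hΨ).ae hlim
  have ht := tendsto_klDiv_of_isDom hr (by positivity)
    (fun n => (hp n).push hc.le hJ hB hL hg) (hq.push hc.le hJ hB hL hg)
    (by filter_upwards [hlim'] with y hy using hy.mul_const _)
  refine ge_of_tendsto' (by rwa [← hJ.map_densityMeasure hq.measurable] at ht) fun n => ?_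
  rw [← hJ.map_densityMeasure (hp n).measurable]
  exact (hk n).trans (iInf₂_le Ψ hΨ)

/-- Pushing both densities by the same map multiplies them by the same Jacobian, so the pointwise
ratio bounds survive and the estimate is uniform over the group. -/
lemma klInf_le_of_ratio {r p q : EuclideanSpace ℝ (Fin d) → ℝ} (hr : IsTarget r) {η : ℝ}
    (hη : 0 ≤ η) (hp : IsNice p) (hq : IsNice q) (h1 : ∀ x, Real.exp (-η) * q x ≤ p x)
    (h2 : ∀ x, p x ≤ Real.exp η * q x) :
    klInf r p ≤ ENNReal.ofReal (Real.exp η) * klInf r q +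
      ENNReal.ofReal (Real.exp η * η * (∫ x, q x) + (1 - Real.exp (-η)) * ∫ x, r x) := by
  set e := ENNReal.ofReal (Real.exp η)
  set A := ENNReal.ofReal (Real.exp η * η * (∫ x, q x) + (1 - Real.exp (-η)) * ∫ x, r x) with hA
  have he0 : e ≠ 0 := by simp [e, Real.exp_pos]
  have het : e ≠ ⊤ := ENNReal.ofReal_ne_top
  have hη1 : 0 ≤ 1 - Real.exp (-η) := by simpa using hη
  have hqi : 0 ≤ ∫ x, q x := integral_nonneg hq.nonneg
  have hri : 0 ≤ ∫ x, r x := integral_nonneg fun x => (hr.pos x).le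
  have hA' : A = ENNReal.ofReal (Real.exp η * η) * (∫⁻ x, ENNReal.ofReal (q x)) +
      ENNReal.ofReal (1 - Real.exp (-η)) * ∫⁻ x, ENNReal.ofReal (r x) := by
    rw [hA, ENNReal.ofReal_add (by positivity) (by positivity), ENNReal.ofReal_mul (by positivity),
      ENNReal.ofReal_mul hη1, ofReal_integral_eq_lintegral_ofReal hq.integrable
        (ae_of_all _ hq.nonneg), ofReal_integral_eq_lintegral_ofReal hr.integrable
        (ae_of_all _ fun x => (hr.pos x).le)]
  -- Solving for `klInf r q` turns the claim into a lower bound for an infimum, which can be checked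
  -- map by map.
  suffices h : (klInf r p - A) / e ≤ klInf r q by
    rw [ENNReal.div_le_iff' he0 het] at h
    exact tsub_le_iff_right.1 h
  refine le_iInf₂ fun Ψ hΨ => ?_
  rw [ENNReal.div_le_iff' he0 het, tsub_le_iff_right]
  refine (iInf₂_le Ψ hΨ).trans ?_
  obtain ⟨J, hJ, -⟩ := exists_jac_growth hΨ
  rw [hJ.map_densityMeasure hp.measurable, hJ.map_densityMeasure hq.measurable]
  refine (klDiv_le_of_ratio hr hη (hp.push hJ) (hq.push hJ) (fun y => ?_) fun y => ?_).trans_eq ?_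
  · rw [← mul_assoc]; exact mul_le_mul_of_nonneg_right (h1 _) (hJ.nonneg y)
  · rw [← mul_assoc]; exact mul_le_mul_of_nonneg_right (h2 _) (hJ.nonneg y)
  · rw [hA', add_assoc]
    congr 3
    rw [← hJ.lintegral_push hq.measurable.ennreal_ofReal]
    refine lintegral_congr fun y => ?_
    rw [ENNReal.ofReal_mul (hq.nonneg _)]

/-! ### Shears and stretchings in a coordinate direction -/

/-- The shear `x ↦ x + f x • e_j` is a volume preserving element of the flow group. -/
def IsFlowShear (j : Fin d) (f : EuclideanSpace ℝ (Fin d) → ℝ) : Prop :=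
  (∀ x (s : ℝ), f (x + s • EuclideanSpace.single j (1 : ℝ)) = f x) ∧
    ∃ F ∈ flowGroup d, (∀ x, F x = x + f x • EuclideanSpace.single j (1 : ℝ)) ∧ HasJac F fun _ => 1

lemma IsFlowShear.zero (j : Fin d) : IsFlowShear j fun _ => 0 := by
  refine ⟨fun _ _ => rfl, 1, one_mem _, fun x => by simp, ⟨measurable_const, fun _ => zero_le_one,
    ⟨1, fun _ => le_rfl⟩, ?_⟩⟩
  have : (⇑(1 : EuclideanSpace ℝ (Fin d) ≃ₜ EuclideanSpace ℝ (Fin d))) = id := rfl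
  rw [this, Measure.map_id, densityMeasure]
  simp

/-- The profiles do not vary along e_j, so neither shear changes the other's profile, and the
displacements add. -/
lemma IsFlowShear.add {j : Fin d} {f g : EuclideanSpace ℝ (Fin d) → ℝ} (hf : IsFlowShear j f)
    (hg : IsFlowShear j g) : IsFlowShear j fun x => f x + g x := by
  obtain ⟨hf1, F, hF, hFx, hFJ⟩ := hf
  obtain ⟨hg1, G, hG, hGx, hGJ⟩ := hg
  refine ⟨fun x s => by simp only [hf1, hg1], F * G, mul_mem hF hG, fun x => ?_, ?_⟩
  · change F (G x) = _
    rw [hFx, hGx, hf1]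
    module
  · have h : HasJac (F * G) fun _ => (1 : ℝ) * 1 := hGJ.trans hFJ
    simpa using h

lemma IsFlowShear.sum {j : Fin d} {ι : Type*} (s : Finset ι)
    {f : ι → EuclideanSpace ℝ (Fin d) → ℝ} (hf : ∀ i ∈ s, IsFlowShear j (f i)) :
    IsFlowShear j fun x => ∑ i ∈ s, f i x := by
  classical
  induction s using Finset.induction_on with
  | empty => simpa using IsFlowShear.zero j
  | insert i s hi ih =>
    simp only [Finset.sum_insert hi]
    exact (hf i (Finset.mem_insert_self i s)).add
      (ih fun k hk => hf k (Finset.mem_insert_of_mem hk))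

/-- Since i ≠ j, the direction `w` is orthogonal to `a`; the rate is zero and the neuron flow is a
volume preserving shear. -/
lemma isFlowShear_relu {i j : Fin d} (hij : i ≠ j) (κ s b : ℝ) :
    IsFlowShear j fun x => κ * max (s * x i + b) 0 := by
  set θ : Param d := (κ • EuclideanSpace.single j (1 : ℝ), s • EuclideanSpace.single i (1 : ℝ), b) with hθ
  have hrate : rate θ = 0 := by
    simp [rate, hθ, inner_smul_left, inner_smul_right, EuclideanSpace.inner_single_left, hij]
  have hpre : ∀ x, preact θ x = s * x i + b := by
    intro x
    simp [preact, hθ, inner_smul_left, EuclideanSpace.inner_single_left]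
  refine ⟨fun x t => by simp [hij], flowHomeo θ 1, flowHomeo_mem θ 1, fun x => ?_, ?_⟩
  · rw [flowHomeo_apply, flowMap, hrate, hpre]
    simp only [expInt_zero_left, hθ]
    module
  · convert hasJac_flowHomeo θ 1 using 1
    ext y
    simp [flowJac, hrate]

/-- Replace the `j`-th coordinate of `x` by `v`. -/
noncomputable def setCoord (j : Fin d) (x : EuclideanSpace ℝ (Fin d)) (v : ℝ) :
    EuclideanSpace ℝ (Fin d) :=
  x + (v - x j) • EuclideanSpace.single j (1 : ℝ)

@[simp] lemma setCoord_same (j : Fin d) (x : EuclideanSpace ℝ (Fin d)) (v : ℝ) :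
    setCoord j x v j = v := by simp [setCoord]

lemma setCoord_of_ne {i j : Fin d} (h : i ≠ j) (x : EuclideanSpace ℝ (Fin d)) (v : ℝ) :
    setCoord j x v i = x i := by simp [setCoord, h]

@[simp] lemma setCoord_self (j : Fin d) (x : EuclideanSpace ℝ (Fin d)) :
    setCoord j x (x j) = x := by simp [setCoord]

@[simp] lemma setCoord_setCoord (j : Fin d) (x : EuclideanSpace ℝ (Fin d)) (v w : ℝ) :
    setCoord j (setCoord j x v) w = setCoord j x w := by
  rw [setCoord, setCoord_same, setCoord, setCoord]; module

/-- The parameters of the neuron with weight and direction `e_j` and threshold `a`. -/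
noncomputable def coordParam (j : Fin d) (a : ℝ) : Param d :=
  (EuclideanSpace.single j (1 : ℝ), EuclideanSpace.single j (1 : ℝ), -a)

lemma rate_coordParam (j : Fin d) (a : ℝ) : rate (coordParam j a) = 1 := by
  simp [rate, coordParam]

lemma preact_coordParam (j : Fin d) (a : ℝ) (x : EuclideanSpace ℝ (Fin d)) :
    preact (coordParam j a) x = x j - a := by
  simp [preact, coordParam, EuclideanSpace.inner_single_left, sub_eq_add_neg]

lemma flowMap_coordParam (j : Fin d) (a t : ℝ) (x : EuclideanSpace ℝ (Fin d)) :
    flowMap (coordParam j a) t x =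
      x + ((Real.exp t - 1) * max (x j - a) 0) • EuclideanSpace.single j (1 : ℝ) := by
  have h := mul_expInt 1 t
  rw [one_mul, one_mul] at h
  rw [flowMap, rate_coordParam, preact_coordParam, h]
  rfl

/-- The shear by -N straightens the graph x_j = a + N(x) to the hyperplane x_j = a. One neuron
stretches above the hyperplane, and the inverse shear restores the graph. -/
lemma exists_conj_stretch {j : Fin d} {N : EuclideanSpace ℝ (Fin d) → ℝ}
    (hN : IsFlowShear j fun x => -N x) (a κ : ℝ) :
    ∃ F ∈ flowGroup d,
      (∀ x, F x = x + ((Real.exp κ - 1) * max (x j - N x - a) 0) • EuclideanSpace.single j (1 : ℝ)) ∧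
      (∀ y, F.symm y =
        y + ((Real.exp (-κ) - 1) * max (y j - N y - a) 0) • EuclideanSpace.single j (1 : ℝ)) ∧
      HasJac F fun y => if a ≤ y j - N y then Real.exp (-κ) else 1 := by
  obtain ⟨hinv, G, hG, hGx, hGJ⟩ := hN
  simp only at hinv hGx
  have hN' : ∀ x (s : ℝ), N (x + s • EuclideanSpace.single j (1 : ℝ)) = N x := fun x s => by
    have := hinv x s; linarith
  have hGs : ∀ y, G.symm y = y + N y • EuclideanSpace.single j (1 : ℝ) := by
    intro y
    rw [Homeomorph.symm_apply_eq, hGx, hN']; module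
  have hconj : ∀ t x, G.symm (flowMap (coordParam j a) t (G x)) =
      x + ((Real.exp t - 1) * max (x j - N x - a) 0) • EuclideanSpace.single j (1 : ℝ) := by
    intro t x
    rw [hGs, flowMap_coordParam, hN', hGx, hN']
    simp only [PiLp.add_apply, PiLp.smul_apply, PiLp.single_apply, if_true, smul_eq_mul, mul_one,
      ← sub_eq_add_neg]
    module
  have hGJs : HasJac G.symm fun _ => 1 := by
    refine ⟨measurable_const, fun _ => zero_le_one, ⟨1, fun _ => le_rfl⟩, ?_⟩
    have h1 : densityMeasure (fun _ : EuclideanSpace ℝ (Fin d) => (1 : ℝ)) = volume := by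
      simp [densityMeasure]
    have h2 := hGJ.map_volume
    rw [h1] at h2 ⊢
    conv_lhs => rw [← h2]
    rw [Measure.map_map G.symm.continuous.measurable G.continuous.measurable]
    simp
  refine ⟨(G.trans (flowHomeo (coordParam j a) κ)).trans G.symm, ?_, fun x => hconj κ x,
    fun y => hconj (-κ) y, ?_⟩
  · exact mul_mem (inv_mem hG) (mul_mem (flowHomeo_mem _ _) hG)
  · convert (hGJ.trans (hasJac_flowHomeo (coordParam j a) κ)).trans hGJs using 1
    ext y
    have h1 : G.symm.symm y j = y j - N y := by
      rw [Homeomorph.symm_symm, hGx]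
      simp [sub_eq_add_neg]
    simp only [flowJac, preact_coordParam, rate_coordParam, one_mul, mul_one, h1, sub_nonneg]

/-! ### Stretching the part of a density above a box -/

/-- The coordinates other than the `j`-th one lie in the half-open box. -/
def InCell (j : Fin d) (A B : Fin d → ℝ) (x : EuclideanSpace ℝ (Fin d)) : Prop :=
  ∀ i, i ≠ j → A i ≤ x i ∧ x i < B i

/-- A penalty vanishing on the cell for large `m` and diverging elsewhere. -/
noncomputable def cellPenalty (j : Fin d) (A B : Fin d → ℝ) (m : ℝ)
    (x : EuclideanSpace ℝ (Fin d)) : ℝ :=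
  ∑ i ∈ Finset.univ.erase j, (m ^ 2 * max (x i - B i + m⁻¹) 0 + m * max (A i - x i) 0)

lemma isFlowShear_neg_cellPenalty (j : Fin d) (A B : Fin d → ℝ) (m : ℝ) :
    IsFlowShear j fun x => -cellPenalty j A B m x := by
  have h : IsFlowShear j fun x => ∑ i ∈ Finset.univ.erase j,
      (-m ^ 2 * max (1 * x i + (m⁻¹ - B i)) 0 + -m * max (-1 * x i + A i) 0) :=
    IsFlowShear.sum _ fun i hi => (isFlowShear_relu (Finset.ne_of_mem_erase hi) _ _ _).add
      (isFlowShear_relu (Finset.ne_of_mem_erase hi) _ _ _)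
  convert h using 2 with x
  rw [cellPenalty, ← Finset.sum_neg_distrib]
  refine Finset.sum_congr rfl fun i _ => ?_
  ring_nf

lemma cellPenalty_nonneg (j : Fin d) (A B : Fin d → ℝ) {m : ℝ} (hm : 0 ≤ m)
    (x : EuclideanSpace ℝ (Fin d)) : 0 ≤ cellPenalty j A B m x :=
  Finset.sum_nonneg fun i _ => by positivity

lemma eventually_cellPenalty_eq_zero {j : Fin d} {A B : Fin d → ℝ}
    {x : EuclideanSpace ℝ (Fin d)} (hx : InCell j A B x) :
    ∀ᶠ m : ℝ in atTop, cellPenalty j A B m x = 0 := by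
  have h : ∀ i : Fin d, ∀ᶠ m : ℝ in atTop, i ≠ j →
      m ^ 2 * max (x i - B i + m⁻¹) 0 + m * max (A i - x i) 0 = 0 := by
    intro i
    by_cases hi : i = j
    · exact Eventually.of_forall fun m h => absurd hi h
    · have hB : 0 < B i - x i := by linarith [(hx i hi).2]
      filter_upwards [tendsto_inv_atTop_zero.eventually (gt_mem_nhds hB)] with m hm _
      rw [max_eq_right (by linarith), max_eq_right (by linarith [(hx i hi).1])]
      simp
  filter_upwards [eventually_all.2 h] with m hm
  exact Finset.sum_eq_zero fun i hi => hm i (Finset.ne_of_mem_erase hi)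

/-- The shift `m⁻¹` together with the weight `m ^ 2` makes the penalty at least m even at x_i = B_i,
a face that the half-open cell excludes. The included face x_i = A_i needs no shift, so weight `m`
suffices below it. -/
lemma tendsto_cellPenalty {j : Fin d} {A B : Fin d → ℝ}
    {x : EuclideanSpace ℝ (Fin d)} (hx : ¬ InCell j A B x) :
    Tendsto (fun m => cellPenalty j A B m x) atTop atTop := by
  simp only [InCell, not_forall] at hx
  obtain ⟨i, hij, hi⟩ := hx
  have hmem : i ∈ Finset.univ.erase j := by simp [hij]
  have hsingle : ∀ m : ℝ, 0 ≤ m →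
      m ^ 2 * max (x i - B i + m⁻¹) 0 + m * max (A i - x i) 0 ≤ cellPenalty j A B m x :=
    fun m hm => Finset.single_le_sum
      (f := fun i => m ^ 2 * max (x i - B i + m⁻¹) 0 + m * max (A i - x i) 0)
      (fun i _ => by positivity) hmem
  by_cases hA : A i ≤ x i
  · have hB : B i ≤ x i := by
      by_contra h
      exact hi ⟨hA, not_le.1 h⟩
    refine tendsto_atTop_mono' _ ?_ tendsto_id
    filter_upwards [eventually_gt_atTop 0] with m hm
    refine le_trans ?_ (hsingle m hm.le)
    have h1 : m⁻¹ ≤ max (x i - B i + m⁻¹) 0 := le_max_of_le_left (by linarith)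
    calc m = m ^ 2 * m⁻¹ := by field_simp
      _ ≤ m ^ 2 * max (x i - B i + m⁻¹) 0 := by gcongr
      _ ≤ _ := le_add_of_nonneg_right (by positivity)
  · have hA' : 0 < A i - x i := by linarith
    refine tendsto_atTop_mono' _ ?_ (tendsto_id.atTop_mul_const hA')
    filter_upwards [eventually_ge_atTop 0] with m hm
    refine le_trans ?_ (hsingle m hm)
    rw [max_eq_left hA'.le]
    exact le_add_of_nonneg_left (by positivity)

open Classical in
/-- Stretch the part of the density `p` over the cell and above `a` by the factor `u⁻¹`. -/
noncomputable def stretch (j : Fin d) (A B : Fin d → ℝ) (a u : ℝ)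
    (p : EuclideanSpace ℝ (Fin d) → ℝ) (y : EuclideanSpace ℝ (Fin d)) : ℝ :=
  if InCell j A B y ∧ a ≤ y j then u * p (setCoord j y (a + u * (y j - a))) else p y

lemma inCell_setCoord {j : Fin d} {A B : Fin d → ℝ} {x : EuclideanSpace ℝ (Fin d)} {v : ℝ} :
    InCell j A B (setCoord j x v) ↔ InCell j A B x := by
  refine forall₂_congr fun i hi => ?_
  rw [setCoord_of_ne hi]

lemma stretch_inv_stretch (j : Fin d) (A B : Fin d → ℝ) (a : ℝ) {u : ℝ} (hu : 0 < u)
    (p : EuclideanSpace ℝ (Fin d) → ℝ) :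
    stretch j A B a u⁻¹ (stretch j A B a u p) = p := by
  ext y
  by_cases h : InCell j A B y ∧ a ≤ y j
  · have h2 : 0 ≤ u⁻¹ * (y j - a) := mul_nonneg (by positivity) (by linarith [h.2])
    rw [stretch, if_pos h, stretch, if_pos ⟨inCell_setCoord.2 h.1, by simpa using h2⟩]
    simp [hu.ne']
  · rw [stretch, if_neg h, stretch, if_neg h]

lemma abs_coord_le (j : Fin d) (x : EuclideanSpace ℝ (Fin d)) : |x j| ≤ ‖x‖ :=
  PiLp.norm_apply_le x j

/-- The approximants are stretchings above the graph of `a` plus the penalty. At each point they are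
eventually equal to their limit: over the cell the graph drops to height `a`, elsewhere it rises
past the point. The penalty is nonnegative, so it only lowers the positive part, and the linear
growth is uniform in `n`. -/
lemma exists_isDom_stretch_of_exp {r : EuclideanSpace ℝ (Fin d) → ℝ} (hr : IsTarget r)
    (j : Fin d) (A B : Fin d → ℝ) (a κ : ℝ) {C c : ℝ} (hc : 0 < c)
    {p : EuclideanSpace ℝ (Fin d) → ℝ} (hp : IsDom C c p) :
    (∃ C' c', 0 < c' ∧ IsDom C' c' (stretch j A B a (Real.exp (-κ)) p)) ∧
      klInf r p ≤ klInf r (stretch j A B a (Real.exp (-κ)) p) := by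
  choose F hF hFx hFs hFJ using fun n : ℕ =>
    exists_conj_stretch (isFlowShear_neg_cellPenalty j A B ((n : ℝ) + 1)) a κ
  set L := 1 + |Real.exp κ - 1| with hL
  set D := |Real.exp κ - 1| * |a| with hD
  have hgrow : ∀ n x, ‖F n x‖ ≤ L * ‖x‖ + D := by
    intro n x
    rw [hFx]
    refine (norm_add_le _ _).trans ?_
    rw [norm_smul, PiLp.norm_single, norm_one, mul_one, norm_mul, Real.norm_eq_abs,
      Real.norm_eq_abs, abs_of_nonneg (le_max_right (x j - cellPenalty j A B _ x - a) 0)]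
    have h1 : max (x j - cellPenalty j A B ((n : ℝ) + 1) x - a) 0 ≤ ‖x‖ + |a| := by
      refine max_le ?_ (by positivity)
      have := cellPenalty_nonneg j A B (by positivity : 0 ≤ (n : ℝ) + 1) x
      have h2 := (le_abs_self _).trans (abs_coord_le j x)
      have h3 := neg_le_abs a
      linarith
    have := mul_le_mul_of_nonneg_left h1 (abs_nonneg (Real.exp κ - 1))
    rw [hL, hD]; linarith
  have hB : ∀ n y, (if a ≤ y j - cellPenalty j A B ((n : ℝ) + 1) y then Real.exp (-κ) else 1) ≤
      Real.exp |κ| := by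
    intro n y
    split_ifs
    · exact Real.exp_le_exp.2 (neg_le_abs κ)
    · exact Real.one_le_exp (abs_nonneg κ)
  have hdom := fun n => hp.push hc.le (hFJ n) (hB n) (by positivity : 0 < L) (hgrow n)
  have hlim : ∀ y, Tendsto (fun n => p ((F n).symm y) *
      (if a ≤ y j - cellPenalty j A B ((n : ℝ) + 1) y then Real.exp (-κ) else 1)) atTop
      (𝓝 (stretch j A B a (Real.exp (-κ)) p y)) := by
    intro y
    have hn : Tendsto (fun n : ℕ => (n : ℝ) + 1) atTop atTop :=
      tendsto_atTop_add_const_right _ _ tendsto_natCast_atTop_atTop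
    refine tendsto_const_nhds.congr' ?_
    by_cases hy : InCell j A B y
    · filter_upwards [hn.eventually (eventually_cellPenalty_eq_zero hy)] with n hn
      rw [hFs, hn, sub_zero, stretch]
      by_cases ha : a ≤ y j
      · rw [if_pos ⟨hy, ha⟩, if_pos ha, max_eq_left (by linarith), mul_comm, setCoord]
        congr 4
        ring
      · rw [if_neg fun h => ha h.2, if_neg ha, max_eq_right (by linarith)]
        simp
    · filter_upwards [hn.eventually ((tendsto_cellPenalty hy).eventually_gt_atTop (y j - a))]
        with n hn
      rw [hFs, stretch, if_neg fun h => hy h.1, if_neg (by linarith), max_eq_right (by linarith)]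
      simp
  have hq : IsDom _ _ (stretch j A B a (Real.exp (-κ)) p) :=
    ⟨measurable_of_tendsto_metrizable (fun n => (hdom n).measurable) (tendsto_pi_nhds.2 hlim),
      fun y => ge_of_tendsto' (hlim y) fun n => (hdom n).nonneg y,
      fun y => le_of_tendsto' (hlim y) fun n => (hdom n).le y⟩
  exact ⟨⟨_, _, by positivity, hq⟩, le_klInf_of_tendsto hr (by positivity) hdom hq
    (ae_of_all _ hlim) fun n => klInf_le_klInf_push hp.measurable (hF n) (hFJ n)⟩

/-- `p` is nonnegative, measurable and has Gaussian decay. -/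
def HasGaussianDecay (p : EuclideanSpace ℝ (Fin d) → ℝ) : Prop :=
  ∃ C c : ℝ, 0 < c ∧ IsDom C c p

lemma HasGaussianDecay.stretch (j : Fin d) (A B : Fin d → ℝ) (a : ℝ) {u : ℝ} (hu : 0 < u)
    {p : EuclideanSpace ℝ (Fin d) → ℝ} (hp : HasGaussianDecay p) {r : EuclideanSpace ℝ (Fin d) → ℝ}
    (hr : IsTarget r) : HasGaussianDecay (stretch j A B a u p) := by
  obtain ⟨C, c, hc, hp⟩ := hp
  have := (exists_isDom_stretch_of_exp hr j A B a (-Real.log u) hc hp).1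
  rwa [neg_neg, Real.exp_log hu] at this

/-- The limit argument gives only one inequality; the other follows by applying it to the inverse
factor, which undoes the stretching. -/
lemma klInf_stretch {r : EuclideanSpace ℝ (Fin d) → ℝ} (hr : IsTarget r) (j : Fin d)
    (A B : Fin d → ℝ) (a : ℝ) {u : ℝ} (hu : 0 < u) {p : EuclideanSpace ℝ (Fin d) → ℝ}
    (hp : HasGaussianDecay p) : klInf r (stretch j A B a u p) = klInf r p := by
  have key : ∀ {v : ℝ} {q : EuclideanSpace ℝ (Fin d) → ℝ}, 0 < v → HasGaussianDecay q →
      klInf r q ≤ klInf r (NeuralTransport.stretch j A B a v q) := by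
    rintro v q hv ⟨C, c, hc, hq⟩
    have := (exists_isDom_stretch_of_exp hr j A B a (-Real.log v) hc hq).2
    rwa [neg_neg, Real.exp_log hv] at this
  refine le_antisymm ?_ (key hu hp)
  have := key (inv_pos.2 hu) (hp.stretch j A B a hu hr)
  rwa [stretch_inv_stretch j A B a hu] at this

/-! ### Boxes -/

/-- The half-open box `∏ [A i, B i)`. -/
def box (A B : Fin d → ℝ) : Set (EuclideanSpace ℝ (Fin d)) :=
  {x | ∀ i, A i ≤ x i ∧ x i < B i}

lemma mem_box {A B : Fin d → ℝ} {x : EuclideanSpace ℝ (Fin d)} :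
    x ∈ box A B ↔ ∀ i, A i ≤ x i ∧ x i < B i := Iff.rfl

lemma mem_box_iff_inCell (j : Fin d) {A B : Fin d → ℝ} {x : EuclideanSpace ℝ (Fin d)} :
    x ∈ box A B ↔ InCell j A B x ∧ A j ≤ x j ∧ x j < B j := by
  refine ⟨fun h => ⟨fun i _ => h i, h j⟩, fun h i => ?_⟩
  by_cases hi : i = j
  · subst hi; exact h.2
  · exact h.1 i hi

lemma mem_box_update_right {j : Fin d} {A B : Fin d → ℝ} {m : ℝ} (hm : m ≤ B j)
    {x : EuclideanSpace ℝ (Fin d)} :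
    x ∈ box A (Function.update B j m) ↔ x ∈ box A B ∧ x j < m := by
  constructor
  · intro h
    have hj := h j
    rw [Function.update_self] at hj
    refine ⟨fun i => ?_, hj.2⟩
    by_cases hi : i = j
    · subst hi; exact ⟨hj.1, hj.2.trans_le hm⟩
    · have := h i
      rwa [Function.update_of_ne hi] at this
  · rintro ⟨h, hx⟩ i
    by_cases hi : i = j
    · subst hi; rw [Function.update_self]; exact ⟨(h i).1, hx⟩
    · rw [Function.update_of_ne hi]; exact h i

lemma mem_box_update_left {j : Fin d} {A B : Fin d → ℝ} {m : ℝ} (hm : A j ≤ m)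
    {x : EuclideanSpace ℝ (Fin d)} :
    x ∈ box (Function.update A j m) B ↔ x ∈ box A B ∧ m ≤ x j := by
  constructor
  · intro h
    have hj := h j
    rw [Function.update_self] at hj
    refine ⟨fun i => ?_, hj.1⟩
    by_cases hi : i = j
    · subst hi; exact ⟨hm.trans hj.1, hj.2⟩
    · have := h i
      rwa [Function.update_of_ne hi] at this
  · rintro ⟨h, hx⟩ i
    by_cases hi : i = j
    · subst hi; rw [Function.update_self]; exact ⟨hx, (h i).2⟩
    · rw [Function.update_of_ne hi]; exact h i

lemma box_eq_preimage (A B : Fin d → ℝ) :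
    box A B = WithLp.ofLp ⁻¹' (Set.univ.pi fun i => Set.Ico (A i) (B i)) := by
  ext x; simp [mem_box]

lemma measurableSet_box (A B : Fin d → ℝ) : MeasurableSet (box A B) := by
  rw [box_eq_preimage]
  exact (PiLp.volume_preserving_ofLp (Fin d)).measurable
    (MeasurableSet.univ_pi fun i => measurableSet_Ico)

lemma volume_box (A B : Fin d → ℝ) : volume (box A B) = ∏ i, ENNReal.ofReal (B i - A i) := by
  rw [box_eq_preimage, (PiLp.volume_preserving_ofLp (Fin d)).measure_preimage
    (MeasurableSet.univ_pi fun i => measurableSet_Ico).nullMeasurableSet, Real.volume_pi_Ico]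

lemma volume_real_box {A B : Fin d → ℝ} (h : ∀ i, A i < B i) :
    volume.real (box A B) = ∏ i, (B i - A i) := by
  rw [Measure.real, volume_box, ENNReal.toReal_prod]
  exact Finset.prod_congr rfl fun i _ => ENNReal.toReal_ofReal (by linarith [h i])

lemma volume_box_ne_top (A B : Fin d → ℝ) : volume (box A B) ≠ ⊤ := by
  rw [volume_box]
  exact ENNReal.prod_ne_top fun i _ => ENNReal.ofReal_ne_top

lemma exists_norm_le_of_mem_box (A B : Fin d → ℝ) : ∃ R : ℝ, ∀ x ∈ box A B, ‖x‖ ≤ R := by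
  obtain ⟨R, hR⟩ := (isCompact_Icc (a := A) (b := B)).exists_bound_of_continuousOn
    (f := fun v => (WithLp.toLp 2 v : EuclideanSpace ℝ (Fin d)))
    (PiLp.continuous_toLp 2 _).continuousOn
  exact ⟨R, fun x hx => hR (WithLp.ofLp x) ⟨fun i => (hx i).1, fun i => (hx i).2.le⟩⟩

open Classical in
lemma HasGaussianDecay.ite_const {g : EuclideanSpace ℝ (Fin d) → ℝ} (hg : HasGaussianDecay g)
    (A B : Fin d → ℝ) {v : ℝ} (hv : 0 ≤ v) :
    HasGaussianDecay fun x => if x ∈ box A B then v else g x := by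
  obtain ⟨C, c, hc, hg⟩ := hg
  have hC := hg.const_nonneg
  obtain ⟨R, hR⟩ := exists_norm_le_of_mem_box A B
  refine ⟨C + v * Real.exp (c * R ^ 2), c, hc, Measurable.ite (measurableSet_box A B)
    measurable_const hg.measurable, fun x => ?_, fun x => ?_⟩
  · split_ifs
    · exact hv
    · exact hg.nonneg x
  · rw [add_mul]
    split_ifs with hx
    · have h1 : 1 ≤ Real.exp (c * R ^ 2) * Real.exp (-(c * ‖x‖ ^ 2)) := by
        rw [← Real.exp_add]
        refine Real.one_le_exp ?_
        have : ‖x‖ ^ 2 ≤ R ^ 2 := pow_le_pow_left₀ (norm_nonneg x) (hR x hx) 2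
        nlinarith
      have h2 := mul_le_mul_of_nonneg_left h1 hv
      have h3 : 0 ≤ C * Real.exp (-(c * ‖x‖ ^ 2)) := by positivity
      linarith
    · exact (hg.le x).trans (le_add_of_nonneg_right (by positivity))

open Classical in
lemma IsDom.ite_box {C C' c c' : ℝ} {p g : EuclideanSpace ℝ (Fin d) → ℝ} (hp : IsDom C c p)
    (hg : IsDom C' c' g) (A B : Fin d → ℝ) :
    IsDom (max C C') (min c c') fun x => if x ∈ box A B then p x else g x where
  measurable := Measurable.ite (measurableSet_box A B) hp.measurable hg.measurable
  nonneg x := by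
    split_ifs
    · exact hp.nonneg x
    · exact hg.nonneg x
  le x := by
    split_ifs
    · exact (hp.mono (le_max_left _ _) (min_le_left _ _)).le x
    · exact (hg.mono (le_max_right _ _) (min_le_right _ _)).le x

/-! ### Splitting a box on which the density is constant -/

open Classical in
-- Above the bottom, the middle and the top of the box the accumulated density factors are v₁/v,
-- v₂/v and 1, as the three ratios telescope. The condition v = (v₁ + v₂)/2 says that the
-- displacements in the two halves cancel at the top face, so beyond it the total map is the
-- identity.
lemma stretch_split {j : Fin d} {A B : Fin d → ℝ} (hAB : A j < B j)
    {p : EuclideanSpace ℝ (Fin d) → ℝ} {v v₁ v₂ : ℝ} (hv₁ : 0 < v₁) (hv₂ : 0 < v₂)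
    (hv : v = (v₁ + v₂) / 2) (hp : ∀ x ∈ box A B, p x = v) :
    stretch j A B (B j) (v / v₂) (stretch j A B ((A j + B j) / 2) (v₂ / v₁)
      (stretch j A B (A j) (v₁ / v) p)) =
    fun x => if x ∈ box A B then (if x j < (A j + B j) / 2 then v₁ else v₂) else p x := by
  have hv0 : 0 < v := by rw [hv]; positivity
  set m := (A j + B j) / 2 with hm
  have hAm : A j < m := by rw [hm]; linarith
  have hmB : m < B j := by rw [hm]; linarith
  ext y
  by_cases hcell : InCell j A B y
  swap
  · rw [stretch, if_neg fun h => hcell h.1, stretch, if_neg fun h => hcell h.1, stretch,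
      if_neg fun h => hcell h.1, if_neg fun h => hcell ((mem_box_iff_inCell j).1 h).1]
  have hcell' : ∀ s, InCell j A B (setCoord j y s) := fun s => inCell_setCoord.2 hcell
  rcases lt_or_ge (y j) (A j) with h1 | h1
  · rw [stretch, if_neg fun h => by linarith [h.2], stretch, if_neg fun h => by linarith [h.2],
      stretch, if_neg fun h => by linarith [h.2],
      if_neg fun h => by linarith [((mem_box_iff_inCell j).1 h).2.1]]
  rcases lt_or_ge (y j) (B j) with h2 | h2
  · rw [if_pos ((mem_box_iff_inCell j).2 ⟨hcell, h1, h2⟩), stretch, if_neg fun h => by linarith [h.2]]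
    rcases lt_or_ge (y j) m with h3 | h3
    · rw [if_pos h3, stretch, if_neg fun h => by linarith [h.2], stretch, if_pos ⟨hcell, h1⟩, hp]
      · field_simp
      · refine (mem_box_iff_inCell j).2 ⟨hcell' _, ?_, ?_⟩
        · rw [setCoord_same]
          have : 0 ≤ v₁ / v * (y j - A j) := mul_nonneg (by positivity) (by linarith)
          linarith
        · rw [setCoord_same]
          -- As 2v = v₁ + v₂ > v₁, a point of the lower half is pulled back less than twice as far
          -- from the bottom, hence stays inside the box.
          have h4 : v₁ / v < 2 := by rw [div_lt_iff₀ hv0]; linarith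
          have h5 : v₁ / v * (y j - A j) ≤ 2 * (y j - A j) :=
            mul_le_mul_of_nonneg_right h4.le (by linarith)
          linarith
    · have h4 : 0 ≤ v₂ / v₁ * (y j - m) := mul_nonneg (by positivity) (by linarith)
      rw [if_neg h3.not_gt, stretch, if_pos ⟨hcell, h3⟩, stretch,
        if_pos ⟨hcell' _, by rw [setCoord_same]; linarith⟩, setCoord_setCoord, setCoord_same, hp]
      · field_simp
      · have h5 : A j + v₁ / v * (m + v₂ / v₁ * (y j - m) - A j) =
            A j + v₁ / v * (m - A j) + v₂ / v * (y j - m) := by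
          field_simp; ring
        have h6 : A j + v₁ / v * (m - A j) + v₂ / v * (B j - m) = B j := by
          rw [hv, hm]; field_simp; ring
        have h7 : v₂ / v * (y j - m) < v₂ / v * (B j - m) :=
          mul_lt_mul_of_pos_left (by linarith) (by positivity)
        have h8 : 0 ≤ v₂ / v * (y j - m) := mul_nonneg (by positivity) (by linarith)
        have h9 : 0 ≤ v₁ / v * (m - A j) := mul_nonneg (by positivity) (by linarith)
        refine (mem_box_iff_inCell j).2 ⟨hcell' _, ?_, ?_⟩ <;> rw [setCoord_same, h5] <;> linarith
  · have h4 : 0 ≤ v / v₂ * (y j - B j) := mul_nonneg (by positivity) (by linarith)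
    have h5 : 0 ≤ v₂ / v₁ * (B j + v / v₂ * (y j - B j) - m) :=
      mul_nonneg (by positivity) (by linarith)
    rw [if_neg fun h => by linarith [((mem_box_iff_inCell j).1 h).2.2], stretch,
      if_pos ⟨hcell, h2⟩, stretch, if_pos ⟨hcell' _, by rw [setCoord_same]; linarith⟩, stretch,
      if_pos ⟨by rw [setCoord_setCoord]; exact hcell' _, by
        rw [setCoord_same, setCoord_same]; linarith⟩]
    simp only [setCoord_setCoord, setCoord_same]
    -- Above the top face the composite pull-back is the identity; this is where the mean condition
    -- enters.
    have h6 : A j + v₁ / v * (m + v₂ / v₁ * (B j + v / v₂ * (y j - B j) - m) - A j) = y j := by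
      rw [hv, hm]; field_simp; ring
    rw [h6, setCoord_self]
    field_simp

open Classical in
lemma klInf_split {r : EuclideanSpace ℝ (Fin d) → ℝ} (hr : IsTarget r) {j : Fin d}
    {A B : Fin d → ℝ} (hAB : A j < B j) {p : EuclideanSpace ℝ (Fin d) → ℝ}
    (hpd : HasGaussianDecay p) {v v₁ v₂ : ℝ} (hv₁ : 0 < v₁) (hv₂ : 0 < v₂)
    (hv : v = (v₁ + v₂) / 2) (hp : ∀ x ∈ box A B, p x = v) :
    HasGaussianDecay (fun x => if x ∈ box A B then
      (if x j < (A j + B j) / 2 then v₁ else v₂) else p x) ∧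
    klInf r (fun x => if x ∈ box A B then
      (if x j < (A j + B j) / 2 then v₁ else v₂) else p x) = klInf r p := by
  have hv0 : 0 < v := by rw [hv]; positivity
  rw [← stretch_split hAB hv₁ hv₂ hv hp]
  have d1 := hpd.stretch j A B (A j) (div_pos hv₁ hv0) hr
  have d2 := d1.stretch j A B ((A j + B j) / 2) (div_pos hv₂ hv₁) hr
  refine ⟨d2.stretch j A B (B j) (div_pos hv0 hv₂) hr, ?_⟩
  rw [klInf_stretch hr _ _ _ _ (div_pos hv0 hv₂) d2, klInf_stretch hr _ _ _ _ (div_pos hv₂ hv₁) d1,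
    klInf_stretch hr _ _ _ _ (div_pos hv₁ hv0) hpd]

/-! ### Step functions obtained by successive bisections -/

/-- A step function on a box, given by successive bisections. -/
inductive StepTree (d : ℕ) : Type
  | leaf (v : ℝ) : StepTree d
  | node (j : Fin d) (l r : StepTree d) : StepTree d

namespace StepTree

/-- The mean value of the step function. -/
noncomputable def mean : StepTree d → ℝ
  | leaf v => v
  | node _ l r => (l.mean + r.mean) / 2

/-- All values are positive. -/
def Pos : StepTree d → Prop
  | leaf v => 0 < v
  | node _ l r => l.Pos ∧ r.Pos

/-- The value of the step function on the box with corners `A`, `B`. -/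
noncomputable def eval : StepTree d → (Fin d → ℝ) → (Fin d → ℝ) → EuclideanSpace ℝ (Fin d) → ℝ
  | leaf v, _, _, _ => v
  | node j l r, A, B, x =>
    if x j < (A j + B j) / 2 then l.eval A (Function.update B j ((A j + B j) / 2)) x
    else r.eval (Function.update A j ((A j + B j) / 2)) B x

lemma Pos.mean_pos : ∀ {t : StepTree d}, t.Pos → 0 < t.mean
  | leaf _, h => h
  | node _ _ _, h => by
    have h1 := Pos.mean_pos h.1
    have h2 := Pos.mean_pos h.2
    simp only [mean]
    positivity

end StepTree

lemma lt_update_midpoint {A B : Fin d → ℝ} (h : ∀ i, A i < B i) (j : Fin d) :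
    ∀ i, A i < Function.update B j ((A j + B j) / 2) i := by
  intro i
  by_cases hi : i = j
  · subst hi; rw [Function.update_self]; linarith [h i]
  · rw [Function.update_of_ne hi]; exact h i

lemma update_midpoint_lt {A B : Fin d → ℝ} (h : ∀ i, A i < B i) (j : Fin d) :
    ∀ i, Function.update A j ((A j + B j) / 2) i < B i := by
  intro i
  by_cases hi : i = j
  · subst hi; rw [Function.update_self]; linarith [h i]
  · rw [Function.update_of_ne hi]; exact h i

open Classical in
-- By induction from the root: one split gives each half the mean of its subtree, and then each half
-- is refined with the rest of the density as exterior data. Quantifying over all `p` lets the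
-- second refinement run with the first one already in place.
lemma klInf_stepTree {r : EuclideanSpace ℝ (Fin d) → ℝ} (hr : IsTarget r) (t : StepTree d) :
    ∀ {A B : Fin d → ℝ}, (∀ i, A i < B i) → t.Pos → ∀ {p : EuclideanSpace ℝ (Fin d) → ℝ},
      HasGaussianDecay p → (∀ x ∈ box A B, p x = t.mean) →
      HasGaussianDecay (fun x => if x ∈ box A B then t.eval A B x else p x) ∧
      klInf r (fun x => if x ∈ box A B then t.eval A B x else p x) = klInf r p := by
  induction t with
  | leaf v =>
    intro A B _ _ p hpd hp
    have : (fun x => if x ∈ box A B then (StepTree.leaf v).eval A B x else p x) = p := by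
      ext x
      split_ifs with hx
      · exact (hp x hx).symm
      · rfl
    rw [this]
    exact ⟨hpd, rfl⟩
  | node j s t ihs iht =>
    intro A B hAB hpos p hpd hp
    obtain ⟨d1, k1⟩ := klInf_split hr (hAB j) hpd hpos.1.mean_pos hpos.2.mean_pos rfl hp
    set m := (A j + B j) / 2 with hm
    have hmB : m ≤ B j := by linarith [hAB j]
    have hAm : A j ≤ m := by linarith [hAB j]
    obtain ⟨d2, k2⟩ := ihs (lt_update_midpoint hAB j) hpos.1 d1 (fun x hx => by
      rw [mem_box_update_right hmB] at hx
      rw [if_pos hx.1, if_pos hx.2])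
    obtain ⟨d3, k3⟩ := iht (update_midpoint_lt hAB j) hpos.2 d2 (fun x hx => by
      rw [mem_box_update_left hAm] at hx
      rw [if_neg fun h => ((mem_box_update_right hmB).1 h).2.not_ge hx.2, if_pos hx.1,
        if_neg hx.2.not_gt])
    rw [k2, k1] at k3
    have heq : (fun x => if x ∈ box A B then (StepTree.node j s t).eval A B x else p x) =
        fun x => if x ∈ box (Function.update A j m) B then t.eval (Function.update A j m) B x
          else if x ∈ box A (Function.update B j m) then s.eval A (Function.update B j m) x
          else if x ∈ box A B then (if x j < m then s.mean else t.mean) else p x := by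
      ext x
      simp only [mem_box_update_right hmB, mem_box_update_left hAm, StepTree.eval]
      by_cases hx : x ∈ box A B
      · rcases lt_or_ge (x j) m with h | h
        · simp [hx, h, h.not_ge, ← hm]
        · simp [hx, h, h.not_gt, ← hm]
      · simp [hx]
    rw [heq]
    exact ⟨d3, k3⟩

/-! ### Approximation of positive continuous functions by step functions -/

lemma box_update_union {j : Fin d} {A B : Fin d → ℝ} {m : ℝ} (h1 : A j ≤ m) (h2 : m ≤ B j) :
    box A B = box A (Function.update B j m) ∪ box (Function.update A j m) B := by
  ext x
  rw [Set.mem_union, mem_box_update_right h2, mem_box_update_left h1, ← and_or_left]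
  exact ⟨fun h => ⟨h, lt_or_ge _ _⟩, fun h => h.1⟩

lemma box_update_disjoint {j : Fin d} {A B : Fin d → ℝ} {m : ℝ} (h1 : A j ≤ m) (h2 : m ≤ B j) :
    Disjoint (box A (Function.update B j m)) (box (Function.update A j m) B) := by
  rw [Set.disjoint_left]
  intro x hx hx'
  exact ((mem_box_update_right h2).1 hx).2.not_ge ((mem_box_update_left h1).1 hx').2

lemma prod_update_midpoint_right (A B : Fin d → ℝ) (j : Fin d) :
    ∏ i, (Function.update B j ((A j + B j) / 2) i - A i) = (∏ i, (B i - A i)) / 2 := by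
  rw [← Finset.mul_prod_erase _ _ (Finset.mem_univ j), ← Finset.mul_prod_erase _ _
    (Finset.mem_univ j), Function.update_self, Finset.prod_congr rfl fun i hi => by
    rw [Function.update_of_ne (Finset.ne_of_mem_erase hi)]]
  ring

lemma prod_update_midpoint_left (A B : Fin d → ℝ) (j : Fin d) :
    ∏ i, (B i - Function.update A j ((A j + B j) / 2) i) = (∏ i, (B i - A i)) / 2 := by
  rw [← Finset.mul_prod_erase _ _ (Finset.mem_univ j), ← Finset.mul_prod_erase _ _
    (Finset.mem_univ j), Function.update_self, Finset.prod_congr rfl fun i hi => by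
    rw [Function.update_of_ne (Finset.ne_of_mem_erase hi)]]
  ring

/-- `t` approximates `f` on the box up to a factor `e^η`, with the same mean value. -/
structure StepTree.Approx (t : StepTree d) (A B : Fin d → ℝ) (η : ℝ)
    (f : EuclideanSpace ℝ (Fin d) → ℝ) : Prop where
  pos : t.Pos
  mean_eq : t.mean = (∫ x in box A B, f x) / ∏ i, (B i - A i)
  le : ∀ x ∈ box A B, Real.exp (-η) * f x ≤ t.eval A B x
  ge : ∀ x ∈ box A B, t.eval A B x ≤ Real.exp η * f x

/-- An average lies between the extreme values, so a small oscillation suffices. Using the average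
rather than a sampled value keeps masses exact, and functions of equal mass get trees with equal
root mean. -/
lemma StepTree.Approx.leaf {A B : Fin d → ℝ} (hAB : ∀ i, A i < B i) {η : ℝ}
    {f : EuclideanSpace ℝ (Fin d) → ℝ} (hf : ∀ x, 0 < f x) (hfi : Integrable f)
    (hosc : ∀ x ∈ box A B, ∀ y ∈ box A B, f y ≤ Real.exp η * f x) :
    (StepTree.leaf ((∫ x in box A B, f x) / ∏ i, (B i - A i))).Approx A B η f := by
  have hV : 0 < ∏ i, (B i - A i) := Finset.prod_pos fun i _ => by linarith [hAB i]
  have hVr := volume_real_box hAB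
  have hms := measurableSet_box A B
  have hconst : ∀ c : ℝ, ∫ _ in box A B, c = (∏ i, (B i - A i)) * c := by
    intro c
    rw [setIntegral_const, hVr, smul_eq_mul]
  have hci : ∀ c : ℝ, IntegrableOn (fun _ => c) (box A B) := fun c =>
    integrableOn_const (volume_box_ne_top A B)
  have hle : ∀ x ∈ box A B, Real.exp (-η) * f x ≤ (∫ x in box A B, f x) / ∏ i, (B i - A i) := by
    intro x hx
    rw [le_div_iff₀ hV, mul_comm, ← hconst]
    refine setIntegral_mono_on (hci _) hfi.integrableOn hms fun y hy => ?_
    rw [Real.exp_neg, inv_mul_le_iff₀ (Real.exp_pos _)]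
    exact hosc y hy x hx
  have hge : ∀ x ∈ box A B, (∫ x in box A B, f x) / ∏ i, (B i - A i) ≤ Real.exp η * f x := by
    intro x hx
    rw [div_le_iff₀ hV, mul_comm, ← hconst]
    exact setIntegral_mono_on hfi.integrableOn (hci _) hms fun y hy => hosc x hx y hy
  refine ⟨?_, rfl, hle, hge⟩
  have hmem : (WithLp.toLp 2 A : EuclideanSpace ℝ (Fin d)) ∈ box A B := fun i => ⟨le_rfl, hAB i⟩
  exact (mul_pos (Real.exp_pos _) (hf _)).trans_le (hle _ hmem)

lemma StepTree.Approx.node {A B : Fin d → ℝ} (hAB : ∀ i, A i < B i) {η : ℝ}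
    {f : EuclideanSpace ℝ (Fin d) → ℝ} (hfi : Integrable f) {j : Fin d} {s t : StepTree d}
    (hs : s.Approx A (Function.update B j ((A j + B j) / 2)) η f)
    (ht : t.Approx (Function.update A j ((A j + B j) / 2)) B η f) :
    (StepTree.node j s t).Approx A B η f := by
  have hmB : (A j + B j) / 2 ≤ B j := by linarith [hAB j]
  have hAm : A j ≤ (A j + B j) / 2 := by linarith [hAB j]
  have hV : 0 < ∏ i, (B i - A i) := Finset.prod_pos fun i _ => by linarith [hAB i]
  refine ⟨⟨hs.pos, ht.pos⟩, ?_, fun x hx => ?_, fun x hx => ?_⟩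
  · rw [StepTree.mean, hs.mean_eq, ht.mean_eq, prod_update_midpoint_right,
      prod_update_midpoint_left, box_update_union hAm hmB, setIntegral_union
        (box_update_disjoint hAm hmB) (measurableSet_box _ _) hfi.integrableOn hfi.integrableOn]
    field_simp
  · rw [StepTree.eval]
    split_ifs with h
    · exact hs.le x ((mem_box_update_right hmB).2 ⟨hx, h⟩)
    · exact ht.le x ((mem_box_update_left hAm).2 ⟨hx, not_lt.1 h⟩)
  · rw [StepTree.eval]
    split_ifs with h
    · exact hs.ge x ((mem_box_update_right hmB).2 ⟨hx, h⟩)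
    · exact ht.ge x ((mem_box_update_left hAm).2 ⟨hx, not_lt.1 h⟩)

/-- The list prescribes the order of the bisections. Each occurrence of `i` halves the i-th side, so
the count of `i` bounds the admissible initial width. -/
lemma exists_approx_of_count {A₀ B₀ : Fin d → ℝ} {η δ : ℝ} {f : EuclideanSpace ℝ (Fin d) → ℝ}
    (hf : ∀ x, 0 < f x) (hfi : Integrable f)
    (hosc : ∀ x ∈ box A₀ B₀, ∀ y ∈ box A₀ B₀, (∀ i, |x i - y i| < δ) → f y ≤ Real.exp η * f x)
    (l : List (Fin d)) : ∀ {A B : Fin d → ℝ}, (∀ i, A i < B i) → box A B ⊆ box A₀ B₀ →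
      (∀ i, B i - A i < 2 ^ l.count i * δ) → ∃ t : StepTree d, t.Approx A B η f := by
  induction l with
  | nil =>
    intro A B hAB hsub hw
    refine ⟨_, StepTree.Approx.leaf hAB hf hfi fun x hx y hy =>
      hosc x (hsub hx) y (hsub hy) fun i => ?_⟩
    have h1 := hx i
    have h2 := hy i
    have h3 := hw i
    simp only [List.count_nil, pow_zero, one_mul] at h3
    rw [abs_lt]
    constructor <;> linarith
  | cons j l ih =>
    intro A B hAB hsub hw
    have hmB : (A j + B j) / 2 ≤ B j := by linarith [hAB j]
    have hAm : A j ≤ (A j + B j) / 2 := by linarith [hAB j]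
    have hwj := hw j
    rw [List.count_cons_self, pow_succ] at hwj
    obtain ⟨s, hs⟩ := ih (lt_update_midpoint hAB j)
      (fun x hx => hsub ((mem_box_update_right hmB).1 hx).1) (fun i => by
        by_cases hi : i = j
        · subst hi; rw [Function.update_self]; linarith
        · have := hw i
          rw [List.count_cons_of_ne (Ne.symm hi)] at this
          rwa [Function.update_of_ne hi])
    obtain ⟨t, ht⟩ := ih (update_midpoint_lt hAB j)
      (fun x hx => hsub ((mem_box_update_left hAm).1 hx).1) (fun i => by
        by_cases hi : i = j
        · subst hi; rw [Function.update_self]; linarith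
        · have := hw i
          rw [List.count_cons_of_ne (Ne.symm hi)] at this
          rwa [Function.update_of_ne hi])
    exact ⟨_, StepTree.Approx.node hAB hfi hs ht⟩

lemma exists_list_count (d k : ℕ) : ∃ l : List (Fin d), ∀ i, l.count i = k := by
  induction k with
  | zero => exact ⟨[], fun i => rfl⟩
  | succ k ih =>
    obtain ⟨l, hl⟩ := ih
    refine ⟨l ++ List.finRange d, fun i => ?_⟩
    rw [List.count_append, hl, List.count_eq_one_of_mem (List.nodup_finRange d)
      (List.mem_finRange i)]

/-- Uniform continuity of log f on the closed box; the logarithm turns additive into multiplicative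
oscillation. -/
lemma exists_oscillation_bound {f : EuclideanSpace ℝ (Fin d) → ℝ} (hfc : Continuous f)
    (hf : ∀ x, 0 < f x) (A B : Fin d → ℝ) {η : ℝ} (hη : 0 < η) :
    ∃ δ > 0, ∀ x ∈ box A B, ∀ y ∈ box A B, (∀ i, |x i - y i| < δ) → f y ≤ Real.exp η * f x := by
  have hc : Continuous fun v : Fin d → ℝ => Real.log (f (WithLp.toLp 2 v)) :=
    (hfc.comp (PiLp.continuous_toLp 2 _)).log fun v => (hf _).ne'
  have hu := (isCompact_Icc (a := A) (b := B)).uniformContinuousOn_of_continuous hc.continuousOn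
  rw [Metric.uniformContinuousOn_iff] at hu
  obtain ⟨δ, hδ, h⟩ := hu η hη
  refine ⟨δ, hδ, fun x hx y hy hxy => ?_⟩
  have h1 := h (WithLp.ofLp x) ⟨fun i => (hx i).1, fun i => (hx i).2.le⟩ (WithLp.ofLp y)
    ⟨fun i => (hy i).1, fun i => (hy i).2.le⟩ ((dist_pi_lt_iff hδ).2 fun i => hxy i)
  rw [Real.dist_eq, WithLp.toLp_ofLp, WithLp.toLp_ofLp] at h1
  have h2 : Real.log (f y) ≤ η + Real.log (f x) := by linarith [(abs_lt.1 h1).1]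
  calc f y = Real.exp (Real.log (f y)) := (Real.exp_log (hf y)).symm
    _ ≤ Real.exp (η + Real.log (f x)) := Real.exp_le_exp.2 h2
    _ = _ := by rw [Real.exp_add, Real.exp_log (hf x)]

lemma exists_approx {f : EuclideanSpace ℝ (Fin d) → ℝ} (hfc : Continuous f) (hf : ∀ x, 0 < f x)
    (hfi : Integrable f) {A B : Fin d → ℝ} (hAB : ∀ i, A i < B i) {η : ℝ} (hη : 0 < η) :
    ∃ t : StepTree d, t.Approx A B η f := by
  obtain ⟨δ, hδ, hosc⟩ := exists_oscillation_bound hfc hf A B hη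
  obtain ⟨k, hk⟩ : ∃ k : ℕ, ∀ i, B i - A i < 2 ^ k * δ := by
    have h : ∀ i, ∀ᶠ k : ℕ in atTop, B i - A i < 2 ^ k * δ := fun i =>
      ((tendsto_pow_atTop_atTop_of_one_lt one_lt_two).atTop_mul_const hδ).eventually_gt_atTop _
    exact (eventually_all.2 h).exists
  obtain ⟨l, hl⟩ := exists_list_count d k
  exact exists_approx_of_count hf hfi hosc l hAB subset_rfl fun i => by rw [hl]; exact hk i

/-! ### Comparison of the infimal relative entropies of two densities -/

open Classical in
-- Equal masses give the step approximations of `f` and `g` the same mean. Filled in on the box they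
-- yield `qs` and `qt`, both reached from the single density `c`, so their infimal entropies
-- coincide. Comparing `g` with `qt` and `qs` with the replaced density costs one factor e^η each.
lemma klInf_le_replace_box_of_pos {r : EuclideanSpace ℝ (Fin d) → ℝ} (hr : IsTarget r)
    {f g : EuclideanSpace ℝ (Fin d) → ℝ} (hfc : Continuous f) (hgc : Continuous g)
    (hf : ∀ x, 0 < f x) (hg : ∀ x, 0 < g x) (hfd : HasGaussianDecay f) (hgd : HasGaussianDecay g)
    {A B : Fin d → ℝ} (hAB : ∀ i, A i < B i)
    (hmass : ∫ x in box A B, f x = ∫ x in box A B, g x) {η : ℝ} (hη : 0 < η) :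
    klInf r g ≤ ENNReal.ofReal (Real.exp η) * (ENNReal.ofReal (Real.exp η) *
      klInf r (fun x => if x ∈ box A B then f x else g x) +
      ENNReal.ofReal (Real.exp η * η * (∫ x, if x ∈ box A B then f x else g x) +
        (1 - Real.exp (-η)) * ∫ x, r x)) +
      ENNReal.ofReal (Real.exp η * η * (Real.exp η * ∫ x, g x) +
        (1 - Real.exp (-η)) * ∫ x, r x) := by
  have nice : ∀ {p : EuclideanSpace ℝ (Fin d) → ℝ}, HasGaussianDecay p → IsNice p :=
    fun ⟨C, c, hc, hp⟩ => hp.isNice hc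
  have hfi := (nice hfd).integrable
  have hgi := (nice hgd).integrable
  obtain ⟨s, hs⟩ := exists_approx hfc hf hfi hAB hη
  obtain ⟨t, ht⟩ := exists_approx hgc hg hgi hAB hη
  have hst : s.mean = t.mean := by rw [hs.mean_eq, ht.mean_eq, hmass]
  set h : EuclideanSpace ℝ (Fin d) → ℝ := fun x => if x ∈ box A B then f x else g x with hh
  set c : EuclideanSpace ℝ (Fin d) → ℝ := fun x => if x ∈ box A B then t.mean else g x with hcdef
  have hcd : HasGaussianDecay c := hgd.ite_const A B ht.pos.mean_pos.le
  have hcin : ∀ x ∈ box A B, c x = t.mean := fun x hx => if_pos hx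
  obtain ⟨ds, ks⟩ := klInf_stepTree hr s hAB hs.pos hcd (fun x hx => (hcin x hx).trans hst.symm)
  obtain ⟨dt, kt⟩ := klInf_stepTree hr t hAB ht.pos hcd hcin
  set qs : EuclideanSpace ℝ (Fin d) → ℝ := fun x => if x ∈ box A B then s.eval A B x else c x
    with hqs
  set qt : EuclideanSpace ℝ (Fin d) → ℝ := fun x => if x ∈ box A B then t.eval A B x else c x
    with hqt
  have hhd : HasGaussianDecay h := by
    obtain ⟨C, a, ha, hf'⟩ := hfd
    obtain ⟨C', a', ha', hg'⟩ := hgd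
    exact ⟨_, _, lt_min ha ha', hf'.ite_box hg' A B⟩
  have he1 : Real.exp (-η) ≤ 1 := by simpa using hη.le
  have he2 : 1 ≤ Real.exp η := by simpa using hη.le
  have hout : ∀ x, Real.exp (-η) * g x ≤ g x ∧ g x ≤ Real.exp η * g x := fun x =>
    ⟨mul_le_of_le_one_left (hg x).le he1, le_mul_of_one_le_left (hg x).le he2⟩
  have hinv : ∀ {a b : ℝ}, Real.exp (-η) * a ≤ b → a ≤ Real.exp η * b := by
    intro a b hab
    rwa [Real.exp_neg, inv_mul_le_iff₀ (Real.exp_pos _)] at hab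
  have hinv' : ∀ {a b : ℝ}, a ≤ Real.exp η * b → Real.exp (-η) * a ≤ b := by
    intro a b hab
    rwa [Real.exp_neg, inv_mul_le_iff₀ (Real.exp_pos _)]
  have hqt1 : ∀ x, Real.exp (-η) * g x ≤ qt x ∧ qt x ≤ Real.exp η * g x := by
    intro x
    by_cases hx : x ∈ box A B
    · simp only [hqt, if_pos hx]; exact ⟨ht.le x hx, ht.ge x hx⟩
    · simp only [hqt, hcdef, if_neg hx]; exact hout x
  have hqs1 : ∀ x, Real.exp (-η) * h x ≤ qs x ∧ qs x ≤ Real.exp η * h x := by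
    intro x
    by_cases hx : x ∈ box A B
    · simp only [hqs, hh, if_pos hx]; exact ⟨hs.le x hx, hs.ge x hx⟩
    · simp only [hqs, hh, hcdef, if_neg hx]; exact hout x
  have k1 := klInf_le_of_ratio hr hη.le (nice hgd) (nice dt) (fun x => hinv' (hqt1 x).2)
    (fun x => hinv (hqt1 x).1)
  have k2 := klInf_le_of_ratio hr hη.le (nice ds) (nice hhd) (fun x => (hqs1 x).1)
    (fun x => (hqs1 x).2)
  rw [kt, ← ks] at k1
  refine k1.trans (add_le_add (by gcongr) (ENNReal.ofReal_le_ofReal ?_))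
  have hint : ∫ x, qt x ≤ Real.exp η * ∫ x, g x := by
    rw [← integral_const_mul]
    exact integral_mono (nice dt).integrable (hgi.const_mul _) fun x => (hqt1 x).2
  gcongr

open Classical in
lemma klInf_le_replace_box {r : EuclideanSpace ℝ (Fin d) → ℝ} (hr : IsTarget r)
    {f g : EuclideanSpace ℝ (Fin d) → ℝ} (hfc : Continuous f) (hgc : Continuous g)
    (hf : ∀ x, 0 < f x) (hg : ∀ x, 0 < g x) (hfd : HasGaussianDecay f) (hgd : HasGaussianDecay g)
    {A B : Fin d → ℝ} (hAB : ∀ i, A i < B i)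
    (hmass : ∫ x in box A B, f x = ∫ x in box A B, g x) :
    klInf r g ≤ klInf r (fun x => if x ∈ box A B then f x else g x) := by
  set K := klInf r (fun x => if x ∈ box A B then f x else g x) with hK
  by_cases htop : K = ⊤
  · rw [htop]; exact le_top
  have hexp : Tendsto (fun η : ℝ => ENNReal.ofReal (Real.exp η)) (𝓝[>] 0) (𝓝 1) := by
    have : Continuous fun η : ℝ => ENNReal.ofReal (Real.exp η) :=
      ENNReal.continuous_ofReal.comp Real.continuous_exp
    simpa using (this.tendsto 0).mono_left nhdsWithin_le_nhds
  have herr : ∀ a b : ℝ, Tendsto (fun η : ℝ => ENNReal.ofReal (Real.exp η * η * a +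
      (1 - Real.exp (-η)) * b)) (𝓝[>] 0) (𝓝 0) := by
    intro a b
    have : Continuous fun η : ℝ => ENNReal.ofReal (Real.exp η * η * a +
      (1 - Real.exp (-η)) * b) :=
      ENNReal.continuous_ofReal.comp (by fun_prop)
    simpa using (this.tendsto 0).mono_left nhdsWithin_le_nhds
  have herr' : ∀ a b : ℝ, Tendsto (fun η : ℝ => ENNReal.ofReal (Real.exp η * η * (Real.exp η * a) +
      (1 - Real.exp (-η)) * b)) (𝓝[>] 0) (𝓝 0) := by
    intro a b
    have : Continuous fun η : ℝ => ENNReal.ofReal (Real.exp η * η * (Real.exp η * a) +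
      (1 - Real.exp (-η)) * b) :=
      ENNReal.continuous_ofReal.comp (by fun_prop)
    simpa using (this.tendsto 0).mono_left nhdsWithin_le_nhds
  have hlim := (ENNReal.Tendsto.mul hexp (Or.inl one_ne_zero)
    ((ENNReal.Tendsto.mul_const hexp (Or.inr htop)).add
      (herr (∫ x, if x ∈ box A B then f x else g x) (∫ x, r x)))
    (Or.inr ENNReal.one_ne_top)).add (herr' (∫ x, g x) (∫ x, r x))
  simp only [one_mul, add_zero] at hlim
  refine ge_of_tendsto hlim ?_
  filter_upwards [self_mem_nhdsWithin] with η hη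
  exact klInf_le_replace_box_of_pos hr hfc hgc hf hg hfd hgd hAB hmass hη

/-! ### Exhaustion of the space by cubes -/

/-- The cube `[-(n + 1), n + 1)^d`. -/
def cube (d n : ℕ) : Set (EuclideanSpace ℝ (Fin d)) :=
  box (fun _ => -((n : ℝ) + 1)) fun _ => (n : ℝ) + 1

lemma cube_monotone (d : ℕ) : Monotone (cube d) := by
  intro m n hmn x hx i
  have h : (m : ℝ) ≤ n := by exact_mod_cast hmn
  have hi := hx i
  simp only at hi ⊢
  exact ⟨by linarith [hi.1], by linarith [hi.2]⟩

lemma eventually_mem_cube (x : EuclideanSpace ℝ (Fin d)) : ∀ᶠ n in atTop, x ∈ cube d n := by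
  filter_upwards [tendsto_natCast_atTop_atTop.eventually_ge_atTop ‖x‖] with n hn i
  have h := abs_le.1 ((abs_coord_le i x).trans hn)
  simp only
  exact ⟨by linarith [h.1], by linarith [h.2]⟩

lemma iUnion_cube (d : ℕ) : ⋃ n, cube d n = Set.univ :=
  Set.eq_univ_of_forall fun x => Set.mem_iUnion.2 (eventually_mem_cube x).exists

lemma tendsto_setIntegral_cube {f : EuclideanSpace ℝ (Fin d) → ℝ} (hf : Integrable f) :
    Tendsto (fun n => ∫ x in cube d n, f x) atTop (𝓝 (∫ x, f x)) := by
  have h := tendsto_setIntegral_of_monotone (s := cube d) (fun n => measurableSet_box _ _) (cube_monotone d)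
    (f := f) hf.integrableOn
  rwa [iUnion_cube, setIntegral_univ] at h

lemma setIntegral_cube_pos {f : EuclideanSpace ℝ (Fin d) → ℝ} (hf : Integrable f)
    (hpos : ∀ x, 0 < f x) (n : ℕ) : 0 < ∫ x in cube d n, f x := by
  rw [setIntegral_pos_iff_support_of_nonneg_ae (ae_of_all _ fun x => (hpos x).le) hf.integrableOn]
  have h : Function.support f = Set.univ := Set.eq_univ_of_forall fun x => (hpos x).ne'
  rw [h, Set.univ_inter, cube, volume_box]
  refine pos_iff_ne_zero.2 (Finset.prod_ne_zero_iff.2 fun i _ => ?_)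
  rw [ne_eq, ENNReal.ofReal_eq_zero, not_le]
  linarith [(Nat.cast_nonneg n : (0 : ℝ) ≤ n)]

lemma IsDom.const_mul {C c κ : ℝ} {p : EuclideanSpace ℝ (Fin d) → ℝ} (hp : IsDom C c p)
    (hκ : 0 ≤ κ) : IsDom (κ * C) c fun x => κ * p x where
  measurable := hp.measurable.const_mul κ
  nonneg x := mul_nonneg hκ (hp.nonneg x)
  le x := by rw [mul_assoc]; exact mul_le_mul_of_nonneg_left (hp.le x) hκ

/-- On each cube replace `g` by a multiple of `f` with the same mass there. The multiples tend to 1,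
so the modified densities tend pointwise to `f`, and upper semicontinuity concludes. -/
lemma klInf_le_of_continuous {r : EuclideanSpace ℝ (Fin d) → ℝ} (hr : IsTarget r)
    {f g : EuclideanSpace ℝ (Fin d) → ℝ} (hfc : Continuous f) (hgc : Continuous g)
    (hf : ∀ x, 0 < f x) (hg : ∀ x, 0 < g x) (hfd : HasGaussianDecay f) (hgd : HasGaussianDecay g)
    (hmass : ∫ x, f x = ∫ x, g x) : klInf r g ≤ klInf r f := by
  classical
  obtain ⟨C, c, hc, hfD⟩ := hfd
  obtain ⟨C', c', hc', hgD⟩ := hgd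
  have hfi := hfD.integrable hc
  have hgi := hgD.integrable hc'
  have hf0 := setIntegral_cube_pos hfi hf
  have hg0 := setIntegral_cube_pos hgi hg
  set κ : ℕ → ℝ := fun n => (∫ x in cube d n, g x) / ∫ x in cube d n, f x with hκ
  -- The smallest cube bounds all the ratios from above; the maximum with 1 lets the same constant
  -- cover the limit `f`.
  set κ₀ : ℝ := max 1 ((∫ x, g x) / ∫ x in cube d 0, f x) with hκ₀
  have hκ0 : ∀ n, 0 < κ n := fun n => div_pos (hg0 n) (hf0 n)
  have hκle : ∀ n, κ n ≤ κ₀ := by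
    intro n
    refine le_trans ?_ (le_max_right _ _)
    refine div_le_div₀ (integral_nonneg fun x => (hg x).le) ?_ (hf0 0) ?_
    · exact setIntegral_le_integral hgi (ae_of_all _ fun x => (hg x).le)
    · exact setIntegral_mono_set hfi.integrableOn (ae_of_all _ fun x => (hf x).le)
        (cube_monotone d (Nat.zero_le n)).eventuallyLE
  have hI : 0 < ∫ x, f x := (hf0 0).trans_le
    (setIntegral_le_integral hfi (ae_of_all _ fun x => (hf x).le))
  have hκlim : Tendsto κ atTop (𝓝 1) := by
    have := (tendsto_setIntegral_cube hgi).div (tendsto_setIntegral_cube hfi) hI.ne'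
    rwa [← hmass, div_self hI.ne'] at this
  refine le_klInf_of_tendsto hr (C := max (κ₀ * C) C') (c := min c c') (lt_min hc hc')
    (p := fun n x => if x ∈ cube d n then κ n * f x else g x) (fun n => ?_) ?_
    (ae_of_all _ fun x => ?_) fun n => ?_
  · exact (((hfD.const_mul (hκ0 n).le).mono
      (mul_le_mul_of_nonneg_right (hκle n) hfD.const_nonneg) le_rfl).ite_box hgD _ _)
  · refine hfD.mono ?_ (min_le_left _ _)
    exact (le_mul_of_one_le_left hfD.const_nonneg (le_max_left _ _)).trans (le_max_left _ _)
  · have h := hκlim.mul_const (f x)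
    rw [one_mul] at h
    refine h.congr' ?_
    filter_upwards [eventually_mem_cube x] with n hn
    rw [if_pos hn]
  · refine klInf_le_replace_box hr (f := fun x => κ n * f x) (continuous_const.mul hfc) hgc
      (fun x => mul_pos (hκ0 n) (hf x)) hg ⟨_, c, hc, hfD.const_mul (hκ0 n).le⟩
      ⟨_, _, hc', hgD⟩ (fun i => ?_) ?_
    · linarith [(Nat.cast_nonneg n : (0 : ℝ) ≤ n)]
    · rw [integral_const_mul]
      exact div_mul_cancel₀ _ (hf0 n).ne'

/-! ### Competitors without continuity -/

lemma exists_continuous_tendsto_ae {q : EuclideanSpace ℝ (Fin d) → ℝ} (hq : Integrable q) :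
    ∃ f : ℕ → EuclideanSpace ℝ (Fin d) → ℝ, (∀ n, Continuous (f n)) ∧
      ∀ᵐ x, Tendsto (fun n => f n x) atTop (𝓝 (q x)) := by
  choose f hfs hfl hfc hfi using fun n : ℕ =>
    hq.exists_hasCompactSupport_lintegral_sub_le (ε := ((n : ENNReal) + 1)⁻¹) (by simp)
  have hL : Tendsto (fun n => eLpNorm (f n - q) 1 volume) atTop (𝓝 0) := by
    have h0 : Tendsto (fun n : ℕ => ((n : ENNReal) + 1)⁻¹) atTop (𝓝 0) := by
      have := (tendsto_add_atTop_iff_nat 1).2 ENNReal.tendsto_inv_nat_nhds_zero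
      simpa using this
    refine tendsto_of_tendsto_of_tendsto_of_le_of_le tendsto_const_nhds h0 (fun _ => zero_le)
      fun n => ?_
    rw [eLpNorm_one_eq_lintegral_enorm]
    refine le_trans (lintegral_mono fun x => ?_) (hfl n)
    rw [Pi.sub_apply, ← enorm_neg, neg_sub]
  obtain ⟨ns, -, hns⟩ := (tendstoInMeasure_of_tendsto_eLpNorm one_ne_zero
    (fun n => (hfi n).aestronglyMeasurable) hq.aestronglyMeasurable hL).exists_seq_tendsto_ae
  exact ⟨fun n => f (ns n), fun n => hfc _, hns⟩

lemma klInf_le_of_isDom {r : EuclideanSpace ℝ (Fin d) → ℝ} (hr : IsTarget r)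
    {q g : EuclideanSpace ℝ (Fin d) → ℝ} (hgc : Continuous g) (hg : ∀ x, 0 < g x)
    (hgd : HasGaussianDecay g) {C c : ℝ} (hc : 0 < c) (hq : IsDom C c q)
    (hmass : ∫ x, q x = ∫ x, g x) : klInf r g ≤ klInf r q := by
  have hC := hq.const_nonneg
  obtain ⟨f, hfc, hfl⟩ := exists_continuous_tendsto_ae (hq.integrable hc)
  set H : EuclideanSpace ℝ (Fin d) → ℝ := fun x => Real.exp (-(c * ‖x‖ ^ 2)) with hH
  have hHc : Continuous H := by simp only [hH]; fun_prop
  have hH0 : ∀ x, 0 < H x := fun x => Real.exp_pos _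
  -- Truncating by `C * H` restores the Gaussian majorant, which the L¹ approximants lack, and the
  -- small multiple of `H` makes the function strictly positive. Neither changes the limit.
  set h : ℕ → EuclideanSpace ℝ (Fin d) → ℝ := fun n x =>
    min |f n x| (C * H x) + ((n : ℝ) + 1)⁻¹ * H x with hh
  have hhc : ∀ n, Continuous (h n) := fun n => by
    have := hfc n
    simp only [hh]; fun_prop
  have hh0 : ∀ n x, 0 < h n x := fun n x => by
    have := hH0 x
    have h1 : 0 ≤ min |f n x| (C * H x) := le_min (abs_nonneg _) (by positivity)
    have h2 : 0 < ((n : ℝ) + 1)⁻¹ * H x := by positivity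
    exact add_pos_of_nonneg_of_pos h1 h2
  have hhD : ∀ n, IsDom (C + 1) c (h n) := fun n => by
    refine ⟨(hhc n).measurable, fun x => (hh0 n x).le, fun x => ?_⟩
    rw [add_mul, one_mul]
    refine add_le_add (min_le_right _ _) (mul_le_of_le_one_left (hH0 x).le ?_)
    exact inv_le_one_of_one_le₀ (by linarith [(Nat.cast_nonneg n : (0 : ℝ) ≤ n)])
  have hlim : ∀ᵐ x, Tendsto (fun n => h n x) atTop (𝓝 (q x)) := by
    filter_upwards [hfl] with x hx
    have h1 := (hx.abs.min (tendsto_const_nhds (x := C * H x))).add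
      ((tendsto_one_div_add_atTop_nhds_zero_nat (𝕜 := ℝ)).mul_const (H x))
    rw [abs_of_nonneg (hq.nonneg x), min_eq_left (hq.le x), zero_mul, add_zero] at h1
    simpa only [hh, one_div] using h1
  have hZ : Tendsto (fun n => ∫ x, h n x) atTop (𝓝 (∫ x, q x)) := by
    refine tendsto_integral_of_dominated_convergence (fun x => (C + 1) * H x)
      (fun n => (hhc n).aestronglyMeasurable)
      ((integrable_exp_neg_mul_norm_sq hc).const_mul _) (fun n => ae_of_all _ fun x => ?_) hlim
    rw [Real.norm_of_nonneg (hh0 n x).le]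
    exact (hhD n).le x
  have hgi : Integrable g := by
    obtain ⟨C', c', hc', hg'⟩ := hgd
    exact hg'.integrable hc'
  have hm : 0 < ∫ x, g x := (setIntegral_cube_pos hgi hg 0).trans_le
    (setIntegral_le_integral hgi (ae_of_all _ fun x => (hg x).le))
  set m := ∫ x, g x with hmdef
  rw [hmass] at hZ
  have hκ : Tendsto (fun n => m / ∫ x, h n x) atTop (𝓝 1) := by
    have := (tendsto_const_nhds (x := m)).div hZ hm.ne'
    rwa [div_self hm.ne'] at this
  -- Beyond `N` the mass-correcting factor is below 2, which gives one Gaussian majorant for the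
  -- whole shifted sequence.
  obtain ⟨N, hN⟩ := eventually_atTop.1 (hκ.eventually (gt_mem_nhds (show (1 : ℝ) < 2 by norm_num)))
  have hZ0 : ∀ n, 0 < ∫ x, h n x := fun n =>
    (setIntegral_cube_pos ((hhD n).integrable hc) (hh0 n) 0).trans_le
      (setIntegral_le_integral ((hhD n).integrable hc) (ae_of_all _ fun x => (hh0 n x).le))
  refine le_klInf_of_tendsto hr (C := 2 * (C + 1)) hc
    (p := fun n x => (m / ∫ x, h (n + N) x) * h (n + N) x) (fun n => ?_) ?_ ?_ fun n => ?_
  · exact ((hhD (n + N)).const_mul (div_pos hm (hZ0 _)).le).mono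
      (mul_le_mul_of_nonneg_right (hN (n + N) (Nat.le_add_left _ _)).le (by positivity)) le_rfl
  · exact hq.mono (by linarith) le_rfl
  · filter_upwards [hlim] with x hx
    have h1 := (hκ.mul hx).comp (tendsto_add_atTop_nat N)
    rwa [one_mul] at h1
  · refine klInf_le_of_continuous hr
      (f := fun x => (m / ∫ x, h (n + N) x) * h (n + N) x) (continuous_const.mul (hhc _)) hgc
      (fun x => mul_pos (div_pos hm (hZ0 _)) (hh0 _ x)) hg
      ⟨_, c, hc, (hhD (n + N)).const_mul (div_pos hm (hZ0 _)).le⟩ hgd ?_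
    rw [integral_const_mul]
    exact div_mul_cancel₀ _ (hZ0 _).ne'

/-! ### Vanishing of the infimal entropy -/

lemma klInf_eq_zero {r : EuclideanSpace ℝ (Fin d) → ℝ} (hr : IsTarget r) (hr1 : ∫ x, r x = 1)
    {g : EuclideanSpace ℝ (Fin d) → ℝ} (hgc : Continuous g) (hg : ∀ x, 0 < g x)
    (hgd : HasGaussianDecay g) (hg1 : ∫ x, g x = 1) : klInf r g = 0 := by
  set H : EuclideanSpace ℝ (Fin d) → ℝ := fun x => Real.exp (-(1 * ‖x‖ ^ 2)) with hH
  have hHm : Measurable H := by simp only [hH]; fun_prop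
  have hH0 : ∀ x, 0 < H x := fun x => Real.exp_pos _
  set h : ℕ → EuclideanSpace ℝ (Fin d) → ℝ := fun n x => min (r x) (((n : ℝ) + 1) * H x) with hh
  have hh0 : ∀ n x, 0 < h n x := fun n x => lt_min (hr.pos x) (mul_pos (by positivity) (hH0 x))
  have hhD : ∀ n : ℕ, IsDom ((n : ℝ) + 1) 1 (h n) := fun n =>
    ⟨hr.measurable.min (hHm.const_mul _), fun x => (hh0 n x).le, fun x => min_le_right _ _⟩
  have hhi := fun n => (hhD n).integrable one_pos
  have hZ0 : ∀ n, 0 < ∫ x, h n x := fun n =>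
    (setIntegral_cube_pos (hhi n) (hh0 n) 0).trans_le
      (setIntegral_le_integral (hhi n) (ae_of_all _ fun x => (hh0 n x).le))
  have hZ : Tendsto (fun n => ∫ x, h n x) atTop (𝓝 1) := by
    rw [← hr1]
    refine tendsto_integral_of_dominated_convergence r
      (fun n => (hhD n).measurable.aestronglyMeasurable) hr.integrable
      (fun n => ae_of_all _ fun x => ?_) (ae_of_all _ fun x => ?_)
    · rw [Real.norm_of_nonneg (hh0 n x).le]; exact min_le_left _ _
    · have h1 : Tendsto (fun n : ℕ => ((n : ℝ) + 1) * H x) atTop atTop :=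
        (tendsto_atTop_add_const_right _ _ tendsto_natCast_atTop_atTop).atTop_mul_const (hH0 x)
      refine tendsto_const_nhds.congr' ?_
      filter_upwards [h1.eventually_ge_atTop (r x)] with n hn
      exact (min_eq_left hn).symm
  have hlog : Tendsto (fun n => ENNReal.ofReal (-Real.log (∫ x, h n x))) atTop (𝓝 0) := by
    have := ENNReal.tendsto_ofReal ((hZ.log one_ne_zero).neg)
    simpa using this
  refine le_antisymm (ge_of_tendsto' hlog fun n => ?_) zero_le
  set Z := ∫ x, h n x with hZdef
  have hZpos : 0 < Z := hZ0 n
  have hqD := (hhD n).const_mul (inv_pos.2 hZpos).le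
  have hqi := hqD.integrable one_pos
  have hq1 : ∫ x, Z⁻¹ * h n x = 1 := by
    rw [integral_const_mul, ← hZdef, inv_mul_cancel₀ hZpos.ne']
  refine (klInf_le_of_isDom hr hgc hg hgd one_pos hqD (hq1.trans hg1.symm)).trans
    ((klInf_le_klDiv _ _).trans ?_)
  rw [klDiv_densityMeasure hqD.measurable hqD.nonneg hqi hr]
  -- Truncation gives q/r ≤ Z⁻¹ for the normalised truncation q. Both q and `r` have integral one,
  -- so the right side integrates to exactly -log Z.
  have hbound : ∀ x, r x * InformationTheory.klFun (Z⁻¹ * h n x / r x) ≤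
      (Z⁻¹ * h n x) * (-Real.log Z) + r x - Z⁻¹ * h n x := by
    intro x
    have hrx := hr.pos x
    have hq0 : 0 < Z⁻¹ * h n x := mul_pos (inv_pos.2 hZpos) (hh0 n x)
    have hle : Z⁻¹ * h n x / r x ≤ Z⁻¹ := by
      rw [div_le_iff₀ hrx]
      exact mul_le_mul_of_nonneg_left (min_le_left _ _) (inv_pos.2 hZpos).le
    have hl : Real.log (Z⁻¹ * h n x / r x) ≤ -Real.log Z := by
      rw [← Real.log_inv]
      exact Real.log_le_log (div_pos hq0 hrx) hle
    rw [InformationTheory.klFun_apply]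
    have h2 : r x * (Z⁻¹ * h n x / r x * Real.log (Z⁻¹ * h n x / r x) + 1 - Z⁻¹ * h n x / r x) =
        Z⁻¹ * h n x * Real.log (Z⁻¹ * h n x / r x) + r x - Z⁻¹ * h n x := by
      field_simp
    rw [h2]
    have := mul_le_mul_of_nonneg_left hl hq0.le
    linarith
  have hbi : Integrable fun x => (Z⁻¹ * h n x) * (-Real.log Z) + r x - Z⁻¹ * h n x :=
    ((hqi.mul_const _).add hr.integrable).sub hqi
  have hb0 : ∀ x, 0 ≤ (Z⁻¹ * h n x) * (-Real.log Z) + r x - Z⁻¹ * h n x := fun x =>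
    (mul_nonneg (hr.pos x).le (InformationTheory.klFun_nonneg
      (div_nonneg (hqD.nonneg x) (hr.pos x).le))).trans (hbound x)
  refine (lintegral_mono fun x => ENNReal.ofReal_le_ofReal (hbound x)).trans ?_
  rw [← ofReal_integral_eq_lintegral_ofReal hbi (ae_of_all _ hb0)]
  refine ENNReal.ofReal_le_ofReal (le_of_eq ?_)
  have e1 := integral_sub ((hqi.mul_const (-Real.log Z)).add hr.integrable) hqi
  simp only [Pi.add_apply] at e1
  rw [e1, integral_add (hqi.mul_const _) hr.integrable, integral_mul_const, hq1, hr1]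
  ring

/-! ### The density of a nondegenerate Gaussian measure -/

lemma isDom_stdGaussianDensity (d : ℕ) : IsDom (d := d) ((2 * Real.pi) ^ ((d : ℝ) / 2))⁻¹ (1 / 2)
    fun x => ((2 * Real.pi) ^ ((d : ℝ) / 2))⁻¹ * Real.exp (-(1 / 2 * ‖x‖ ^ 2)) where
  measurable := by fun_prop
  nonneg x := by positivity
  le x := le_rfl

/-- Both finite measures have the same characteristic function, by the Fourier transform of a
Gaussian. -/
lemma stdGaussian_eq_densityMeasure (d : ℕ) :
    ProbabilityTheory.stdGaussian (EuclideanSpace ℝ (Fin d)) = densityMeasure fun x =>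
      ((2 * Real.pi) ^ ((d : ℝ) / 2))⁻¹ * Real.exp (-(1 / 2 * ‖x‖ ^ 2)) := by
  have hD := isDom_stdGaussianDensity d
  have := isFiniteMeasure_densityMeasure (hD.integrable (by norm_num))
  refine Measure.ext_of_charFun ?_
  ext t
  rw [ProbabilityTheory.charFun_stdGaussian, charFun_apply, densityMeasure,
    integral_withDensity_eq_integral_toReal_smul hD.measurable.ennreal_ofReal
      (ae_of_all _ fun _ => ENNReal.ofReal_lt_top)]
  have h := GaussianFourier.integral_cexp_neg_mul_sq_norm_add (b := 1 / 2)
    (V := EuclideanSpace ℝ (Fin d)) (by norm_num) Complex.I t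
  have hk : ((Real.pi : ℂ) / (1 / 2)) ^ ((Module.finrank ℝ (EuclideanSpace ℝ (Fin d)) : ℂ) / 2) =
      (((2 * Real.pi) ^ ((d : ℝ) / 2) : ℝ) : ℂ) := by
    rw [Complex.ofReal_cpow (by positivity)]
    simp only [finrank_euclideanSpace, Fintype.card_fin]
    push_cast
    congr 1
    ring
  rw [hk] at h
  have hk0 : (((2 * Real.pi) ^ ((d : ℝ) / 2) : ℝ) : ℂ) ≠ 0 := by
    rw [Complex.ofReal_ne_zero]; positivity
  have h2 : ∀ x : EuclideanSpace ℝ (Fin d),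
      (ENNReal.ofReal (((2 * Real.pi) ^ ((d : ℝ) / 2))⁻¹ *
        Real.exp (-(1 / 2 * ‖x‖ ^ 2)))).toReal • Complex.exp ((inner ℝ x t : ℝ) * Complex.I) =
      (((2 * Real.pi) ^ ((d : ℝ) / 2) : ℝ) : ℂ)⁻¹ *
        Complex.exp (-(1 / 2) * ‖x‖ ^ 2 + Complex.I * (inner ℝ t x : ℝ)) := by
    intro x
    rw [ENNReal.toReal_ofReal (hD.nonneg x), Complex.real_smul, Complex.exp_add, real_inner_comm]
    push_cast
    rw [mul_comm Complex.I, mul_assoc]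
    congr 3
    ring_nf
  simp_rw [h2]
  rw [integral_const_mul, h, inv_mul_cancel_left₀ hk0, Complex.I_sq]
  congr 1
  ring

lemma hasJac_affine (L : EuclideanSpace ℝ (Fin d) ≃L[ℝ] EuclideanSpace ℝ (Fin d))
    (m : EuclideanSpace ℝ (Fin d)) :
    HasJac (L.toHomeomorph.trans (Homeomorph.addLeft m))
      fun _ => |(LinearMap.det (L.toLinearEquiv : EuclideanSpace ℝ (Fin d) →ₗ[ℝ]
        EuclideanSpace ℝ (Fin d)))⁻¹| where
  measurable := measurable_const
  nonneg _ := abs_nonneg _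
  bounded := ⟨_, fun _ => le_rfl⟩
  map_volume := by
    have hdet := (LinearEquiv.isUnit_det' L.toLinearEquiv).ne_zero
    have h1 := Measure.map_linearMap_addHaar_eq_smul_addHaar
      (volume : Measure (EuclideanSpace ℝ (Fin d))) hdet
    have h2 : (⇑(L.toHomeomorph.trans (Homeomorph.addLeft m))) = (fun x => m + x) ∘
        ⇑(L.toLinearEquiv : EuclideanSpace ℝ (Fin d) →ₗ[ℝ] EuclideanSpace ℝ (Fin d)) := rfl
    have hL : Measurable ⇑(L.toLinearEquiv : EuclideanSpace ℝ (Fin d) →ₗ[ℝ]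
        EuclideanSpace ℝ (Fin d)) := L.continuous.measurable
    rw [h2, ← Measure.map_map (measurable_const_add m) hL, h1, Measure.map_smul,
      map_add_left_eq_self, densityMeasure, withDensity_const]

open scoped MatrixOrder in
-- The measure is the image of the standard Gaussian under x ↦ m + S^{1/2} x. Positive definiteness
-- makes the square root invertible, so the density is the standard one transported by an affine
-- homeomorphism.
lemma exists_gaussian_density (m : EuclideanSpace ℝ (Fin d)) {S : Matrix (Fin d) (Fin d) ℝ}
    (hS : S.PosDef) : ∃ g : EuclideanSpace ℝ (Fin d) → ℝ, Continuous g ∧ (∀ x, 0 < g x) ∧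
      HasGaussianDecay g ∧ ProbabilityTheory.multivariateGaussian m S = densityMeasure g := by
  have hu : IsUnit (CFC.sqrt S) := (CFC.isUnit_sqrt_iff S hS.posSemidef.nonneg).2 hS.isUnit
  obtain ⟨U, hU⟩ := hu.map (Matrix.toEuclideanCLM (n := Fin d) (𝕜 := ℝ))
  set L := ContinuousLinearEquiv.ofUnit U with hL
  have hLx : ∀ x, L x = Matrix.toEuclideanCLM (n := Fin d) (𝕜 := ℝ) (CFC.sqrt S) x := by
    intro x; rw [← hU]; rfl
  have hJ := hasJac_affine L m
  set F := L.toHomeomorph.trans (Homeomorph.addLeft m) with hF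
  set D := |(LinearMap.det (L.toLinearEquiv : EuclideanSpace ℝ (Fin d) →ₗ[ℝ]
        EuclideanSpace ℝ (Fin d)))⁻¹| with hDdef
  have hD0 : 0 < D := abs_pos.2 (inv_ne_zero (LinearEquiv.isUnit_det' L.toLinearEquiv).ne_zero)
  have hstd := isDom_stdGaussianDensity d
  have hgrow : ∀ x, ‖F x‖ ≤ (‖(L : EuclideanSpace ℝ (Fin d) →L[ℝ] EuclideanSpace ℝ (Fin d))‖ + 1) *
      ‖x‖ + ‖m‖ := by
    intro x
    have h1 : F x = m + L x := rfl
    rw [h1]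
    refine (norm_add_le _ _).trans ?_
    have h2 := (L : EuclideanSpace ℝ (Fin d) →L[ℝ] EuclideanSpace ℝ (Fin d)).le_opNorm x
    have h3 : ‖(L : EuclideanSpace ℝ (Fin d) →L[ℝ] EuclideanSpace ℝ (Fin d)) x‖ = ‖L x‖ := rfl
    nlinarith [norm_nonneg x]
  refine ⟨fun y => ((2 * Real.pi) ^ ((d : ℝ) / 2))⁻¹ *
    Real.exp (-(1 / 2 * ‖F.symm y‖ ^ 2)) * D, ?_, fun x => by positivity, ?_, ?_⟩
  · have := F.symm.continuous
    fun_prop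
  · exact ⟨_, _, by positivity, hstd.push (by norm_num) hJ (fun _ => le_rfl) (by positivity) hgrow⟩
  · rw [← hJ.map_densityMeasure hstd.measurable, ← stdGaussian_eq_densityMeasure,
      ProbabilityTheory.multivariateGaussian]
    congr 1
    ext1 x
    rw [← hLx]; rfl

/-! ### Target densities -/

/-- The lower bound on the logarithm is the Gaussian tail; the upper one is log t ≤ t - 1. -/
lemma abs_log_le_of_tail {ρs : EuclideanSpace ℝ (Fin d) → ℝ} {M σ : ℝ} (hσ : 0 < σ)
    (htail : ∀ x, M ≤ ‖x‖ → isoGaussianDensity σ x ≤ ρs x) {x : EuclideanSpace ℝ (Fin d)}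
    (hx : M ≤ ‖x‖) (hpos : 0 < ρs x) :
    |Real.log (ρs x)| ≤ ρs x + |Real.log ((2 * Real.pi * σ ^ 2) ^ ((d : ℝ) / 2))| +
      (2 * σ ^ 2)⁻¹ * ‖x‖ ^ 2 := by
  have h0 : 0 < (2 * Real.pi * σ ^ 2) ^ ((d : ℝ) / 2) := by positivity
  have hiso : 0 < isoGaussianDensity σ x := by unfold isoGaussianDensity; positivity
  have h1 := Real.log_le_log hiso (htail x hx)
  rw [isoGaussianDensity, Real.log_mul (by positivity) (Real.exp_pos _).ne', Real.log_exp,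
    one_div, Real.log_inv] at h1
  have h2 := le_abs_self (Real.log ((2 * Real.pi * σ ^ 2) ^ ((d : ℝ) / 2)))
  have h3 := Real.log_le_sub_one_of_pos hpos
  have h4 : -‖x‖ ^ 2 / (2 * σ ^ 2) = -((2 * σ ^ 2)⁻¹ * ‖x‖ ^ 2) := by field_simp
  have h5 : 0 ≤ (2 * σ ^ 2)⁻¹ * ‖x‖ ^ 2 := by positivity
  have h6 := abs_nonneg (Real.log ((2 * Real.pi * σ ^ 2) ^ ((d : ℝ) / 2)))
  rw [abs_le]
  constructor <;> linarith

lemma integrable_norm_sq_mul_exp {c : ℝ} (hc : 0 < c) :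
    Integrable fun x : EuclideanSpace ℝ (Fin d) => ‖x‖ ^ 2 * Real.exp (-(c * ‖x‖ ^ 2)) := by
  refine ((integrable_exp_neg_mul_norm_sq (half_pos hc)).const_mul (2 / c)).mono'
    (by fun_prop) (ae_of_all _ fun x => ?_)
  rw [Real.norm_of_nonneg (by positivity)]
  have h1 : c / 2 * ‖x‖ ^ 2 ≤ Real.exp (c / 2 * ‖x‖ ^ 2) :=
    (by linarith : c / 2 * ‖x‖ ^ 2 ≤ c / 2 * ‖x‖ ^ 2 + 1).trans (Real.add_one_le_exp _)
  have h2 : Real.exp (-(c * ‖x‖ ^ 2)) =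
      Real.exp (-(c / 2 * ‖x‖ ^ 2)) * Real.exp (-(c / 2 * ‖x‖ ^ 2)) := by
    rw [← Real.exp_add]; ring_nf
  have h3 : c / 2 * ‖x‖ ^ 2 * Real.exp (-(c / 2 * ‖x‖ ^ 2)) ≤ 1 := by
    rw [Real.exp_neg, ← div_eq_mul_inv, div_le_one (Real.exp_pos _)]
    exact h1
  calc ‖x‖ ^ 2 * Real.exp (-(c * ‖x‖ ^ 2))
      = 2 / c * (c / 2 * ‖x‖ ^ 2 * Real.exp (-(c / 2 * ‖x‖ ^ 2))) *
          Real.exp (-(c / 2 * ‖x‖ ^ 2)) := by rw [h2]; field_simp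
    _ ≤ 2 / c * 1 * Real.exp (-(c / 2 * ‖x‖ ^ 2)) := by gcongr
    _ = _ := by ring

/-- Inside the ball of radius `M` local integrability is enough; outside, the logarithm is at most
ρ_* plus a quadratic, which a Gaussian weight integrates. -/
lemma integrable_exp_mul_abs_log {ρs : EuclideanSpace ℝ (Fin d) → ℝ} (hρi : Integrable ρs)
    (hpos : ∀ᵐ x, 0 < ρs x) (hlog : LocallyIntegrable (fun x => Real.log (ρs x)))
    {M σ : ℝ} (hσ : 0 < σ) (htail : ∀ x, M ≤ ‖x‖ → isoGaussianDensity σ x ≤ ρs x)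
    {c : ℝ} (hc : 0 < c) :
    Integrable fun x => Real.exp (-(c * ‖x‖ ^ 2)) * |Real.log (ρs x)| := by
  set K := |Real.log ((2 * Real.pi * σ ^ 2) ^ ((d : ℝ) / 2))| with hK
  have hball : Integrable ((Metric.closedBall (0 : EuclideanSpace ℝ (Fin d)) M).indicator
      fun x => |Real.log (ρs x)|) :=
    (integrable_indicator_iff measurableSet_closedBall).2
      (hlog.integrableOn_isCompact (isCompact_closedBall 0 M)).abs
  have hbound := ((hball.add hρi).add ((integrable_exp_neg_mul_norm_sq (d := d) hc).const_mul K)).add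
    ((integrable_norm_sq_mul_exp (d := d) hc).const_mul (2 * σ ^ 2)⁻¹)
  refine hbound.mono' ?_ ?_
  · exact (by fun_prop : AEStronglyMeasurable
      (fun x : EuclideanSpace ℝ (Fin d) => Real.exp (-(c * ‖x‖ ^ 2)))).mul
      hlog.aestronglyMeasurable.norm
  · filter_upwards [hpos] with x hx
    have he : Real.exp (-(c * ‖x‖ ^ 2)) ≤ 1 := Real.exp_le_one_iff.2 (by simp; positivity)
    have he0 := Real.exp_pos (-(c * ‖x‖ ^ 2))
    have hr1 : 0 ≤ K * Real.exp (-(c * ‖x‖ ^ 2)) := by positivity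
    have hr2 : 0 ≤ (2 * σ ^ 2)⁻¹ * (‖x‖ ^ 2 * Real.exp (-(c * ‖x‖ ^ 2))) := by positivity
    rw [Real.norm_of_nonneg (by positivity)]
    simp only [Pi.add_apply]
    by_cases hM : x ∈ Metric.closedBall (0 : EuclideanSpace ℝ (Fin d)) M
    · rw [Set.indicator_of_mem hM]
      have := mul_le_of_le_one_left (abs_nonneg (Real.log (ρs x))) he
      linarith
    · rw [Set.indicator_of_notMem hM]
      have hMx : M ≤ ‖x‖ := by
        rw [mem_closedBall_zero_iff, not_le] at hM; exact hM.le
      have h1 := mul_le_mul_of_nonneg_left (abs_log_le_of_tail hσ htail hMx hx) he0.le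
      have h2 := mul_le_of_le_one_left hx.le he
      rw [← hK] at h1
      nlinarith

/-- Take a measurable version and put the value 1 where it fails to be positive; this alters only a
null set. -/
lemma exists_isTarget {ρs : EuclideanSpace ℝ (Fin d) → ℝ} (hρs : IsProbDensity ρs)
    (hpos : ∀ᵐ x, 0 < ρs x) (hlog : LocallyIntegrable (fun x => Real.log (ρs x)))
    {M σ : ℝ} (hσ : 0 < σ) (htail : ∀ x, M ≤ ‖x‖ → isoGaussianDensity σ x ≤ ρs x) :
    ∃ r, IsTarget r ∧ r =ᵐ[volume] ρs := by
  classical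
  set f := hρs.integrable.aestronglyMeasurable.mk ρs with hf
  have hfm : Measurable f := hρs.integrable.aestronglyMeasurable.stronglyMeasurable_mk.measurable
  have hfe : ρs =ᵐ[volume] f := hρs.integrable.aestronglyMeasurable.ae_eq_mk
  have hre : (fun x => if 0 < f x then f x else 1) =ᵐ[volume] ρs := by
    filter_upwards [hfe, hpos] with x h1 h2
    rw [← h1, if_pos h2]
  refine ⟨fun x => if 0 < f x then f x else 1, ⟨?_, fun x => ?_, hρs.integrable.congr hre.symm, ?_⟩,
    hre⟩
  · exact Measurable.ite (measurableSet_lt measurable_const hfm) hfm measurable_const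
  · split_ifs with h
    · exact h
    · exact one_pos
  · intro c hc
    refine (integrable_exp_mul_abs_log hρs.integrable hpos hlog hσ htail hc).congr ?_
    filter_upwards [hre] with x hx
    rw [hx]

/-! ### The relative entropy as a Bochner integral -/

lemma integral_densityMeasure {p : EuclideanSpace ℝ (Fin d) → ℝ} (hp : IsNice p)
    {u : EuclideanSpace ℝ (Fin d) → ℝ} :
    ∫ x, u x ∂(densityMeasure p) = ∫ x, p x * u x := by
  rw [densityMeasure, integral_withDensity_eq_integral_toReal_smul hp.measurable.ennreal_ofReal
    (ae_of_all _ fun _ => ENNReal.ofReal_lt_top)]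
  refine integral_congr_ae (ae_of_all _ fun x => ?_)
  simp [ENNReal.toReal_ofReal (hp.nonneg x)]

lemma integrable_densityMeasure_iff {p : EuclideanSpace ℝ (Fin d) → ℝ} (hp : IsNice p)
    {u : EuclideanSpace ℝ (Fin d) → ℝ} :
    Integrable u (densityMeasure p) ↔ Integrable fun x => p x * u x := by
  rw [densityMeasure, integrable_withDensity_iff_integrable_smul' hp.measurable.ennreal_ofReal
    (ae_of_all _ fun _ => ENNReal.ofReal_lt_top)]
  refine integrable_congr (ae_of_all _ fun x => ?_)
  simp [ENNReal.toReal_ofReal (hp.nonneg x)]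

lemma llr_densityMeasure {p r : EuclideanSpace ℝ (Fin d) → ℝ} (hp : IsNice p) (hr : IsTarget r) :
    llr (densityMeasure p) (densityMeasure r) =ᵐ[densityMeasure p]
      fun x => Real.log (p x / r x) := by
  have := isFiniteMeasure_densityMeasure hr.integrable
  have heq := densityMeasure_eq_withDensity hp.measurable hr.measurable hr.pos
  have hac : densityMeasure p ≪ densityMeasure r := by
    rw [heq]; exact withDensity_absolutelyContinuous _ _
  have hrn : (densityMeasure p).rnDeriv (densityMeasure r) =ᵐ[densityMeasure r]
      fun x => ENNReal.ofReal (p x / r x) := by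
    conv_lhs => rw [heq]
    exact Measure.rnDeriv_withDensity _ (hp.measurable.div hr.measurable).ennreal_ofReal
  filter_upwards [hac.ae_le hrn] with x hx
  rw [llr, hx, ENNReal.toReal_ofReal (div_nonneg (hp.nonneg x) (hr.pos x).le)]

/-- For finite measures `klDiv` carries a correction by the difference of masses; equality of the
masses removes it and leaves the integral of the log-ratio. -/
lemma integrable_and_integral_of_klDiv_lt_top {p r : EuclideanSpace ℝ (Fin d) → ℝ}
    (hp : IsNice p) (hr : IsTarget r)
    (hmass : densityMeasure p Set.univ = densityMeasure r Set.univ)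
    (hkl : InformationTheory.klDiv (densityMeasure p) (densityMeasure r) ≠ ⊤) :
    Integrable (fun x => p x * Real.log (p x / r x)) ∧
      ∫ x, p x * Real.log (p x / r x) =
        (InformationTheory.klDiv (densityMeasure p) (densityMeasure r)).toReal := by
  have := isFiniteMeasure_densityMeasure hr.integrable
  have := isFiniteMeasure_densityMeasure hp.integrable
  obtain ⟨hac, hint⟩ := InformationTheory.klDiv_ne_top_iff.1 hkl
  have hllr := llr_densityMeasure hp hr
  refine ⟨(integrable_densityMeasure_iff hp).1 (hint.congr hllr), ?_⟩
  rw [InformationTheory.toReal_klDiv_of_measure_eq hac hmass, integral_congr_ae hllr,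
    integral_densityMeasure hp]

lemma IsContinuitySolution.congr_initial {T : ℝ} {θ : ℝ → Param d}
    {ρ₀ ρ₁ : EuclideanSpace ℝ (Fin d) → ℝ} {ρ : ℝ → EuclideanSpace ℝ (Fin d) → ℝ}
    (h : IsContinuitySolution T θ ρ₀ ρ) (he : ρ₀ =ᵐ[volume] ρ₁) :
    IsContinuitySolution T θ ρ₁ ρ where
  integrable := h.integrable
  bounded := h.bounded
  continuous := h.continuous
  initial := h.initial.trans he
  weak φ hφ hc t ht := by
    rw [h.weak φ hφ hc t ht]
    congr 1
    refine integral_congr_ae ?_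
    filter_upwards [he] with x hx
    rw [hx]

lemma densityMeasure_univ {p : EuclideanSpace ℝ (Fin d) → ℝ} (hp : Integrable p)
    (hp0 : ∀ x, 0 ≤ p x) : densityMeasure p Set.univ = ENNReal.ofReal (∫ x, p x) := by
  rw [densityMeasure_apply _ MeasurableSet.univ, setLIntegral_univ,
    ofReal_integral_eq_lintegral_ofReal hp (ae_of_all _ hp0)]

end NeuralTransport

/-! ### Conclusion -/

theorem theorem2 {d : ℕ} (mB : EuclideanSpace ℝ (Fin d)) (SB : Matrix (Fin d) (Fin d) ℝ)
    (hSB : SB.PosDef) (μB : Measure (EuclideanSpace ℝ (Fin d)))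
    (hμB : μB = ProbabilityTheory.multivariateGaussian mB SB)
    (ρs : EuclideanSpace ℝ (Fin d) → ℝ) (hρs : IsProbDensity ρs)
    (hent : Integrable (fun x => ρs x * Real.log (ρs x)))
    (hpos : ∀ᵐ x, 0 < ρs x) (hlog : LocallyIntegrable (fun x => Real.log (ρs x)))
    (M : ℝ) (hM : 0 < M) (σ : ℝ) (hσ : 0 < σ)
    (htail : ∀ x, M ≤ ‖x‖ → isoGaussianDensity σ x ≤ ρs x)
    (T : ℝ) (hT : 0 < T) (ε : ℝ) (hε : 0 < ε) :
    ∃ (θ : ℝ → Param d) (Φ : ℝ → EuclideanSpace ℝ (Fin d) → EuclideanSpace ℝ (Fin d))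
      (ρ : ℝ → EuclideanSpace ℝ (Fin d) → ℝ),
      IsPiecewiseConstant T θ ∧ IsFlow T θ Φ ∧
      IsContinuitySolution T θ (fun x => (μB.rnDeriv volume x).toReal) ρ ∧
      IsProbDensity (ρ T) ∧ μB.map (Φ T) = densityMeasure (ρ T) ∧
      Integrable (fun x => ρ T x * Real.log (ρ T x / ρs x)) ∧
      ∫ x, ρ T x * Real.log (ρ T x / ρs x) ≤ ε ∧
      InformationTheory.klDiv (μB.map (Φ T)) (densityMeasure ρs) ≤ ENNReal.ofReal ε := by
  obtain ⟨r, hr, hre⟩ := exists_isTarget hρs hpos hlog hσ htail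
  have hrs : densityMeasure ρs = densityMeasure r := by
    refine withDensity_congr_ae ?_
    filter_upwards [hre] with x hx
    rw [hx]
  have hr1 : ∫ x, r x = 1 := (integral_congr_ae hre).trans hρs.integral_eq_one
  obtain ⟨g, hgc, hg, hgd, hgμ⟩ := exists_gaussian_density mB hSB
  rw [← hμB] at hgμ
  have hprob : IsProbabilityMeasure μB := by rw [hμB]; infer_instance
  have hgn : IsNice g := by
    obtain ⟨C, c, hc, h⟩ := hgd
    exact h.isNice hc
  have hg1 : ∫ x, g x = 1 := by
    have h1 := densityMeasure_univ hgn.integrable hgn.nonneg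
    rw [← hgμ, measure_univ, eq_comm, ENNReal.ofReal_eq_one] at h1
    exact h1
  have hkl : klInf r g < ENNReal.ofReal ε := by
    rw [klInf_eq_zero hr hr1 hgc hg hgd hg1]
    exact ENNReal.ofReal_pos.2 hε
  -- The strict inequality selects a single group element with divergence below ε, which a control
  -- then realises in time `T`.
  simp only [klInf, iInf_lt_iff] at hkl
  obtain ⟨F, hF, hlt⟩ := hkl
  obtain ⟨θ, Φ, ρ, h⟩ := steerable_of_mem hF T hT g hgn
  have hmap : μB.map (Φ T) = densityMeasure (ρ T) := by
    rw [h.flow_end, hgμ, h.map_eq]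
  have hFm : Measurable F := F.continuous.measurable
  have huniv : densityMeasure (ρ T) Set.univ = 1 := by
    rw [← hmap, h.flow_end, Measure.map_apply hFm MeasurableSet.univ, Set.preimage_univ,
      measure_univ]
  have hρ1 : ∫ x, ρ T x = 1 := by
    have h1 := densityMeasure_univ h.nice_end.integrable h.nice_end.nonneg
    rw [huniv, eq_comm, ENNReal.ofReal_eq_one] at h1
    exact h1
  have hru : densityMeasure r Set.univ = 1 := by
    rw [densityMeasure_univ hr.integrable fun x => (hr.pos x).le, hr1, ENNReal.ofReal_one]
  rw [h.map_eq] at hlt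
  obtain ⟨hi, he⟩ := integrable_and_integral_of_klDiv_lt_top h.nice_end hr
    (huniv.trans hru.symm) hlt.ne_top
  have hae : (fun x => ρ T x * Real.log (ρ T x / r x)) =ᵐ[volume]
      fun x => ρ T x * Real.log (ρ T x / ρs x) := by
    filter_upwards [hre] with x hx
    rw [hx]
  have hrn : g =ᵐ[volume] fun x => (μB.rnDeriv volume x).toReal := by
    have h1 := Measure.rnDeriv_withDensity (volume : Measure (EuclideanSpace ℝ (Fin d)))
      hgn.measurable.ennreal_ofReal
    rw [← densityMeasure, ← hgμ] at h1
    filter_upwards [h1] with x hx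
    rw [hx, ENNReal.toReal_ofReal (hg x).le]
  refine ⟨θ, Φ, ρ, h.isPiecewiseConstant, h.isFlow, h.isSolution.congr_initial hrn,
    ⟨h.nice_end.nonneg, h.nice_end.integrable, hρ1⟩, hmap, hi.congr hae, ?_, ?_⟩
  · rw [← integral_congr_ae hae, he]
    exact ENNReal.toReal_le_of_le_ofReal hε.le hlt.le
  · rw [hmap, hrs]
    exact hlt.le
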